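/- A noncrossing geometric tree $T$ is a finite tree whose vertices are distinct points of the plane and whose edges are straight line segments, two distinct edges meeting only at a common endpoint. (Such a tree is a noncrossing covering tree for every set $S$ of points all of which lie at its vertices or on its edges.) A segment of $T$ is a path, with at least one edge, all of whose edges lie on one line; two edge-disjoint segments cross if some vertex lies in the interior of both. Let $\mathcal{M}$ be a partition of the edges of $T$ into the minimum possible number $s$ of pairwise noncrossing segments. A fork is a vertex $v$ that lies in the interior of a segment $ab\in\mathcal{M}$ and is an endpoint of another segment in $\mathcal{M}$; its multiplicity is $2$ if it is an endpoint of two segments in $\mathcal{M}$ that lie on opposite sides of the line through $a$ and $b$, and $1$ otherwise. Let $t$ be the sum of the multiplicities of all forks. If $s\ge 2$, then for every $\varepsilon>0$ there is a simple polygon $P$ with exactly $2s+t$ vertices (distinct, with no three consecutive ones collinear) such that the area of the closed region bounded by $P$ is at most $\varepsilon$ and $T$ is contained in this closed region. -/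

import Mathlib

open scoped EuclideanGeometry

/-- The Euclidean plane. -/
abbrev Plane : Type := EuclideanSpace ℝ (Fin 2)

/-- A noncrossing geometric tree (plane straight-line tree): a tree whose vertices are distinct
points of the plane and whose edges are drawn as straight line segments, such that two distinct
edges meet only in the position of a vertex common to both. -/
structure PlaneTree (V : Type*) where
  graph : SimpleGraph V
  isTree : graph.IsTree
  pos : V → Plane
  pos_injective : Function.Injective pos
  noncrossing : ∀ u v x y : V, graph.Adj u v → graph.Adj x y → s(u, v) ≠ s(x, y) →
    segment ℝ (pos u) (pos v) ∩ segment ℝ (pos x) (pos y) ⊆ pos '' ({u, v} ∩ {x, y})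

namespace PlaneTree

variable {V : Type*}

/-- The set of points of the plane occupied by the vertices and edges of the tree. -/
def carrier (T : PlaneTree V) : Set Plane :=
  Set.range T.pos ∪ {p | ∃ u v : V, T.graph.Adj u v ∧ p ∈ segment ℝ (T.pos u) (T.pos v)}

/-- `σ` is the set of edges of a path of the tree that joins two distinct vertices `a` and `b` and
all of whose vertices lie on one line. -/
def IsSegmentBetween (T : PlaneTree V) (a b : V) (σ : Finset (Sym2 V)) : Prop :=
  a ≠ b ∧ ∃ w : T.graph.Walk a b, w.IsPath ∧ (∀ e : Sym2 V, e ∈ σ ↔ e ∈ w.edges) ∧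
    Collinear ℝ (T.pos '' {x : V | x ∈ w.support})

/-- A segment of the tree: a path, with at least one edge, of collinear edges, given by its set of
edges. -/
def IsSegment (T : PlaneTree V) (σ : Finset (Sym2 V)) : Prop :=
  ∃ a b : V, T.IsSegmentBetween a b σ

/-- The vertex `v` is an endpoint of the segment `σ`. -/
def IsEndpoint (T : PlaneTree V) (v : V) (σ : Finset (Sym2 V)) : Prop :=
  ∃ b : V, T.IsSegmentBetween v b σ

/-- The vertex `v` lies in the interior of the segment `σ`. -/
def IsInterior (T : PlaneTree V) (v : V) (σ : Finset (Sym2 V)) : Prop :=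
  (∃ e ∈ σ, v ∈ e) ∧ ¬ T.IsEndpoint v σ

/-- Two edge-disjoint segments of the tree can only meet in a vertex, and they cross exactly if
they meet in a vertex that lies in the interior of both. -/
def Cross (T : PlaneTree V) (σ τ : Finset (Sym2 V)) : Prop :=
  ∃ v : V, T.IsInterior v σ ∧ T.IsInterior v τ

/-- `M` is a partition of the edges of the tree into pairwise noncrossing segments. -/
structure IsSegmentPartition (T : PlaneTree V) (M : Finset (Finset (Sym2 V))) : Prop where
  isSegment : ∀ σ ∈ M, T.IsSegment σ
  existsUnique_mem : ∀ e ∈ T.graph.edgeSet, ∃! σ : Finset (Sym2 V), σ ∈ M ∧ e ∈ σ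
  not_cross : ∀ σ ∈ M, ∀ τ ∈ M, σ ≠ τ → ¬ T.Cross σ τ

/-- `M` is a partition of the edges of the tree into the minimum number of pairwise noncrossing
segments. -/
def IsMinimumSegmentPartition (T : PlaneTree V) (M : Finset (Finset (Sym2 V))) : Prop :=
  T.IsSegmentPartition M ∧
    ∀ M' : Finset (Finset (Sym2 V)), T.IsSegmentPartition M' → M.card ≤ M'.card

/-- A fork: a vertex in the interior of one segment of `M` that is an endpoint of another one. -/
def IsFork (T : PlaneTree V) (M : Finset (Finset (Sym2 V))) (v : V) : Prop :=
  ∃ σ ∈ M, T.IsInterior v σ ∧ ∃ τ ∈ M, τ ≠ σ ∧ T.IsEndpoint v τ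

/-- A fork in the interior of a segment `ab` of `M` that is the endpoint of two segments `vc` and
`vd` of `M` on opposite sides of the supporting line of `ab`. -/
def IsTwoSidedFork (T : PlaneTree V) (M : Finset (Finset (Sym2 V))) (v : V) : Prop :=
  ∃ σ ∈ M, T.IsInterior v σ ∧ ∃ a b : V, T.IsSegmentBetween a b σ ∧
    ∃ τ₁ ∈ M, ∃ τ₂ ∈ M, ∃ c d : V, T.IsSegmentBetween v c τ₁ ∧ T.IsSegmentBetween v d τ₂ ∧
      line[ℝ, T.pos a, T.pos b].SOppSide (T.pos c) (T.pos d)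

open Classical in
/-- The multiplicity of a vertex as a fork; it is zero for a vertex that is not a fork. -/
noncomputable def forkMultiplicity (T : PlaneTree V) (M : Finset (Finset (Sym2 V))) (v : V) : ℕ :=
  if T.IsTwoSidedFork M v then 2 else if T.IsFork M v then 1 else 0

/-- The sum of the multiplicities of all forks. -/
noncomputable def forkSum [Fintype V] (T : PlaneTree V) (M : Finset (Finset (Sym2 V))) : ℕ :=
  ∑ v : V, T.forkMultiplicity M v

end PlaneTree

namespace Polygon

variable {n : ℕ}

/-- A simple polygon with exactly `n` vertices: the `n ≥ 3` vertices are distinct, each of them is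
a genuine corner (three consecutive vertices are not collinear), and two distinct edges meet only
in a common endpoint. -/
structure IsSimple (P : Polygon Plane n) : Prop where
  three_le : 3 ≤ n
  injective : Function.Injective P.vertices
  corner : ∀ i : Fin n,
    AffineIndependent ℝ ![P i, P (finRotate n i), P (finRotate n (finRotate n i))]
  edges_inter : ∀ i j : Fin n, i ≠ j →
    P.edgeSet ℝ i ∩ P.edgeSet ℝ j ⊆ P.vertices '' ({i, finRotate n i} ∩ {j, finRotate n j})

/-- The closed region bounded by a polygon: its boundary together with the points whose connected
component in the complement of the boundary is bounded. -/
def region (P : Polygon Plane n) : Set Plane :=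
  P.boundary ℝ ∪
    {x | x ∉ P.boundary ℝ ∧ Bornology.IsBounded (connectedComponentIn (P.boundary ℝ)ᶜ x)}

end Polygon

/-! The polygon is drawn tightly around the tree. A dart `d` also stands for the corner between `d`
and the next dart `T.rot d` counterclockwise around `d.fst`. Every edge of a tree is a bridge, so
the boundary walk `T.face` is a single cycle through all darts (`exists_face_iterate_eq`). Ignoring
straight corners turns it into a cycle of straight stretches between the proper corners `T.kept`.
For small δ > 0 each proper corner is pushed off its vertex by δ along the bisector of its angle (at
a leaf: straight on past the leaf), and consecutive pushed points are joined by a side.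

Counting: in a minimum partition the two edges bounding a straight corner belong to one segment,
since otherwise two segments would end there and could be merged
(`IsMinimumSegmentPartition.rot_edge_mem`). Hence each end of a segment contributes one proper
corner, and a segment passing through a vertex contributes one more for each of its sides on which
an edge is attached. The total is 2s + t (`IsMinimumSegmentPartition.card_kept`).

Simplicity: finitely many conditions are involved, so each need only hold for all sufficiently small
δ. A side stays to the left of its stretch. Sides of disjoint stretches are far apart, sides of
stretches with only vertices in common lie in different sectors there, and sides of stretches
sharing an edge are separated by its line. The degenerate case is a side from leaf to leaf, which
lies on the line of its stretch; two of them along one stretch would make the whole walk close up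
after two corners, which is impossible with at least three proper corners.

Area: the tree is a compact null set that does not separate the plane
(`isPreconnected_compl_edgeUnion`). Every point off the tree therefore escapes to infinity away from
all polygons close to the tree, and dominated convergence sends the area to zero
(`tendsto_volume_fill`).

Enclosure: an edge not covered by a leaf-to-leaf side is separated from a nearby outer point by
exactly one side. Crossing it changes the total swept angle by 2π (`sweep_jump`), and this angle is
0 in unbounded components (`sweep_eq_zero`), so the edge lies in a bounded one. -/

open Filter Topology

/-! ### Oriented angles and bisectors. -/

/-- The counterclockwise angle, in `(0, 2π]`, by which a nonzero vector `a` has to be turned to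
point in the direction of `b`. -/
noncomputable def turn (a b : ℂ) : ℝ := Complex.arg (-(b / a)) + Real.pi

theorem turn_pos (a b : ℂ) : 0 < turn a b := by
  have := Complex.neg_pi_lt_arg (-(b / a))
  unfold turn; linarith

theorem turn_le (a b : ℂ) : turn a b ≤ 2 * Real.pi := by
  have := Complex.arg_le_pi (-(b / a))
  unfold turn; linarith

theorem turn_coe_angle {a b : ℂ} (ha : a ≠ 0) (hb : b ≠ 0) :
    ((turn a b : ℝ) : Real.Angle) = Complex.arg (b / a) := by
  rw [turn, Real.Angle.coe_add, Complex.arg_neg_coe_angle (div_ne_zero hb ha), add_assoc,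
    ← Real.Angle.coe_add, ← two_mul, Real.Angle.coe_two_pi, add_zero]

/-- Angles add modulo 2π, and all three values lie in `(0, 2π]`, which leaves only two multiples of
2π as correction. Cyclic-order arguments below reduce to this dichotomy and linear arithmetic. -/
theorem turn_add {a b c : ℂ} (ha : a ≠ 0) (hb : b ≠ 0) (hc : c ≠ 0) :
    turn a c = turn a b + turn b c ∨ turn a c = turn a b + turn b c - 2 * Real.pi := by
  have h : ((turn a c : ℝ) : Real.Angle) = ((turn a b + turn b c : ℝ) : Real.Angle) := by
    rw [Real.Angle.coe_add, turn_coe_angle ha hb, turn_coe_angle hb hc, turn_coe_angle ha hc,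
      ← Complex.arg_mul_coe_angle (div_ne_zero hb ha) (div_ne_zero hc hb)]
    congr 2; field_simp
  obtain ⟨k, hk⟩ := Real.Angle.angle_eq_iff_two_pi_dvd_sub.1 h
  have h1 := turn_pos a b; have h2 := turn_pos b c; have h3 := turn_pos a c
  have h4 := turn_le a b; have h5 := turn_le b c; have h6 := turn_le a c
  have hpi := Real.pi_pos
  have k1 : (k : ℝ) < 1 := by
    by_contra! hh
    nlinarith
  have k2 : (-2 : ℝ) < k := by
    by_contra! hh
    nlinarith
  have k1' : k < 1 := by exact_mod_cast k1
  have k2' : -2 < k := by exact_mod_cast k2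
  obtain rfl | rfl : k = 0 ∨ k = -1 := by omega
  · left; simp at hk; linarith
  · right; push_cast at hk; linarith

theorem turn_eq_two_pi_iff {a b : ℂ} (ha : a ≠ 0) (hb : b ≠ 0) :
    turn a b = 2 * Real.pi ↔ ∃ r : ℝ, 0 < r ∧ b = r * a := by
  have : turn a b = 2 * Real.pi ↔ Complex.arg (-(b / a)) = Real.pi := by
    unfold turn; constructor <;> intro h <;> linarith
  rw [this, Complex.arg_eq_pi_iff]
  constructor
  · rintro ⟨h1, h2⟩
    refine ⟨(b / a).re, by simpa using h1, ?_⟩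
    have : ((b / a).re : ℂ) = b / a := by
      apply Complex.ext <;> simp at *
      exact h2.symm
    rw [this]; field_simp
  · rintro ⟨r, hr, rfl⟩
    rw [mul_div_assoc, div_self ha]; simpa using hr

theorem turn_self {a : ℂ} (ha : a ≠ 0) : turn a a = 2 * Real.pi :=
  (turn_eq_two_pi_iff ha ha).2 ⟨1, one_pos, by simp⟩

theorem turn_eq_pi_iff {a b : ℂ} (ha : a ≠ 0) (hb : b ≠ 0) :
    turn a b = Real.pi ↔ ∃ r : ℝ, 0 < r ∧ b = -(r * a) := by
  have : turn a b = Real.pi ↔ Complex.arg (-(b / a)) = 0 := by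
    unfold turn; constructor <;> intro h <;> linarith
  rw [this, Complex.arg_eq_zero_iff]
  constructor
  · rintro ⟨h1, h2⟩
    have : ((b / a).re : ℂ) = b / a := by
      apply Complex.ext <;> simp at *
      exact h2.symm
    have hne : (b / a).re ≠ 0 := by
      intro h0
      rw [h0] at this
      exact div_ne_zero hb ha (by simpa using this.symm)
    refine ⟨-(b / a).re, ?_, ?_⟩
    · have : 0 ≤ -(b / a).re := by simpa using h1
      exact lt_of_le_of_ne this (fun h => hne (by simpa using h.symm))
    · push_cast; rw [this]; field_simp
  · rintro ⟨r, hr, rfl⟩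
    rw [← neg_mul, mul_div_assoc, div_self ha]; simpa using hr.le

/-- Translates between cyclic order (angles) and sides of a line (signs of imaginary parts). -/
theorem turn_lt_pi_iff {a b : ℂ} : turn a b < Real.pi ↔ 0 < (b / a).im := by
  have : turn a b < Real.pi ↔ Complex.arg (-(b / a)) < 0 := by
    unfold turn; constructor <;> intro h <;> linarith
  rw [this, Complex.arg_neg_iff]; simp

theorem turn_smul_right {a b : ℂ} {r : ℝ} (hr : 0 < r) : turn a (r * b) = turn a b := by
  unfold turn
  rw [mul_div_assoc, ← mul_neg, Complex.arg_real_mul _ hr]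

theorem turn_smul_left {a b : ℂ} {r : ℝ} (hr : 0 < r) : turn (r * a) b = turn a b := by
  unfold turn
  have : -(b / (r * a)) = ((r⁻¹ : ℝ) : ℂ) * -(b / a) := by
    push_cast
    rw [mul_neg, ← div_eq_inv_mul, div_div, mul_comm a]
  rw [this, Complex.arg_real_mul _ (inv_pos.2 hr)]

theorem turn_exp_mul {a : ℂ} (ha : a ≠ 0) {θ : ℝ} (h0 : 0 < θ) (h1 : θ ≤ 2 * Real.pi) :
    turn a (Complex.exp (θ * Complex.I) * a) = θ := by
  unfold turn
  have : -(Complex.exp (θ * Complex.I) * a / a) = Complex.exp ((θ - Real.pi : ℝ) * Complex.I) := by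
    rw [mul_div_assoc, div_self ha]
    push_cast
    rw [sub_mul, Complex.exp_sub, Complex.exp_pi_mul_I]; simp [div_neg]
  rw [this, Complex.arg_exp_mul_I, toIocMod_eq_self Real.two_pi_pos |>.2]
  · ring
  · constructor <;> linarith

theorem eq_of_turn {a b : ℂ} (ha : a ≠ 0) (hb : b ≠ 0) :
    ∃ r : ℝ, 0 < r ∧ b = r * (Complex.exp (turn a b * Complex.I) * a) := by
  refine ⟨‖-(b / a)‖, by simp [ha, hb], ?_⟩
  have h := Complex.norm_mul_exp_arg_mul_I (-(b / a))
  have : Complex.exp (turn a b * Complex.I) = -Complex.exp (Complex.arg (-(b / a)) * Complex.I) :=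
      by
    unfold turn; push_cast
    rw [add_mul, Complex.exp_add, Complex.exp_pi_mul_I]; ring
  rw [this, ← mul_assoc, mul_neg, h]; field_simp

/-- The direction bisecting the sector swept out when turning counterclockwise from `a` to `b`. -/
noncomputable def bisector (a b : ℂ) : ℂ := Complex.exp ((turn a b / 2 : ℝ) * Complex.I) * a

theorem bisector_ne_zero {a b : ℂ} (ha : a ≠ 0) : bisector a b ≠ 0 :=
  mul_ne_zero (Complex.exp_ne_zero _) ha

theorem turn_bisector {a b : ℂ} (ha : a ≠ 0) : turn a (bisector a b) = turn a b / 2 :=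
  turn_exp_mul ha (by linarith [turn_pos a b]) (by linarith [turn_le a b, turn_pos a b])

theorem bisector_turn {a b : ℂ} (ha : a ≠ 0) (hb : b ≠ 0) :
    turn (bisector a b) b = turn a b / 2 := by
  obtain ⟨r, hr, h⟩ := eq_of_turn ha hb
  have : b = r * (Complex.exp ((turn a b / 2 : ℝ) * Complex.I) * bisector a b) := by
    rw [bisector, ← mul_assoc (Complex.exp _), ← Complex.exp_add, ← add_mul, ← Complex.ofReal_add,
      add_halves]
    exact h
  refine (congrArg _ this).trans ?_
  rw [turn_smul_right hr, turn_exp_mul (bisector_ne_zero ha)]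
  · linarith [turn_pos a b]
  · linarith [turn_le a b, turn_pos a b]

/-- Whether the turn to `b` is below π depends only on the side of the line spanned by `b`, so the
sign of `β` plays no role. -/
theorem comb_turn_lt_pi {a b : ℂ} (ha : a ≠ 0) (hab : turn a b < Real.pi) {α β : ℝ}
    (hα : 0 < α) :
    (α * a + β * b : ℂ) ≠ 0 ∧ turn (α * a + β * b) b < Real.pi := by
  have hi := turn_lt_pi_iff.1 hab
  have h1 : ((α * a + β * b) / a : ℂ) = α + β * (b / a) := by field_simp
  have hne : (α * a + β * b : ℂ) ≠ 0 := by
    intro h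
    rw [h, zero_div] at h1
    have h2 := congrArg Complex.im h1
    have h3 := congrArg Complex.re h1
    have h4 : β = 0 := by simpa [hi.ne'] using h2.symm
    simp [h4] at h3
    exact hα.ne h3
  refine ⟨hne, ?_⟩
  rw [turn_lt_pi_iff]
  have : b / (α * a + β * b) = (b / a) / (α + β * (b / a)) := by
    rw [← h1]; field_simp
  rw [this, Complex.div_im]
  have hn : 0 < Complex.normSq (α + β * (b / a)) := by
    rw [Complex.normSq_pos, ← h1]; exact div_ne_zero hne ha
  rw [← sub_div]
  apply div_pos _ hn
  simp
  nlinarith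

/-- A nonnegative combination of `a` and `b` points into the sector from `a` to `b`. -/
theorem turn_comb_le {a b : ℂ} (ha : a ≠ 0) (hb : b ≠ 0) (hab : turn a b < Real.pi) {α β : ℝ}
    (hα : 0 ≤ α) (hβ : 0 < β) :
    (α * a + β * b : ℂ) ≠ 0 ∧ turn a (α * a + β * b) ≤ turn a b := by
  have hi := turn_lt_pi_iff.1 hab
  rcases hα.eq_or_lt with rfl | hα
  · simp [turn_smul_right hβ, hb, hβ.ne']
  obtain ⟨hne, h3⟩ := comb_turn_lt_pi ha hab hα
  refine ⟨hne, ?_⟩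
  have h1 : ((α * a + β * b) / a : ℂ) = α + β * (b / a) := by field_simp
  have h4 : turn a (α * a + β * b) < Real.pi := by
    rw [turn_lt_pi_iff, h1]; simp; positivity
  rcases turn_add ha hne hb with h | h
  · linarith [turn_pos (α * a + β * b) b]
  · linarith [turn_pos a b]

theorem comb_turn_le {a b : ℂ} (ha : a ≠ 0) (hb : b ≠ 0) (hab : turn a b < Real.pi) {α β : ℝ}
    (hα : 0 < α) (hβ : 0 ≤ β) :
    (α * a + β * b : ℂ) ≠ 0 ∧ turn (α * a + β * b) b ≤ turn a b := by
  rcases hβ.eq_or_lt with rfl | hβ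
  · simp [turn_smul_left hα, ha, hα.ne']
  have h0 := turn_comb_le ha hb hab hα.le hβ
  have h3 := (comb_turn_lt_pi (β := β) ha hab hα).2
  refine ⟨h0.1, ?_⟩
  rcases turn_add ha h0.1 hb with h | h
  · linarith [turn_pos a (α * a + β * b)]
  · linarith [turn_pos a b, h0.2]

/-- The identification of the plane with the complex numbers. -/
noncomputable def toC : Plane ≃ₗᵢ[ℝ] ℂ := Complex.orthonormalBasisOneI.repr.symm

/-! ### The rotation system and the boundary walk of the tree. -/

namespace PlaneTree

variable {V : Type*} (T : PlaneTree V)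

/-- The position of a vertex as a complex number. -/
noncomputable def z (v : V) : ℂ := toC (T.pos v)

theorem z_injective : Function.Injective T.z := toC.injective.comp T.pos_injective

theorem toC_image_segment (p q : Plane) : toC '' segment ℝ p q = segment ℝ (toC p) (toC q) :=
  image_segment ℝ (toC.toLinearEquiv : Plane →ₗ[ℝ] ℂ).toAffineMap p q

theorem inter_segment_subset {d e : T.graph.Dart} (h : d.edge ≠ e.edge) :
    segment ℝ (T.z d.fst) (T.z d.snd) ∩ segment ℝ (T.z e.fst) (T.z e.snd) ⊆
      T.z '' ({d.fst, d.snd} ∩ {e.fst, e.snd}) := by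
  rintro x ⟨h1, h2⟩
  rw [z, z, ← toC_image_segment] at h1 h2
  obtain ⟨p, hp, rfl⟩ := h1
  obtain ⟨q, hq, h3⟩ := h2
  obtain rfl := toC.injective h3
  obtain ⟨v, hv, rfl⟩ := T.noncrossing _ _ _ _ d.adj e.adj h ⟨hp, hq⟩
  exact ⟨v, hv, rfl⟩

/-- The vector along a dart. -/
noncomputable def dir (d : T.graph.Dart) : ℂ := T.z d.snd - T.z d.fst

theorem dir_ne_zero (d : T.graph.Dart) : T.dir d ≠ 0 :=
  sub_ne_zero.2 fun h => d.adj.ne' (T.z_injective h)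

theorem dir_symm (d : T.graph.Dart) : T.dir d.symm = -T.dir d := by
  simp [dir]

theorem eq_of_edge_eq {d e : T.graph.Dart} (hf : d.fst = e.fst) (h : d.edge = e.edge) : d = e := by
  rcases (SimpleGraph.dart_edge_eq_iff _ _).1 h with h | h
  · exact h
  · subst h
    exact absurd hf e.adj.ne'

theorem eq_of_snd_eq {d e : T.graph.Dart} (hf : d.fst = e.fst) (h : d.snd = e.snd) : d = e :=
  SimpleGraph.Dart.ext _ _ (Prod.ext hf h)

theorem mem_segment_add_smul {x y : ℂ} {r : ℝ} (h0 : 0 ≤ r) (h1 : r ≤ 1) :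
    x + r * (y - x) ∈ segment ℝ x y := by
  rw [segment_eq_image']
  exact ⟨r, ⟨h0, h1⟩, by simp⟩

/-- Of two edges leaving a vertex in the same direction, the shorter one would have its far end on
the longer one, against noncrossing. Thus a direction at a vertex determines the dart. -/
theorem eq_of_dir_eq_smul {d e : T.graph.Dart} (hf : d.fst = e.fst) {r : ℝ} (hr : 0 < r)
    (h : T.dir e = r * T.dir d) : d = e := by
  by_contra hne
  have key : ∀ d e : T.graph.Dart, d.fst = e.fst → d ≠ e → ∀ r : ℝ, 0 < r → r ≤ 1 →
      T.dir e ≠ r * T.dir d := by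
    intro d e hf hne r hr hr1 h
    have hmem : T.z e.snd ∈ segment ℝ (T.z d.fst) (T.z d.snd) := by
      have : T.z e.snd = T.z d.fst + r * (T.z d.snd - T.z d.fst) := by
        rw [dir, dir, ← hf] at h; rw [← h]; ring
      rw [this]; exact mem_segment_add_smul hr.le hr1
    obtain ⟨v, ⟨hv1, hv2⟩, hv⟩ := T.inter_segment_subset (fun h' => hne (T.eq_of_edge_eq hf h'))
      ⟨hmem, right_mem_segment ℝ _ _⟩
    obtain rfl := T.z_injective hv
    rcases hv1 with h1 | h1
    · exact e.adj.ne' (h1.trans hf)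
    · exact hne (T.eq_of_snd_eq hf h1.symm)
  rcases le_total r 1 with h1 | h1
  · exact key d e hf hne r hr h1 h
  · refine key e d hf.symm (Ne.symm hne) r⁻¹ (inv_pos.2 hr) (inv_le_one_of_one_le₀ h1) ?_
    rw [h]; push_cast; rw [← mul_assoc, inv_mul_cancel₀ (by exact_mod_cast hr.ne'), one_mul]

theorem turn_dir_lt {d e : T.graph.Dart} (hf : d.fst = e.fst) (hne : d ≠ e) :
    turn (T.dir d) (T.dir e) < 2 * Real.pi := by
  refine lt_of_le_of_ne (turn_le _ _) fun h => ?_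
  obtain ⟨r, hr, h⟩ := (turn_eq_two_pi_iff (T.dir_ne_zero d) (T.dir_ne_zero e)).1 h
  exact hne (T.eq_of_dir_eq_smul hf hr h)

theorem turn_dir_self (d : T.graph.Dart) : turn (T.dir d) (T.dir d) = 2 * Real.pi :=
  turn_self (T.dir_ne_zero d)

theorem turn_dir_add (d e f : T.graph.Dart) :
    turn (T.dir d) (T.dir f) = turn (T.dir d) (T.dir e) + turn (T.dir e) (T.dir f) ∨
    turn (T.dir d) (T.dir f) = turn (T.dir d) (T.dir e) + turn (T.dir e) (T.dir f) - 2 * Real.pi :=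
  turn_add (T.dir_ne_zero d) (T.dir_ne_zero e) (T.dir_ne_zero f)

variable [Finite V]

instance : Finite T.graph.Dart := Finite.of_injective _ (SimpleGraph.Dart.toProd_injective)

/-- The dart `d` itself competes with the largest possible value 2π, so it is chosen only when it is
the only dart at its vertex. Leaves thus get a corner of angle 2π. -/
theorem exists_next (d : T.graph.Dart) : ∃ e : T.graph.Dart, e.fst = d.fst ∧
    ∀ f : T.graph.Dart, f.fst = d.fst → turn (T.dir d) (T.dir e) ≤ turn (T.dir d) (T.dir f) := by
  obtain ⟨e, he, h⟩ := Set.exists_min_image {e : T.graph.Dart | e.fst = d.fst}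
    (fun e => turn (T.dir d) (T.dir e)) (Set.toFinite _) ⟨d, rfl⟩
  exact ⟨e, he, h⟩

/-- The next dart in counterclockwise order around the first vertex of a dart. -/
noncomputable def next (d : T.graph.Dart) : T.graph.Dart := (T.exists_next d).choose

theorem next_fst (d : T.graph.Dart) : (T.next d).fst = d.fst := (T.exists_next d).choose_spec.1

theorem turn_next_le {d f : T.graph.Dart} (h : f.fst = d.fst) :
    turn (T.dir d) (T.dir (T.next d)) ≤ turn (T.dir d) (T.dir f) :=
  (T.exists_next d).choose_spec.2 f h

/-- If `d` and `e` had the same successor, then one of them would be met strictly between the other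
and this successor. -/
theorem next_injective : Function.Injective T.next := by
  intro d e h
  by_contra hne
  have hf : d.fst = e.fst := by rw [← T.next_fst d, h, T.next_fst]
  have h1 := T.turn_next_le hf.symm
  have h2 := T.turn_next_le hf
  rw [← h] at h2
  set g := T.next d
  have hg : g.fst = d.fst := T.next_fst d
  have h3 := T.turn_dir_lt hf hne
  have h4 := T.turn_dir_lt hf.symm (Ne.symm hne)
  have p1 := turn_pos (T.dir d) (T.dir g)
  have p2 := turn_pos (T.dir e) (T.dir g)
  have p3 := turn_pos (T.dir d) (T.dir e)
  have p4 := turn_pos (T.dir e) (T.dir d)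
  have q1 := turn_le (T.dir d) (T.dir g)
  have q2 := turn_le (T.dir e) (T.dir g)
  rcases T.turn_dir_add d e g with h5 | h5 <;> rcases T.turn_dir_add e d g with h6 | h6 <;>
  rcases T.turn_dir_add d e d with h7 | h7 <;> rw [turn_dir_self] at h7 <;> linarith

/-- The rotation system of the tree: the counterclockwise rotation around the first vertex. -/
noncomputable def rot : Equiv.Perm T.graph.Dart :=
  Equiv.ofBijective T.next (Finite.injective_iff_bijective.1 T.next_injective)

theorem rot_fst (d : T.graph.Dart) : (T.rot d).fst = d.fst := T.next_fst d

/-- The angle of the corner that follows a dart in counterclockwise order. -/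
noncomputable def ang (d : T.graph.Dart) : ℝ := turn (T.dir d) (T.dir (T.rot d))

theorem ang_le {d f : T.graph.Dart} (h : f.fst = d.fst) : T.ang d ≤ turn (T.dir d) (T.dir f) :=
  T.turn_next_le h

theorem ang_pos (d : T.graph.Dart) : 0 < T.ang d := turn_pos _ _

/-- A set of darts with a common first vertex that is closed under rotation contains all darts
with this first vertex. -/
theorem mem_of_rot_closed {O : Set T.graph.Dart} (hO : ∀ d ∈ O, T.rot d ∈ O) {d e : T.graph.Dart}
    (hd : d ∈ O) (h : e.fst = d.fst) : e ∈ O := by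
  by_contra he
  -- Take the member `f` of `O` closest before `e`; its successor is not `e` and cannot jump over
  -- `e`, so it is a closer member.
  obtain ⟨f, ⟨hf, hfO⟩, hmin⟩ := Set.exists_min_image {f : T.graph.Dart | f.fst = e.fst ∧ f ∈ O}
    (fun f => turn (T.dir f) (T.dir e)) (Set.toFinite _) ⟨d, h.symm, hd⟩
  have h1 : T.rot f ≠ e := fun h' => he (h' ▸ hO f hfO)
  have h2 := hmin (T.rot f) ⟨(T.rot_fst f).trans hf, hO f hfO⟩
  have h3 := T.ang_le hf.symm
  have h4 := T.ang_pos f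
  unfold ang at h3 h4
  have h5 := T.turn_dir_lt ((T.rot_fst f).trans hf) h1
  have h6 := turn_pos (T.dir (T.rot f)) (T.dir e)
  rcases T.turn_dir_add f (T.rot f) e with h7 | h7 <;> linarith [turn_le (T.dir f) (T.dir e)]

/-- The open sector of directions of the corner following a dart. -/
def sector (d : T.graph.Dart) : Set ℂ := {y | y ≠ 0 ∧ turn (T.dir d) y < T.ang d}

theorem disjoint_sector {d e : T.graph.Dart} (h : d.fst = e.fst) (hne : d ≠ e) :
    Disjoint (T.sector d) (T.sector e) := by
  rw [Set.disjoint_left]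
  rintro y ⟨hy, h1⟩ ⟨-, h2⟩
  have h3 := T.ang_le h.symm
  have h4 := T.ang_le h
  have h5 := T.turn_dir_lt h hne
  have h6 := T.turn_dir_lt h.symm hne.symm
  have h7 := turn_pos (T.dir d) y
  have h8 := turn_pos (T.dir e) y
  rcases turn_add (T.dir_ne_zero d) (T.dir_ne_zero e) hy with h9 | h9 <;>
  rcases turn_add (T.dir_ne_zero e) (T.dir_ne_zero d) hy with h10 | h10 <;> linarith

theorem dir_notMem_sector {d e : T.graph.Dart} (h : e.fst = d.fst) {r : ℝ} (hr : 0 < r) :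
    (r * T.dir e : ℂ) ∉ T.sector d := by
  rintro ⟨-, h1⟩
  rw [turn_smul_right hr] at h1
  exact absurd (T.ang_le h) (not_le.2 h1)

theorem rot_eq_self_iff (d : T.graph.Dart) : T.rot d = d ↔ T.ang d = 2 * Real.pi := by
  constructor
  · intro h; rw [ang, h, turn_dir_self]
  · intro h
    by_contra hne
    exact absurd h (T.turn_dir_lt (T.rot_fst d).symm (Ne.symm hne)).ne

theorem eq_of_fst_eq_of_rot_eq_self {d e : T.graph.Dart} (hd : T.rot d = d) (h : e.fst = d.fst) :
    e = d :=
  T.mem_of_rot_closed (O := {d}) (by rintro _ rfl; exact hd) rfl h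

/-- The direction in which the corner of the polygon is moved off the vertex. -/
noncomputable def bis (d : T.graph.Dart) : ℂ := bisector (T.dir d) (T.dir (T.rot d))

theorem bis_ne_zero (d : T.graph.Dart) : T.bis d ≠ 0 := bisector_ne_zero (T.dir_ne_zero d)

theorem bis_mem_sector (d : T.graph.Dart) : T.bis d ∈ T.sector d := by
  refine ⟨T.bis_ne_zero d, ?_⟩
  rw [bis, turn_bisector (T.dir_ne_zero d)]
  exact half_lt_self (T.ang_pos d)

/-- The face permutation: the dart along which the boundary of the tree is followed after a
dart, with the tree on the right-hand side. -/
noncomputable def face : Equiv.Perm T.graph.Dart :=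
  (SimpleGraph.Dart.symm_involutive.toPerm _).trans T.rot.symm

theorem rot_face (d : T.graph.Dart) : T.rot (T.face d) = d.symm := by simp [face]

theorem face_fst (d : T.graph.Dart) : (T.face d).fst = d.snd := by
  rw [← T.rot_fst, rot_face]; rfl

/-- The edge of `d` is a bridge. After traversing `d` the walk is on the side of `d.snd`; being
periodic, it must reach `d.fst` before it repeats `d`, and the only way back is `d.symm`. -/
theorem exists_face_iterate_eq_symm (d : T.graph.Dart) : ∃ n : ℕ, T.face^[n] d = d.symm := by
  by_contra! hn
  have hb := SimpleGraph.isAcyclic_iff_forall_adj_isBridge.1 T.isTree.2 d.adj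
  rw [SimpleGraph.isBridge_iff] at hb
  set G' := T.graph.deleteEdges {s(d.fst, d.snd)}
  have key : ∀ n : ℕ, G'.Reachable d.snd (T.face^[n] d).snd := by
    intro n
    induction n with
    | zero => exact SimpleGraph.Reachable.refl _
    | succ n ih =>
      rw [Function.iterate_succ_apply']
      set e := T.face^[n] d
      have h1 : (T.face e).fst = e.snd := T.face_fst e
      by_cases h2 : (T.face e).edge = d.edge
      · rcases (SimpleGraph.dart_edge_eq_iff _ _).1 h2 with h3 | h3
        · rw [h3]
        · exact absurd (by rw [Function.iterate_succ_apply']; exact h3) (hn (n + 1))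
      · refine ih.trans (SimpleGraph.Adj.reachable ?_)
        rw [← h1, SimpleGraph.deleteEdges_adj]
        exact ⟨(T.face e).adj, h2⟩
  obtain ⟨n, hn0, hn1⟩ : ∃ n, 0 < n ∧ T.face^[n] d = d := by
    have := (isOfFinOrder_of_finite T.face).exists_pow_eq_one
    obtain ⟨n, h0, h1⟩ := this
    exact ⟨n, h0, by rw [Equiv.Perm.iterate_eq_pow, h1]; rfl⟩
  obtain ⟨m, rfl⟩ := Nat.exists_eq_succ_of_ne_zero hn0.ne'
  rw [Nat.succ_eq_add_one, Function.iterate_succ_apply'] at hn1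
  have h := T.face_fst (T.face^[m] d)
  rw [hn1] at h
  apply hb
  rw [h]
  exact (key m).symm

/-- The boundary of a tree is a single closed walk through all darts. -/
theorem exists_face_iterate_eq (d e : T.graph.Dart) : ∃ n : ℕ, T.face^[n] d = e := by
  set O : Set T.graph.Dart := {e | ∃ n : ℕ, T.face^[n] d = e}
  have hsymm : ∀ e ∈ O, e.symm ∈ O := by
    rintro _ ⟨n, rfl⟩
    obtain ⟨m, hm⟩ := T.exists_face_iterate_eq_symm (T.face^[n] d)
    exact ⟨m + n, by rw [Function.iterate_add_apply, hm]⟩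
  have hface : ∀ e ∈ O, T.face e ∈ O := by
    rintro _ ⟨n, rfl⟩
    exact ⟨n + 1, by rw [Function.iterate_succ_apply']⟩
  have hface' : ∀ e, T.face e ∈ O → e ∈ O := by
    intro e he
    obtain ⟨n, h0, h1⟩ := (isOfFinOrder_of_finite T.face).exists_pow_eq_one
    obtain ⟨m, rfl⟩ := Nat.exists_eq_succ_of_ne_zero h0.ne'
    have : ∀ k, T.face^[k] (T.face e) ∈ O := by
      intro k
      induction k with
      | zero => exact he
      | succ k ih => rw [Function.iterate_succ_apply']; exact hface _ ih
    have h2 := this m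
    rw [← Function.iterate_succ_apply, Equiv.Perm.iterate_eq_pow, h1] at h2
    exact h2
  -- The rotation is the inverse of `T.face` followed by reversal, so closure under both carries
  -- over. Then `O` contains all darts at each vertex it reaches, and connectedness spreads it over
  -- the tree.
  have hrot : ∀ e ∈ O, T.rot e ∈ O := by
    intro e he
    have h1 : T.rot e = (T.face.symm e).symm := by rw [← rot_face, Equiv.apply_symm_apply]
    rw [h1]
    exact hsymm _ (hface' _ (by rwa [Equiv.apply_symm_apply]))
  have hv : ∀ v w : V, ∀ p : T.graph.Walk v w, ∀ e : T.graph.Dart, e.fst = v → e ∈ O →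
      ∀ f : T.graph.Dart, f.fst = w → f ∈ O := by
    intro v w p
    induction p with
    | nil => intro e he heO f hf; exact T.mem_of_rot_closed hrot heO (hf.trans he.symm)
    | cons h p ih =>
      intro e he heO f hf
      have h1 : (⟨(_, _), h⟩ : T.graph.Dart) ∈ O := T.mem_of_rot_closed hrot heO he.symm
      exact ih _ rfl (hsymm _ h1) f hf
  obtain ⟨p⟩ := T.isTree.1.preconnected d.fst e.fst
  exact hv _ _ p d rfl ⟨0, rfl⟩ e rfl

end PlaneTree

/-! ### First returns of a cyclic map to a subset. -/

section FirstReturn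

variable {α : Type*} (f : α → α) (K : Set α)

/-- The first positive time at which the orbit of a point enters `K`. -/
noncomputable def returnTime (x : α) : ℕ := sInf {k | 1 ≤ k ∧ f^[k] x ∈ K}

variable {f K}

theorem returnTime_spec (hf : ∀ x y : α, ∃ n, f^[n] x = y) (hK : K.Nonempty) (x : α) :
    1 ≤ returnTime f K x ∧ f^[returnTime f K x] x ∈ K := by
  have : {k | 1 ≤ k ∧ f^[k] x ∈ K}.Nonempty := by
    obtain ⟨y, hy⟩ := hK
    obtain ⟨n, hn⟩ := hf (f x) y
    exact ⟨n + 1, by omega, by rw [Function.iterate_succ_apply, hn]; exact hy⟩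
  exact Nat.sInf_mem this

theorem notMem_of_lt_returnTime {x : α} {j : ℕ} (h1 : 1 ≤ j) (h2 : j < returnTime f K x) :
    f^[j] x ∉ K := fun h => Nat.notMem_of_lt_sInf h2 ⟨h1, h⟩

/-- If one return took longer than the other, cancelling the common iterates would place a point of
`K` strictly inside the longer excursion. -/
theorem iterate_returnTime_inj (hi : Function.Injective f) (hf : ∀ x y : α, ∃ n, f^[n] x = y)
    (hK : K.Nonempty) {x y : α} (hx : x ∈ K) (hy : y ∈ K)
    (h : f^[returnTime f K x] x = f^[returnTime f K y] y) : x = y := by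
  wlog hle : returnTime f K x ≤ returnTime f K y generalizing x y
  · exact (this hy hx h.symm (le_of_not_ge hle)).symm
  obtain ⟨k, hk⟩ := Nat.exists_eq_add_of_le hle
  rw [hk, Function.iterate_add_apply] at h
  have h1 := hi.iterate _ h
  rcases Nat.eq_zero_or_pos k with rfl | h0
  · exact h1
  · have := (returnTime_spec hf hK x).1
    exact absurd (h1 ▸ hx) (notMem_of_lt_returnTime h0 (by omega))

/-- Excursions from different points of `K` are disjoint. Together with `exists_lt_returnTime` this
puts every dart on exactly one stretch of the boundary walk. -/
theorem iterate_eq_of_lt_returnTime (hi : Function.Injective f) {x y : α} (hx : x ∈ K)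
    (hy : y ∈ K) {i j : ℕ} (hij : i < returnTime f K x) (hj : j < returnTime f K y) (h : f^[i] x =
        f^[j] y) : x = y := by
  wlog hle : i ≤ j generalizing x y i j
  · exact (this hy hx hj hij h.symm (le_of_not_ge hle)).symm
  obtain ⟨k, rfl⟩ := Nat.exists_eq_add_of_le hle
  rw [Function.iterate_add_apply] at h
  have h1 := hi.iterate _ h
  rcases Nat.eq_zero_or_pos k with rfl | h0
  · exact h1
  · exact absurd (h1 ▸ hx) (notMem_of_lt_returnTime h0 (by omega))

theorem exists_lt_returnTime (hf : ∀ x y : α, ∃ n, f^[n] x = y) (hK : K.Nonempty) (y : α) :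
    ∃ x ∈ K, ∃ i < returnTime f K x, f^[i] x = y := by
  have key : ∀ n : ℕ, ∀ x ∈ K, f^[n] x = y → ∃ x ∈ K, ∃ i < returnTime f K x, f^[i] x = y := by
    intro n
    induction n using Nat.strong_induction_on with
    | _ n ih =>
      intro x hx h
      obtain ⟨h1, h2⟩ := returnTime_spec hf hK x
      by_cases hn : n < returnTime f K x
      · exact ⟨x, hx, n, hn, h⟩
      · obtain ⟨m, rfl⟩ := Nat.exists_eq_add_of_le (not_lt.1 hn)
        rw [Nat.add_comm, Function.iterate_add_apply] at h
        exact ih m (by omega) _ h2 h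
  obtain ⟨x, hx⟩ := hK
  obtain ⟨n, hn⟩ := hf x y
  exact key n x hx hn

/-- The first-return map to a nonempty subset of a finite set on which the iterates of `f` act
transitively is a cyclic permutation. -/
theorem exists_cyclic_enumeration [Finite α] (hi : Function.Injective f)
    (hf : ∀ x y : α, ∃ n, f^[n] x = y) (hK : K.Nonempty) {n : ℕ} (hn : Nat.card K = n) :
    ∃ e : Fin n ≃ K, ∀ i, (e (finRotate n i) : α) = f^[returnTime f K (e i)] (e i) := by
  classical
  have := Fintype.ofFinite K
  let ψ : K → K := fun x => ⟨f^[returnTime f K x] x, (returnTime_spec hf hK x).2⟩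
  have hψ : Function.Injective ψ := fun x y h =>
    Subtype.ext (iterate_returnTime_inj hi hf hK x.2 y.2 (congrArg Subtype.val h))
  let P : Equiv.Perm K := Equiv.ofBijective ψ (Finite.injective_iff_bijective.1 hψ)
  have htrans : ∀ x y : K, ∃ m : ℕ, (P ^ m) x = y := by
    have key : ∀ m : ℕ, ∀ x y : K, f^[m] x = y → ∃ m : ℕ, (P ^ m) x = y := by
      intro m
      induction m using Nat.strong_induction_on with
      | _ m ih =>
        intro x y h
        obtain ⟨h1, -⟩ := returnTime_spec hf hK (x : α)
        rcases Nat.eq_zero_or_pos m with rfl | hm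
        · exact ⟨0, Subtype.ext h⟩
        by_cases hlt : m < returnTime f K x
        · exact absurd (h ▸ y.2) (notMem_of_lt_returnTime hm hlt)
        · obtain ⟨k, rfl⟩ := Nat.exists_eq_add_of_le (not_lt.1 hlt)
          rw [Nat.add_comm, Function.iterate_add_apply] at h
          obtain ⟨l, hl⟩ := ih k (by omega) (ψ x) y h
          exact ⟨l + 1, by rw [pow_succ, Equiv.Perm.mul_apply]; exact hl⟩
    intro x y
    obtain ⟨m, hm⟩ := hf x y
    exact key m x y hm
  have hcyc : P.IsCycleOn ((Finset.univ : Finset K) : Set K) := by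
    refine ⟨by simp, fun x _ y _ => ?_⟩
    obtain ⟨m, hm⟩ := htrans x y
    exact ⟨m, by simpa using hm⟩
  have hcard : (Finset.univ : Finset K).card = n := by
    rw [Finset.card_univ, ← Nat.card_eq_fintype_card, hn]
  obtain ⟨x0, hx0⟩ := hK
  let a : K := ⟨x0, hx0⟩
  let e0 : Fin n → K := fun i => (P ^ (i : ℕ)) a
  have hsurj : Function.Surjective e0 := by
    intro y
    obtain ⟨m, hm, h⟩ := hcyc.exists_pow_eq (Finset.mem_univ a) (Finset.mem_univ y)
    exact ⟨⟨m, hcard ▸ hm⟩, h⟩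
  have hbij : Function.Bijective e0 :=
    (Fintype.bijective_iff_surjective_and_card e0).2
      ⟨hsurj, by rw [Fintype.card_fin, ← hn, Nat.card_eq_fintype_card]⟩
  refine ⟨Equiv.ofBijective e0 hbij, fun i => ?_⟩
  have hstep : e0 (finRotate n i) = P (e0 i) := by
    obtain ⟨m, rfl⟩ : ∃ m, n = m + 1 := ⟨n - 1, by have := i.2; omega⟩
    have hpow : P ^ ((i : ℕ) + 1) = P * P ^ (i : ℕ) := pow_succ' _ _
    rcases eq_or_ne i (Fin.last m) with rfl | hne
    · rw [finRotate_last]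
      have h0 := hcyc.pow_card_apply (Finset.mem_univ a)
      rw [hcard] at h0
      simp only [Fin.val_last] at hpow
      simp only [e0, Fin.val_last, Fin.val_zero, pow_zero]
      rw [← Equiv.Perm.mul_apply, ← hpow, h0]; rfl
    · have hlt : (i : ℕ) < m := by
        have h1 := i.2
        have h2 : (i : ℕ) ≠ m := fun h => hne (Fin.ext h)
        omega
      simp only [e0]
      rw [coe_finRotate_of_ne_last hne, hpow]; rfl
  exact congrArg Subtype.val hstep

end FirstReturn

/-! ### The angle swept out by a closed chain. -/

section Winding

/-- A nonpositive quotient means that `a` and `b` are seen from `x` in opposite directions, which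
puts `x` between them. Hence the angle subtended by an edge is continuous off that edge. -/
theorem div_mem_slitPlane {a b x : ℂ} (hx : x ∉ segment ℝ a b) :
    (b - x) / (a - x) ∈ Complex.slitPlane := by
  have ha : a - x ≠ 0 := fun h => hx (sub_eq_zero.1 h ▸ left_mem_segment ℝ a b)
  by_contra h
  rw [Complex.mem_slitPlane_iff_not_le_zero, not_not] at h
  obtain ⟨t, ht, h1⟩ : ∃ t : ℝ, 0 ≤ t ∧ (b - x) / (a - x) = -t := by
    obtain ⟨h1, h2⟩ := Complex.le_def.1 h
    refine ⟨-((b - x) / (a - x)).re, by simpa using h1, ?_⟩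
    apply Complex.ext <;> simp
    simpa using h2
  rw [div_eq_iff ha] at h1
  apply hx
  have h2 : x = a + ((1 + t)⁻¹ : ℝ) * (b - a) := by
    have : (1 + t : ℂ) ≠ 0 := by
      norm_cast; positivity
    push_cast
    field_simp
    linear_combination -h1
  rw [h2]
  exact PlaneTree.mem_segment_add_smul (by positivity) (inv_le_one_of_one_le₀ (by linarith))

theorem exp_arg_mul_I {r : ℂ} (hr : r ≠ 0) : Complex.exp (r.arg * Complex.I) = r / ‖r‖ := by
  have h := Complex.norm_mul_exp_arg_mul_I r
  rw [eq_div_iff (by simpa using hr), mul_comm]; exact h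

theorem eq_of_continuousOn_of_discrete {S : Set ℂ} (hS : IsPreconnected S) {f : ℂ → ℝ}
    (hf : ContinuousOn f S) {c : ℝ} (h : ∀ x ∈ S, ∃ k : ℤ, f x = c + 2 * Real.pi * k) {x y : ℂ}
    (hx : x ∈ S) (hy : y ∈ S) : f x = f y := by
  by_contra hne
  wlog hlt : f x < f y generalizing x y
  · exact this hy hx (Ne.symm hne) (lt_of_le_of_ne (not_lt.1 hlt) (Ne.symm hne))
  have hpi := Real.pi_pos
  obtain ⟨k, hk⟩ := h x hx
  obtain ⟨l, hl⟩ := h y hy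
  have hkl : k < l := by
    have : (k : ℝ) < l := by
      rw [hk, hl] at hlt
      by_contra! h; nlinarith
    exact_mod_cast this
  have hkl' : (k : ℝ) + 1 ≤ l := by exact_mod_cast hkl
  -- The value half a period above `f x` is not admissible: it would make an odd integer even.
  obtain ⟨w, hw, hw'⟩ := hS.intermediate_value hx hy hf
    (show f x + Real.pi ∈ Set.Icc (f x) (f y) from ⟨by linarith, by rw [hk, hl]; nlinarith⟩)
  obtain ⟨m, hm⟩ := h w hw
  have h1 : (2 * m : ℝ) = 2 * k + 1 := by
    rw [hm, hk] at hw'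
    have : Real.pi * (2 * m) = Real.pi * (2 * k + 1) := by linarith
    exact mul_left_cancel₀ hpi.ne' this
  have h2 : 2 * m = 2 * k + 1 := by exact_mod_cast h1
  omega

variable {n : ℕ} (p : Fin n → ℂ)

/-- The boundary of the closed polygonal chain through the points `p i`. -/
def chain : Set ℂ := ⋃ i, segment ℝ (p i) (p (finRotate n i))

/-- The quotient whose argument is the angle subtended by an edge of a closed chain. -/
noncomputable def ratio (i : Fin n) (x : ℂ) : ℂ := (p (finRotate n i) - x) / (p i - x)

/-- The total angle swept out by a closed polygonal chain, seen from a point. -/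
noncomputable def sweep (x : ℂ) : ℝ := ∑ i, (ratio p i x).arg

variable {p}

theorem segment_subset_chain (i : Fin n) : segment ℝ (p i) (p (finRotate n i)) ⊆ chain p :=
  Set.subset_iUnion (fun i => segment ℝ (p i) (p (finRotate n i))) i

theorem isCompact_segment (a b : ℂ) : IsCompact (segment ℝ a b) := by
  rw [segment_eq_image']
  exact isCompact_Icc.image (by fun_prop)

theorem isCompact_chain : IsCompact (chain p) := isCompact_iUnion fun _ => isCompact_segment _ _

theorem ne_of_notMem_chain {x : ℂ} (hx : x ∉ chain p) (i : Fin n) : p i - x ≠ 0 := fun h =>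
  hx (segment_subset_chain i (sub_eq_zero.1 h ▸ left_mem_segment ℝ _ _))

theorem ratio_ne_zero {x : ℂ} (hx : ∀ i, p i - x ≠ 0) (i : Fin n) : ratio p i x ≠ 0 :=
  div_ne_zero (hx _) (hx _)

/-- The product telescopes around the cycle; this is why the sweep is a multiple of 2π. -/
theorem prod_ratio {x : ℂ} (hx : ∀ i, p i - x ≠ 0) : ∏ i, ratio p i x = 1 := by
  unfold ratio
  rw [Finset.prod_div_distrib, Equiv.prod_comp (finRotate n) (fun i => p i - x), div_self]
  exact Finset.prod_ne_zero_iff.2 fun i _ => hx i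

theorem exp_sweep {x : ℂ} (hx : ∀ i, p i - x ≠ 0) : Complex.exp (sweep p x * Complex.I) = 1 := by
  unfold sweep
  push_cast
  rw [Finset.sum_mul, Complex.exp_sum,
    Finset.prod_congr rfl fun i _ => exp_arg_mul_I (ratio_ne_zero hx i), Finset.prod_div_distrib,
    ← Complex.ofReal_prod, ← norm_prod, prod_ratio hx]
  simp

theorem exists_eq_of_exp_eq {c t : ℝ} (h : Complex.exp (t * Complex.I) = Complex.exp (c *
    Complex.I)) :
    ∃ k : ℤ, t = c + 2 * Real.pi * k := by
  obtain ⟨k, hk⟩ := Complex.exp_eq_exp_iff_exists_int.1 h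
  refine ⟨k, ?_⟩
  have := congrArg Complex.im hk
  simp at this
  linarith

theorem continuousOn_ratio_arg {S : Set ℂ} {i : Fin n}
    (hS : Disjoint S (segment ℝ (p i) (p (finRotate n i)))) :
    ContinuousOn (fun x => (ratio p i x).arg) S := by
  intro x hx
  have hx' := Set.disjoint_left.1 hS hx
  have h1 : p i - x ≠ 0 := fun h => hx' (sub_eq_zero.1 h ▸ left_mem_segment ℝ _ _)
  refine (ContinuousAt.comp (g := Complex.arg) (f := ratio p i)
    (Complex.continuousAt_arg (div_mem_slitPlane hx')) ?_).continuousWithinAt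
  exact ContinuousAt.div (by fun_prop) (by fun_prop) h1

theorem sweep_eq_of_isPreconnected {S : Set ℂ} (hS : IsPreconnected S) (h : S ⊆ (chain p)ᶜ)
    {x y : ℂ} (hx : x ∈ S) (hy : y ∈ S) : sweep p x = sweep p y := by
  refine eq_of_continuousOn_of_discrete (c := 0) hS ?_ (fun w hw => ?_) hx hy
  · refine continuousOn_finsetSum _ fun i _ => continuousOn_ratio_arg ?_
    exact Set.disjoint_left.2 fun w hw hw' => h hw (segment_subset_chain i hw')
  · exact exists_eq_of_exp_eq (by rw [exp_sweep (ne_of_notMem_chain (h hw))]; simp)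

theorem tendsto_sweep : Tendsto (sweep p) (Bornology.cobounded ℂ) (𝓝 0) := by
  have h0 : (0 : ℝ) = ∑ _i : Fin n, (0 : ℝ) := by simp
  rw [h0]
  refine tendsto_finsetSum _ fun i _ => ?_
  have h1 : Tendsto (fun x => ratio p i x) (Bornology.cobounded ℂ) (𝓝 1) := by
    have h2 : Tendsto (fun x => 1 + (p (finRotate n i) - p i) * (p i - x)⁻¹)
        (Bornology.cobounded ℂ) (𝓝 (1 + (p (finRotate n i) - p i) * 0)) := by
      refine tendsto_const_nhds.add (tendsto_const_nhds.mul ?_)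
      refine tendsto_inv₀_cobounded.comp ?_
      rw [← tendsto_norm_atTop_iff_cobounded]
      exact (Metric.tendsto_dist_left_cobounded_atTop (p i)).congr fun x => dist_eq_norm _ _
    simp only [mul_zero, add_zero] at h2
    refine h2.congr' ?_
    have h4 : Bornology.IsBounded {p i} := Bornology.isBounded_singleton
    filter_upwards [Bornology.isBounded_def.1 h4] with x hx
    have : p i - x ≠ 0 := sub_ne_zero.2 (Ne.symm hx)
    unfold ratio
    field_simp
    ring
  have h3 := (Complex.continuousAt_arg (x := 1) (by simp)).tendsto.comp h1
  simpa [Function.comp_def] using h3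

/-- The sweep is constant on `S`, a multiple of 2π, and tends to 0 at infinity. A nonzero sweep
therefore certifies that a point lies in a bounded component. -/
theorem sweep_eq_zero {S : Set ℂ} (hS : IsPreconnected S) (h : S ⊆ (chain p)ᶜ)
    (hb : ¬ Bornology.IsBounded S) {x : ℂ} (hx : x ∈ S) : sweep p x = 0 := by
  obtain ⟨y, hy, hlt⟩ : ∃ y ∈ S, |sweep p y| < 2 * Real.pi := by
    by_contra! hc
    have h1 : ∀ᶠ y in Bornology.cobounded ℂ, |sweep p y| < 2 * Real.pi := by
      have := (tendsto_sweep (p := p)).abs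
      rw [abs_zero] at this
      exact this.eventually_lt_const Real.two_pi_pos
    apply hb
    have h2 : Bornology.IsBounded {y | |sweep p y| < 2 * Real.pi}ᶜ := by
      rw [Bornology.isBounded_def, compl_compl]; exact h1
    exact h2.subset fun y hy => by simpa using hc y hy
  rw [sweep_eq_of_isPreconnected hS h hx hy]
  obtain ⟨k, hk⟩ := exists_eq_of_exp_eq (c := 0) (t := sweep p y)
    (by rw [exp_sweep (ne_of_notMem_chain (h hy))]; simp)
  rw [zero_add] at hk
  rw [hk, abs_mul, abs_of_pos Real.two_pi_pos] at hlt
  have h1 : |(k : ℝ)| < 1 := by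
    by_contra! h; nlinarith [Real.two_pi_pos]
  have h2 : |k| < 1 := by exact_mod_cast h1
  rw [hk, Int.abs_lt_one_iff.1 h2]; simp

/-- The angle swept out by a closed chain jumps by a full turn across an edge. -/
theorem sweep_jump {x y : ℂ} {i : Fin n}
    (hd : ∀ j, j ≠ i → Disjoint (segment ℝ x y) (segment ℝ (p j) (p (finRotate n j))))
    (hi : ∀ w ∈ segment ℝ x y, -ratio p i w ∈ Complex.slitPlane)
    (hx : 0 < (ratio p i x).im) (hy : (ratio p i y).im < 0) :
    sweep p x = sweep p y + 2 * Real.pi := by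
  classical
  -- Negating the `i`-th ratio moves the branch cut away from the path, so `G` is continuous across
  -- the edge. Its values lie in π + 2πℤ, so it is constant; the jump of the sweep comes from
  -- comparing the two branches at the ends.
  let G : ℂ → ℝ := fun w => (-ratio p i w).arg + ∑ j ∈ Finset.univ.erase i, (ratio p j w).arg
  have hne : ∀ w ∈ segment ℝ x y, ∀ j, p j - w ≠ 0 := by
    intro w hw j h
    by_cases hj : j = i
    · subst hj
      have := Complex.slitPlane_ne_zero (hi w hw)
      simp [ratio, h] at this
    · exact Set.disjoint_left.1 (hd j hj) hw (sub_eq_zero.1 h ▸ left_mem_segment ℝ _ _)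
  have hG : G x = G y := by
    refine eq_of_continuousOn_of_discrete (c := Real.pi) (convex_segment x y).isPreconnected ?_
      (fun w hw => ?_) (left_mem_segment ℝ x y) (right_mem_segment ℝ x y)
    · refine ContinuousOn.add ?_ (continuousOn_finsetSum _ fun j hj =>
        continuousOn_ratio_arg (hd j (Finset.ne_of_mem_erase hj)))
      intro w hw
      refine (ContinuousAt.comp (g := Complex.arg) (f := fun w => -ratio p i w)
        (Complex.continuousAt_arg (hi w hw)) ?_).continuousWithinAt
      exact (ContinuousAt.div (by fun_prop) (by fun_prop) (hne w hw i)).neg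
    · refine exists_eq_of_exp_eq ?_
      simp only [G]
      push_cast
      have h0 := hne w hw
      rw [add_mul, Finset.sum_mul, Complex.exp_add, Complex.exp_sum,
        Finset.prod_congr rfl fun i _ => exp_arg_mul_I (ratio_ne_zero h0 i),
        exp_arg_mul_I (neg_ne_zero.2 (ratio_ne_zero h0 i)), norm_neg, neg_div, neg_mul,
        Finset.mul_prod_erase Finset.univ (fun i => ratio p i w / (‖ratio p i w‖ : ℂ))
          (Finset.mem_univ i), Finset.prod_div_distrib,
        ← Complex.ofReal_prod, ← norm_prod, prod_ratio h0]
      simp [Complex.exp_pi_mul_I]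
  have h1 : ∀ w, sweep p w = (ratio p i w).arg + ∑ j ∈ Finset.univ.erase i, (ratio p j w).arg :=
    fun w => (Finset.add_sum_erase Finset.univ (fun j => (ratio p j w).arg)
      (Finset.mem_univ i)).symm
  have h2 := Complex.arg_neg_eq_arg_sub_pi_of_im_pos hx
  have h3 := Complex.arg_neg_eq_arg_add_pi_of_im_neg hy
  simp only [G, h2, h3] at hG
  rw [h1, h1]
  linarith

end Winding

/-! ### Slitting a connected open set. -/

section Slit

/-- In the coordinate `g` sending `a` to 0 and `b` to 1, the slit set is the union of its parts
above the line, beyond `b`, and below the line. Each is convex, and the middle one meets the other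
two near `b`. No point of `W` lies on the line behind `a`, since convexity would then put `a` into
`W`. -/
theorem isPreconnected_sdiff_segment {W : Set ℂ} (hWo : IsOpen W) (hWc : Convex ℝ W) {a b : ℂ}
    (hab : a ≠ b) (ha : a ∉ W) (hb : b ∈ W) : IsPreconnected (W \ segment ℝ a b) := by
  have hu : b - a ≠ 0 := sub_ne_zero.2 hab.symm
  let g : ℂ → ℂ := fun y => (y - a) / (b - a)
  have hgc : Continuous g := by fun_prop
  have hg : ∀ (x y : ℂ) (s t : ℝ), s + t = 1 → g (s • x + t • y) = s * g x + t * g y := by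
    intro x y s t h
    have h' : (s : ℂ) + t = 1 := by exact_mod_cast h
    simp only [g, Complex.real_smul]
    field_simp
    linear_combination a * h'
  have hg' : ∀ w : ℂ, g (a + w * (b - a)) = w := fun w => by
    simp only [g]; rw [add_sub_cancel_left, mul_div_assoc, div_self hu, mul_one]
  have hconv1 : Convex ℝ {y | 0 < (g y).im} := by
    intro x hx y hy s t hs ht hst
    simp only [Set.mem_ofPred_eq] at hx hy ⊢
    rw [hg x y s t hst]; simp
    rcases hs.eq_or_lt with rfl | hs
    · simp at hst; subst hst; simpa using hy
    · nlinarith [mul_pos hs hx, mul_nonneg ht hy.le]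
  have hconv2 : Convex ℝ {y | (g y).im < 0} := by
    intro x hx y hy s t hs ht hst
    simp only [Set.mem_ofPred_eq] at hx hy ⊢
    rw [hg x y s t hst]; simp
    rcases hs.eq_or_lt with rfl | hs
    · simp at hst; subst hst; simpa using hy
    · nlinarith [mul_neg_of_pos_of_neg hs hx, mul_nonpos_of_nonneg_of_nonpos ht hy.le]
  have hconv3 : Convex ℝ {y | 1 < (g y).re} := by
    intro x hx y hy s t hs ht hst
    simp only [Set.mem_ofPred_eq] at hx hy ⊢
    rw [hg x y s t hst]; simp
    rcases hs.eq_or_lt with rfl | hs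
    · simp at hst; subst hst; simpa using hy
    · nlinarith [mul_lt_mul_of_pos_left hx hs, mul_le_mul_of_nonneg_left hy.le ht]
  have hnear : ∀ w : ℂ, ∃ t : ℝ, 0 < t ∧ a + (1 + t * w) * (b - a) ∈ W := by
    intro w
    have hc : Continuous fun t : ℝ => a + (1 + (t : ℂ) * w) * (b - a) := by fun_prop
    have h1 : ∀ᶠ t : ℝ in 𝓝 0, a + (1 + (t : ℂ) * w) * (b - a) ∈ W :=
      hc.continuousAt.eventually_mem (hWo.mem_nhds (by simpa using hb))
    obtain ⟨t, ht, ht'⟩ := ((h1.filter_mono nhdsWithin_le_nhds).and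
      (self_mem_nhdsWithin (s := Set.Ioi (0 : ℝ)))).exists
    exact ⟨t, ht', ht⟩
  have heq : W \ segment ℝ a b =
      (W ∩ {y | 0 < (g y).im}) ∪ (W ∩ {y | 1 < (g y).re}) ∪ (W ∩ {y | (g y).im < 0}) := by
    have hy' : ∀ y, y = a + g y * (b - a) := fun y => by simp only [g]; field_simp; ring
    have hseg : ∀ y, y ∈ segment ℝ a b → (g y).im = 0 ∧ (g y).re ≤ 1 := by
      intro y hy
      rw [segment_eq_image'] at hy
      obtain ⟨t, ht, rfl⟩ := hy
      simp only [Complex.real_smul]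
      rw [hg']; simpa using ht.2
    ext y
    constructor
    · rintro ⟨hyW, hys⟩
      rcases lt_trichotomy (g y).im 0 with h | h | h
      · exact Or.inr ⟨hyW, h⟩
      · refine Or.inl (Or.inr ⟨hyW, ?_⟩)
        by_contra! h1
        simp only [Set.mem_ofPred_eq, not_lt] at h1
        have hyr : y = a + (g y).re * (b - a) := by
          conv_lhs => rw [hy' y]
          congr 2
          exact Complex.ext (by simp) (by simpa using h)
        rcases le_or_gt 0 (g y).re with h0 | h0
        · apply hys
          rw [hyr]
          exact PlaneTree.mem_segment_add_smul h0 h1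
        · apply ha
          have : a = y + ((-(g y).re) / (1 - (g y).re) : ℝ) * (b - y) := by
            have h3 : (1 - (g y).re : ℂ) ≠ 0 := by
              norm_cast; linarith
            push_cast
            field_simp
            linear_combination -hyr
          rw [this]
          refine hWc.segment_subset hyW hb (PlaneTree.mem_segment_add_smul ?_ ?_)
          · apply div_nonneg <;> linarith
          · rw [div_le_one (by linarith)]; linarith
      · exact Or.inl (Or.inl ⟨hyW, h⟩)
    · rintro ((⟨hyW, h⟩ | ⟨hyW, h⟩) | ⟨hyW, h⟩) <;> refine ⟨hyW, fun hs => ?_⟩ <;>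
      obtain ⟨h1, h2⟩ := hseg y hs <;> simp only [Set.mem_ofPred_eq] at h <;> linarith
  rw [heq]
  obtain ⟨t1, ht1, hW1⟩ := hnear (1 + Complex.I)
  obtain ⟨t2, ht2, hW2⟩ := hnear (1 - Complex.I)
  refine IsPreconnected.union _ (Or.inr ⟨hW2, ?_⟩) ⟨hW2, ?_⟩
    (IsPreconnected.union _ ⟨hW1, ?_⟩ ⟨hW1, ?_⟩ (hWc.inter hconv1).isPreconnected
    (hWc.inter hconv3).isPreconnected) (hWc.inter hconv2).isPreconnected <;>
  simp only [Set.mem_ofPred_eq, hg'] <;> simp <;> linarith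

/-- Removing a segment that starts on a closed set and otherwise runs in a convex open set in the
complement does not disconnect the complement. -/
theorem isPreconnected_compl_union_segment {C W : Set ℂ} (hC : IsPreconnected Cᶜ)
    (hCc : IsClosed C) (hWo : IsOpen W) (hWc : Convex ℝ W) {a b : ℂ} (hab : a ≠ b) (ha : a ∈ C)
    (hW : segment ℝ a b ⊆ insert a W) (hWC : Disjoint W C) :
    IsPreconnected (C ∪ segment ℝ a b)ᶜ := by
  have haW : a ∉ W := fun h => Set.disjoint_left.1 hWC h ha
  have hbW : b ∈ W := (hW (right_mem_segment ℝ a b)).resolve_left hab.symm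
  have hW' := isPreconnected_sdiff_segment hWo hWc hab haW hbW
  have hAo : IsOpen (C ∪ segment ℝ a b)ᶜ := (hCc.union (isCompact_segment a
      b).isClosed).isOpen_compl
  have hW'A : W \ segment ℝ a b ⊆ (C ∪ segment ℝ a b)ᶜ := by
    rintro y ⟨h1, h2⟩ (h | h)
    · exact Set.disjoint_left.1 hWC h1 h
    · exact h2 h
  intro u v hu hv hAuv hAu hAv
  -- If the slit neighbourhood avoids `v`, the slit can be closed by adding `W` to `u`, and
  -- connectedness of `Cᶜ` applies. If it meets both open sets, its own connectedness is enough.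
  have main : ∀ u v : Set ℂ, IsOpen u → IsOpen v → (C ∪ segment ℝ a b)ᶜ ⊆ u ∪ v →
      ((C ∪ segment ℝ a b)ᶜ ∩ u).Nonempty → ((C ∪ segment ℝ a b)ᶜ ∩ v).Nonempty →
      Disjoint (W \ segment ℝ a b) v → ((C ∪ segment ℝ a b)ᶜ ∩ (u ∩ v)).Nonempty := by
    intro u v hu hv hAuv ⟨x, hxA, hxu⟩ ⟨y, hyA, hyv⟩ hdisj
    have hsub : (C ∪ segment ℝ a b)ᶜ ⊆ Cᶜ := Set.compl_subset_compl.2 Set.subset_union_left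
    obtain ⟨w, hwC, hwu, hwv, hwA⟩ := hC (u ∪ W) (v ∩ (C ∪ segment ℝ a b)ᶜ) (hu.union hWo)
      (hv.inter hAo) (by
        intro w hw
        by_cases hs : w ∈ segment ℝ a b
        · rcases hW hs with rfl | h
          · exact absurd ha hw
          · exact Or.inl (Or.inr h)
        · have hwA : w ∈ (C ∪ segment ℝ a b)ᶜ := by
            rintro (h | h)
            · exact hw h
            · exact hs h
          rcases hAuv hwA with h | h
          · exact Or.inl (Or.inl h)
          · exact Or.inr ⟨h, hwA⟩)
      ⟨x, hsub hxA, Or.inl hxu⟩ ⟨y, hsub hyA, hyv, hyA⟩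
    rcases hwu with h | h
    · exact ⟨w, hwA, h, hwv⟩
    · exact absurd hwv (Set.disjoint_left.1 hdisj ⟨h, fun h' => hwA (Or.inr h')⟩)
  by_cases hv' : Disjoint (W \ segment ℝ a b) v
  · exact main u v hu hv hAuv hAu hAv hv'
  by_cases hu' : Disjoint (W \ segment ℝ a b) u
  · rw [Set.inter_comm u v]
    exact main v u hv hu (by rwa [Set.union_comm v u]) hAv hAu hu'
  rw [Set.not_disjoint_iff] at hu' hv'
  obtain ⟨y, hy⟩ := hW' u v hu hv (hW'A.trans hAuv) hu' hv'
  exact ⟨y, hW'A hy.1, hy.2⟩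

/-- A segment leaving an endpoint of another one in a different direction is separated from it, up
to this endpoint, by a line. -/
theorem exists_halfPlane_of_ne {a b c : ℂ} (hb : a ≠ b) (h : ∀ r : ℝ, 0 < r → c - a ≠ r * (b - a)) :
    ∃ H : Set ℂ, IsOpen H ∧ Convex ℝ H ∧ segment ℝ a b ⊆ insert a H ∧
      Disjoint H (segment ℝ a c) := by
  obtain ⟨f, hfb, hfc⟩ : ∃ f : ℂ →L[ℝ] ℝ, 0 < f (b - a) ∧ f (c - a) ≤ 0 := by
    by_cases hc : a = c
    · subst hc
      refine ⟨innerSL ℝ (b - a), ?_, by simp⟩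
      rw [innerSL_apply_apply, real_inner_self_eq_norm_sq]
      exact pow_pos (norm_pos_iff.2 (sub_ne_zero.2 hb.symm)) 2
    have hu : 0 < ‖b - a‖ := norm_pos_iff.2 (sub_ne_zero.2 hb.symm)
    have hw : 0 < ‖c - a‖ := norm_pos_iff.2 (sub_ne_zero.2 (Ne.symm hc))
    set u := b - a
    set w := c - a
    have hn : ∀ y : ℂ, 0 < ‖y‖ → ‖(‖y‖⁻¹ : ℝ) • y‖ = 1 := fun y hy => by
      rw [norm_smul, norm_inv, norm_norm, inv_mul_cancel₀ hy.ne']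
    have hlt : inner ℝ ((‖u‖⁻¹ : ℝ) • u) ((‖w‖⁻¹ : ℝ) • w) < 1 := by
      rw [inner_lt_one_iff_real_of_norm_eq_one (hn u hu) (hn w hw)]
      intro he
      refine h (‖w‖ * ‖u‖⁻¹) (by positivity) ?_
      have := congrArg (fun y => (‖w‖ : ℝ) • y) he
      simp only [smul_smul, mul_inv_cancel₀ hw.ne', one_smul] at this
      exact this.symm.trans Complex.real_smul
    -- The difference of the two unit vectors is normal to the bisector of their angle; the signs
    -- follow from the strict Cauchy–Schwarz inequality.
    refine ⟨innerSL ℝ ((‖u‖⁻¹ : ℝ) • u - (‖w‖⁻¹ : ℝ) • w), ?_, ?_⟩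
    · have h1 : inner ℝ ((‖u‖⁻¹ : ℝ) • u - (‖w‖⁻¹ : ℝ) • w) u =
          ‖u‖ * (1 - inner ℝ ((‖u‖⁻¹ : ℝ) • u) ((‖w‖⁻¹ : ℝ) • w)) := by
        rw [inner_sub_left, inner_smul_left, inner_smul_left,
          inner_smul_left, real_inner_self_eq_norm_sq]
        simp only [conj_trivial]
        rw [inner_smul_right, real_inner_comm]
        field_simp
      rw [innerSL_apply_apply, h1]
      exact mul_pos hu (by linarith)
    · have h1 : inner ℝ ((‖u‖⁻¹ : ℝ) • u - (‖w‖⁻¹ : ℝ) • w) w =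
          -(‖w‖ * (1 - inner ℝ ((‖u‖⁻¹ : ℝ) • u) ((‖w‖⁻¹ : ℝ) • w))) := by
        rw [inner_sub_left, inner_smul_left, inner_smul_left,
          inner_smul_left, real_inner_self_eq_norm_sq]
        simp only [conj_trivial]
        rw [inner_smul_right]
        field_simp
        ring
      rw [innerSL_apply_apply, h1]
      have := mul_pos hw (by linarith : 0 < 1 - inner ℝ ((‖u‖⁻¹ : ℝ) • u) ((‖w‖⁻¹ : ℝ) • w))
      linarith
  refine ⟨{y | f a < f y}, isOpen_lt continuous_const f.continuous,
    convex_halfSpace_gt f.isLinear (f a), ?_, ?_⟩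
  · intro y hy
    rw [segment_eq_image'] at hy
    obtain ⟨t, ⟨ht, -⟩, rfl⟩ := hy
    rcases ht.eq_or_lt with rfl | ht
    · left; simp
    · right
      simp only [Set.mem_ofPred_eq, map_add, map_smul, smul_eq_mul]
      nlinarith
  · rw [Set.disjoint_right]
    intro y hy
    rw [segment_eq_image'] at hy
    obtain ⟨t, ⟨ht, -⟩, rfl⟩ := hy
    simp only [Set.mem_ofPred_eq, map_add, map_smul, smul_eq_mul, not_lt]
    nlinarith

/-- Strict separation even puts all of the first segment into the half-plane; `insert a` is kept to
match the case of a common endpoint. -/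
theorem exists_halfPlane_of_disjoint {a b c d : ℂ}
    (h : Disjoint (segment ℝ a b) (segment ℝ c d)) :
    ∃ H : Set ℂ, IsOpen H ∧ Convex ℝ H ∧ segment ℝ a b ⊆ insert a H ∧
      Disjoint H (segment ℝ c d) := by
  obtain ⟨f, u, v, h1, h2, h3⟩ := geometric_hahn_banach_compact_closed (convex_segment a b)
    (isCompact_segment a b) (convex_segment c d) (isCompact_segment c d).isClosed h
  refine ⟨{y | f y < u}, isOpen_lt f.continuous continuous_const,
    convex_halfSpace_lt f.isLinear u, fun y hy => Or.inr (h1 y hy), ?_⟩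
  rw [Set.disjoint_right]
  intro y hy
  simp only [Set.mem_ofPred_eq, not_lt]
  exact (h2.trans (h3 y hy)).le

end Slit

/-! ### A plane tree is a null set that does not separate the plane. -/

namespace PlaneTree

variable {V : Type*} (T : PlaneTree V)

/-- The segment drawn for a dart. -/
def seg (d : T.graph.Dart) : Set ℂ := segment ℝ (T.z d.fst) (T.z d.snd)

theorem seg_symm (d : T.graph.Dart) : T.seg d.symm = T.seg d := segment_symm ℝ _ _

/-- The union of the edges of the tree in the complex plane. -/
def edgeUnion : Set ℂ := ⋃ d, T.seg d

theorem seg_subset (d : T.graph.Dart) : T.seg d ⊆ T.edgeUnion := Set.subset_iUnion T.seg d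

theorem exists_dart_fst {v w : V} (h : v ≠ w) : ∃ d : T.graph.Dart, d.fst = v := by
  obtain ⟨p⟩ := T.isTree.1.preconnected v w
  cases p with
  | nil => exact absurd rfl h
  | cons h p => exact ⟨⟨(_, _), h⟩, rfl⟩

/-- A vertex lying on an edge is one of its ends. -/
theorem eq_of_z_mem_seg {v : V} {d : T.graph.Dart} (h : T.z v ∈ T.seg d) :
    v = d.fst ∨ v = d.snd := by
  by_cases hv : v = d.fst
  · exact Or.inl hv
  obtain ⟨e, he⟩ := T.exists_dart_fst hv
  by_cases hed : d.edge = e.edge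
  · have : v ∈ d.edge := by rw [hed, ← he]; exact Sym2.mem_mk_left _ _
    exact Sym2.mem_iff.1 this
  · obtain ⟨w, ⟨hw, -⟩, hw'⟩ := T.inter_segment_subset hed ⟨h, he ▸ left_mem_segment ℝ _ _⟩
    rw [← T.z_injective hw']
    exact hw

/-- The far end of `d` is no vertex of `e`, so the two edges are disjoint or meet only at `d.fst`;
each case has its own separating line. -/
theorem exists_halfPlane {d e : T.graph.Dart} (hf : d.snd ≠ e.fst) (hs : d.snd ≠ e.snd) :
    ∃ H : Set ℂ, IsOpen H ∧ Convex ℝ H ∧ T.seg d ⊆ insert (T.z d.fst) H ∧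
      Disjoint H (T.seg e) := by
  have hedge : d.edge ≠ e.edge := by
    intro h
    have : d.snd ∈ e.edge := h ▸ Sym2.mem_mk_right _ _
    rcases Sym2.mem_iff.1 this with h | h
    · exact hf h
    · exact hs h
  have key : ∀ e : T.graph.Dart, d.fst = e.fst → d.snd ≠ e.snd → ∃ H : Set ℂ, IsOpen H ∧
      Convex ℝ H ∧ T.seg d ⊆ insert (T.z d.fst) H ∧ Disjoint H (T.seg e) := by
    intro e h1 h2
    rw [seg, seg, ← h1]
    refine exists_halfPlane_of_ne (fun h => d.adj.ne (T.z_injective h)) fun r hr h => h2 ?_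
    rw [T.eq_of_dir_eq_smul (d := d) (e := e) h1 hr (by rw [dir, dir, ← h1]; exact h)]
  by_cases hdis : Disjoint (T.seg d) (T.seg e)
  · exact exists_halfPlane_of_disjoint hdis
  · obtain ⟨x, hx1, hx2⟩ := Set.not_disjoint_iff.1 hdis
    obtain ⟨v, ⟨hv1, hv2⟩, -⟩ := T.inter_segment_subset hedge ⟨hx1, hx2⟩
    rcases hv1 with rfl | hv1
    · rcases hv2 with h | h
      · exact key e h hs
      · rw [← T.seg_symm e]
        exact key e.symm h hf
    · rw [Set.mem_singleton_iff] at hv1; subst hv1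
      rcases hv2 with h | h
      · exact absurd h hf
      · exact absurd h hs

variable [Finite V]

theorem isCompact_edgeUnion : IsCompact T.edgeUnion :=
  isCompact_iUnion fun _ => isCompact_segment _ _

/-- The tree is grown from `r`. If a maximal vertex set with connected complement is not everything,
some edge leaves it. The half-planes separating this edge from all earlier ones intersect in a
convex open set containing the edge up to its foot, so slitting applies. Reachability is recorded in
order to see afterwards that no edge is missing. -/
theorem isPreconnected_compl_aux (r : V) : ∃ F : Set T.graph.Dart,
    (∀ v, (SimpleGraph.fromEdgeSet (SimpleGraph.Dart.edge '' F)).Reachable r v) ∧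
    IsPreconnected ({T.z r} ∪ ⋃ d ∈ F, T.seg d)ᶜ := by
  let Q : Set V → Prop := fun A => r ∈ A ∧ ∃ F : Set T.graph.Dart,
    (∀ d ∈ F, d.fst ∈ A ∧ d.snd ∈ A) ∧ (∀ v ∈ A, T.z v ∈ {T.z r} ∪ ⋃ d ∈ F, T.seg d) ∧
    (∀ v ∈ A, (SimpleGraph.fromEdgeSet (SimpleGraph.Dart.edge '' F)).Reachable r v) ∧
    IsPreconnected ({T.z r} ∪ ⋃ d ∈ F, T.seg d)ᶜ
  have h0 : Q {r} := by
    refine ⟨rfl, ∅, by simp, by simp, by simp, ?_⟩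
    simp only [Set.mem_empty_iff_false, Set.iUnion_of_empty, Set.iUnion_empty, Set.union_empty]
    refine (isConnected_compl_singleton_of_one_lt_rank ?_ _).isPreconnected
    rw [Complex.rank_real_complex]; norm_num
  obtain ⟨A, -, hA, hmax⟩ := (Set.toFinite {A | Q A}).exists_le_maximal h0
  have hmax' : ∀ B, Q B → A ⊆ B → B ⊆ A := fun B hB h => hmax hB h
  obtain ⟨hrA, F, hF, hzA, hreach, hpre⟩ := hA
  by_cases huniv : A = Set.univ
  · exact ⟨F, fun v => hreach v (huniv ▸ Set.mem_univ v), hpre⟩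
  exfalso
  obtain ⟨b, hb⟩ := (Set.ne_univ_iff_exists_notMem A).1 huniv
  obtain ⟨p⟩ := T.isTree.1.preconnected r b
  obtain ⟨d, -, hd1, hd2⟩ := p.exists_boundary_dart A hrA hb
  have hH : ∀ e ∈ F, ∃ H : Set ℂ, IsOpen H ∧ Convex ℝ H ∧ T.seg d ⊆ insert (T.z d.fst) H ∧
      Disjoint H (T.seg e) := fun e he => T.exists_halfPlane
    (fun h => hd2 (h ▸ (hF e he).1)) (fun h => hd2 (h ▸ (hF e he).2))
  have hzd : T.z d.fst ≠ T.z d.snd := fun h => d.adj.ne (T.z_injective h)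
  -- The root is treated as a degenerate segment, since it belongs to the closed set even while `F`
  -- is empty.
  obtain ⟨H0, ho0, hc0, hs0, hd0⟩ : ∃ H : Set ℂ, IsOpen H ∧ Convex ℝ H ∧
      T.seg d ⊆ insert (T.z d.fst) H ∧ Disjoint H (segment ℝ (T.z r) (T.z r)) := by
    by_cases h : d.fst = r
    · rw [← h]
      refine exists_halfPlane_of_ne hzd fun s hs h' => ?_
      rw [sub_self] at h'
      exact mul_ne_zero (by exact_mod_cast hs.ne') (sub_ne_zero.2 hzd.symm) h'.symm
    · refine exists_halfPlane_of_disjoint ?_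
      rw [segment_same, Set.disjoint_singleton_right]
      intro h'
      rcases T.eq_of_z_mem_seg h' with h' | h'
      · exact h h'.symm
      · exact hd2 (h' ▸ hrA)
  choose! H hHo hHc hHs hHd using hH
  have hslit := isPreconnected_compl_union_segment (W := H0 ∩ ⋂ e ∈ F, H e) hpre
    (isClosed_singleton.union (Set.Finite.isClosed_biUnion (Set.toFinite F)
      fun e _ => (isCompact_segment _ _).isClosed))
    (ho0.inter (Set.Finite.isOpen_biInter (Set.toFinite F) hHo))
    (hc0.inter (convex_iInter₂ hHc)) hzd (hzA _ hd1) (by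
      intro x hx
      rcases hs0 hx with h | h
      · exact Or.inl h
      by_cases hx0 : x = T.z d.fst
      · exact Or.inl hx0
      refine Or.inr ⟨h, Set.mem_iInter₂.2 fun e he => ?_⟩
      exact (hHs e he hx).resolve_left hx0)
    (by
      rw [Set.disjoint_left]
      rintro x ⟨hx0, hx⟩ (h | h)
      · exact Set.disjoint_left.1 hd0 hx0 (by rwa [segment_same])
      · obtain ⟨e, he, hxe⟩ := Set.mem_iUnion₂.1 h
        exact Set.disjoint_left.1 (hHd e he) (Set.mem_iInter₂.1 hx e he) hxe)
  have heq : {T.z r} ∪ ⋃ e ∈ insert d F, T.seg e = ({T.z r} ∪ ⋃ e ∈ F, T.seg e) ∪ T.seg d := by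
    rw [Set.biUnion_insert, Set.union_comm (T.seg d), Set.union_assoc]
  have hle : SimpleGraph.fromEdgeSet (SimpleGraph.Dart.edge '' F) ≤
      SimpleGraph.fromEdgeSet (SimpleGraph.Dart.edge '' (insert d F)) :=
    SimpleGraph.fromEdgeSet_mono (Set.image_mono (Set.subset_insert _ _))
  refine hd2 (hmax' (insert d.snd A) ⟨Or.inr hrA, insert d F, ?_, ?_, ?_, ?_⟩
    (Set.subset_insert _ _) (Set.mem_insert _ _))
  · rintro e (rfl | he)
    · exact ⟨Or.inr hd1, Or.inl rfl⟩
    · exact ⟨Or.inr (hF e he).1, Or.inr (hF e he).2⟩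
  · rw [heq]
    rintro v (rfl | hv)
    · exact Or.inr (right_mem_segment ℝ _ _)
    · exact Or.inl (hzA v hv)
  · rintro v (rfl | hv)
    · refine ((hreach _ hd1).mono hle).trans (SimpleGraph.Adj.reachable ?_)
      rw [SimpleGraph.fromEdgeSet_adj]
      exact ⟨⟨d, Or.inl rfl, rfl⟩, d.adj.ne⟩
    · exact (hreach v hv).mono hle
  · rw [heq]; exact hslit

/-- A noncrossing geometric tree does not separate the plane. -/
theorem isPreconnected_compl_edgeUnion [Nonempty T.graph.Dart] :
    IsPreconnected T.edgeUnionᶜ := by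
  obtain ⟨d0⟩ := ‹Nonempty T.graph.Dart›
  obtain ⟨F, hreach, hpre⟩ := T.isPreconnected_compl_aux d0.fst
  convert hpre using 2
  apply Set.Subset.antisymm
  · intro x hx
    obtain ⟨e, he⟩ := Set.mem_iUnion.1 hx
    suffices h : ∃ d ∈ F, d.edge = e.edge by
      obtain ⟨d, hd, hde⟩ := h
      refine Or.inr (Set.mem_iUnion₂.2 ⟨d, hd, ?_⟩)
      rcases (SimpleGraph.dart_edge_eq_iff _ _).1 hde with rfl | rfl
      · exact he
      · rwa [T.seg_symm]
    -- A missing edge would be a bridge of the tree whose ends are nevertheless joined inside `F`.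
    by_contra! hc
    have hb := SimpleGraph.isAcyclic_iff_forall_adj_isBridge.1 T.isTree.2 e.adj
    rw [SimpleGraph.isBridge_iff] at hb
    refine hb (((hreach e.fst).symm.trans (hreach e.snd)).mono ?_)
    intro v w hvw
    obtain ⟨⟨d, hd, hd'⟩, hne⟩ := (SimpleGraph.fromEdgeSet_adj _).1 hvw
    rw [SimpleGraph.deleteEdges_adj]
    have := d.edge_mem
    rw [hd'] at this
    refine ⟨this, fun h => hc d hd (hd'.trans h)⟩
  · rintro x (rfl | hx)
    · exact T.seg_subset d0 (left_mem_segment ℝ _ _)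
    · obtain ⟨d, -, hd⟩ := Set.mem_iUnion₂.1 hx
      exact T.seg_subset d hd

theorem volume_edgeUnion : MeasureTheory.volume T.edgeUnion = 0 := by
  refine MeasureTheory.measure_iUnion_null fun d => ?_
  have hsub : T.seg d ⊆ (line[ℝ, T.z d.fst, T.z d.snd] : Set ℂ) := by
    intro x hx
    exact (convexHull_pair (𝕜 := ℝ) (T.z d.fst) (T.z d.snd) ▸ convexHull_subset_affineSpan _) hx
  refine MeasureTheory.measure_mono_null hsub (MeasureTheory.Measure.addHaar_affineSubspace _ _ ?_)
  intro h
  have h1 := (collinear_pair ℝ (T.z d.fst) (T.z d.snd)).finrank_le_one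
  rw [← direction_affineSpan, h, AffineSubspace.direction_top, finrank_top,
    Complex.finrank_real_complex] at h1
  norm_num at h1

end PlaneTree

/-! ### The region enclosed by a closed set and its area. -/

section Region

/-- A set together with the bounded components of its complement. -/
def fill (B : Set ℂ) : Set ℂ :=
  B ∪ {x | x ∉ B ∧ Bornology.IsBounded (connectedComponentIn Bᶜ x)}

/-- The complement is the union of the unbounded components of an open set, and these are open. -/
theorem isClosed_fill {B : Set ℂ} (hB : IsClosed B) : IsClosed (fill B) := by
  rw [← isOpen_compl_iff, isOpen_iff_mem_nhds]
  intro x hx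
  have hxB : x ∈ Bᶜ := fun h => hx (Or.inl h)
  have ho : IsOpen (connectedComponentIn Bᶜ x) := hB.isOpen_compl.connectedComponentIn
  refine Filter.mem_of_superset (ho.mem_nhds (mem_connectedComponentIn hxB)) ?_
  rintro y hy (h | ⟨-, h⟩)
  · exact connectedComponentIn_subset _ _ hy h
  · rw [← connectedComponentIn_eq hy] at h
    exact hx (Or.inr ⟨hxB, h⟩)

theorem not_isBounded_of_subset {B S : Set ℂ} (hS : IsPreconnected S) (hSB : Disjoint S B) {x : ℂ}
    (hx : x ∈ S) (hb : ¬ Bornology.IsBounded S) :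
    ¬ Bornology.IsBounded (connectedComponentIn Bᶜ x) := fun h =>
  hb (h.subset (hS.subset_connectedComponentIn hx hSB.subset_compl_right))

theorem not_isBounded_ray {x : ℂ} (hx : x ≠ 0) :
    ¬ Bornology.IsBounded ((fun t : ℝ => (t : ℂ) * x) '' Set.Ici 1) := by
  intro h
  obtain ⟨C, hC⟩ := h.exists_norm_le
  have h1 := hC _ ⟨max 1 ((C + 1) / ‖x‖), Set.mem_Ici.2 (le_max_left _ _), rfl⟩
  have hx' : 0 < ‖x‖ := norm_pos_iff.2 hx
  rw [norm_mul, Complex.norm_real, Real.norm_eq_abs] at h1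
  have h2 : (C + 1) / ‖x‖ ≤ |max 1 ((C + 1) / ‖x‖)| := (le_max_right _ _).trans (le_abs_self _)
  have h3 := mul_le_mul_of_nonneg_right h2 hx'.le
  rw [div_mul_cancel₀ _ hx'.ne'] at h3
  linarith

theorem isPreconnected_ray (x : ℂ) : IsPreconnected ((fun t : ℝ => (t : ℂ) * x) '' Set.Ici 1) :=
  isPreconnected_Ici.image _ (by fun_prop)

theorem norm_le_of_mem_ray {x y : ℂ} (hy : y ∈ (fun t : ℝ => (t : ℂ) * x) '' Set.Ici 1) :
    ‖x‖ ≤ ‖y‖ := by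
  obtain ⟨t, ht, rfl⟩ := hy
  simp only [Set.mem_Ici] at ht
  rw [norm_mul, Complex.norm_real, Real.norm_of_nonneg (by linarith)]
  exact le_mul_of_one_le_left (norm_nonneg _) ht

theorem self_mem_ray (x : ℂ) : x ∈ (fun t : ℝ => (t : ℂ) * x) '' Set.Ici 1 :=
  ⟨1, Set.mem_Ici.2 le_rfl, by simp⟩

theorem fill_subset_closedBall {B : Set ℂ} {R : ℝ} (hR : 0 ≤ R) (hB : B ⊆ Metric.closedBall 0 R) :
    fill B ⊆ Metric.closedBall 0 R := by
  rintro x (h | ⟨-, h⟩)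
  · exact hB h
  by_contra hx
  simp only [Metric.mem_closedBall, dist_zero_right, not_le] at hx
  refine not_isBounded_of_subset (isPreconnected_ray x) ?_ (self_mem_ray x)
    (not_isBounded_ray (norm_pos_iff.1 (hR.trans_lt hx))) h
  rw [Set.disjoint_left]
  intro y hy hyB
  have := hB hyB
  simp only [Metric.mem_closedBall, dist_zero_right] at this
  linarith [norm_le_of_mem_ray hy]

/-- If a compact set `C` does not separate the plane, then a point off `C` is in an unbounded
component of the complement of each set close to `C`. -/
theorem exists_thickening_not_isBounded {C : Set ℂ} (hC : IsCompact C) (hCc : IsPreconnected Cᶜ)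
    {x : ℂ} (hx : x ∉ C) : ∃ η : ℝ, 0 < η ∧ ∀ B ⊆ Metric.thickening η C,
      x ∉ B ∧ ¬ Bornology.IsBounded (connectedComponentIn Bᶜ x) := by
  obtain ⟨R, hR, hCR⟩ : ∃ R : ℝ, 0 < R ∧ C ⊆ Metric.closedBall 0 R := by
    obtain ⟨R, hR⟩ := hC.isBounded.subset_closedBall 0
    exact ⟨max R 1, lt_max_of_lt_right one_pos,
      hR.trans (Metric.closedBall_subset_closedBall (le_max_left _ _))⟩
  -- From `y` outwards the radial ray keeps distance more than 1 from `C`. A path from `x` to `y`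
  -- off `C` followed by this ray therefore avoids every sufficiently thin thickening, of width at
  -- most 1.
  let y : ℂ := (R + 2 : ℝ)
  have hny : ‖y‖ = R + 2 := by
    rw [Complex.norm_real, Real.norm_of_nonneg (by linarith)]
  have hyC : y ∈ Cᶜ := fun h => by
    have := hCR h
    rw [Metric.mem_closedBall, dist_zero_right, hny] at this
    linarith
  have hpc : IsPathConnected Cᶜ :=
    hC.isClosed.isOpen_compl.isConnected_iff_isPathConnected.1 ⟨⟨x, hx⟩, hCc⟩
  obtain ⟨γ, hγ⟩ := hpc.joinedIn x hx y hyC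
  have hK : IsCompact (Set.range γ) := isCompact_range γ.continuous
  have hdis : Disjoint (Set.range γ) C := by
    rw [Set.disjoint_left]
    rintro _ ⟨t, rfl⟩ h
    exact hγ t h
  obtain ⟨η, hη, hηd⟩ := hdis.exists_thickenings hK hC.isClosed
  refine ⟨min η 1, lt_min hη one_pos, fun B hB => ?_⟩
  let S := Set.range γ ∪ (fun t : ℝ => (t : ℂ) * y) '' Set.Ici 1
  have hSpre : IsPreconnected S :=
    (isPreconnected_range γ.continuous).union y ⟨1, γ.target⟩ (self_mem_ray y) (isPreconnected_ray
        y)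
  have hxS : x ∈ S := Or.inl ⟨0, γ.source⟩
  have hSB : Disjoint S B := by
    rw [Set.disjoint_left]
    rintro w (hw | hw) hwB
    · exact Set.disjoint_left.1 hηd (Metric.self_subset_thickening hη _ hw)
        (Metric.thickening_mono (min_le_left _ _) _ (hB hwB))
    · have h1 := norm_le_of_mem_ray hw
      rw [hny] at h1
      obtain ⟨c, hc, hcd⟩ := Metric.mem_thickening_iff.1
        (Metric.thickening_mono (min_le_right _ _) _ (hB hwB))
      have h2 := hCR hc
      rw [Metric.mem_closedBall, dist_zero_right] at h2
      rw [dist_eq_norm] at hcd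
      have h3 := norm_sub_norm_le w c
      linarith
  refine ⟨fun h => Set.disjoint_left.1 hSB hxS h, not_isBounded_of_subset hSpre hSB hxS ?_⟩
  intro h
  exact not_isBounded_ray (norm_pos_iff.1 (by rw [hny]; linarith))
    (h.subset Set.subset_union_right)

/-- Closed sets that approach a null set not separating the plane have fillings of small area. -/
theorem tendsto_volume_fill {C : Set ℂ} (hC : IsCompact C) (hCc : IsPreconnected Cᶜ)
    (hC0 : MeasureTheory.volume C = 0) {B : ℝ → Set ℂ} (hB : ∀ δ, IsClosed (B δ))
    (hBC : ∀ η : ℝ, 0 < η → ∀ᶠ δ in 𝓝[>] (0 : ℝ), B δ ⊆ Metric.thickening η C) :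
    Tendsto (fun δ => MeasureTheory.volume (fill (B δ))) (𝓝[>] 0) (𝓝 0) := by
  obtain ⟨R, hR⟩ := hC.isBounded.subset_closedBall 0
  have hsub : Metric.thickening 1 C ⊆ Metric.closedBall 0 (max R 0 + 1) := by
    intro w hw
    obtain ⟨c, hc, hcd⟩ := Metric.mem_thickening_iff.1 hw
    have h2 := hR hc
    rw [Metric.mem_closedBall, dist_zero_right] at h2 ⊢
    rw [dist_eq_norm] at hcd
    have h3 := norm_sub_norm_le w c
    linarith [le_max_left R 0]
  -- Dominated convergence: almost every point is off `C` and eventually leaves the fillings, all of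
  -- which eventually lie in one ball.
  have h := MeasureTheory.tendsto_measure_of_ae_tendsto_indicator (μ := MeasureTheory.volume) (𝓝[>]
      (0 : ℝ))
    (A := ∅) (As := fun δ => fill (B δ)) (B := Metric.closedBall (0 : ℂ) (max R 0 + 1))
    MeasurableSet.empty (fun δ => (isClosed_fill (hB δ)).measurableSet)
    Metric.isClosed_closedBall.measurableSet
    (MeasureTheory.measure_closedBall_lt_top).ne
    (by
      filter_upwards [hBC 1 one_pos] with δ hδ
      exact fill_subset_closedBall (by positivity) (hδ.trans hsub))
    (by
      have : ∀ᵐ x : ℂ, x ∉ C := MeasureTheory.measure_eq_zero_iff_ae_notMem.1 hC0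
      filter_upwards [this] with x hx
      obtain ⟨η, hη, hx'⟩ := exists_thickening_not_isBounded hC hCc hx
      filter_upwards [hBC η hη] with δ hδ
      obtain ⟨h1, h2⟩ := hx' _ hδ
      simp only [Set.mem_empty_iff_false, iff_false]
      rintro (h | ⟨-, h⟩)
      · exact h1 h
      · exact h2 h)
  simpa using h

end Region

/-! ### Proper corners, straight stretches and pushed-off corners. -/

theorem turn_comb_lt {a b : ℂ} (ha : a ≠ 0) (hb : b ≠ 0) (hab : turn a b < Real.pi) {α β : ℝ}
    (hα : 0 < α) (hβ : 0 < β) : turn a (α * a + β * b) < turn a b := by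
  obtain ⟨hne, h1⟩ := turn_comb_le ha hb hab hα.le hβ
  have h3 := (comb_turn_lt_pi (β := β) ha hab hα).2
  rcases turn_add ha hne hb with h | h
  · linarith [turn_pos (α * a + β * b) b]
  · linarith [turn_pos a b]

theorem bisector_div {a : ℂ} (ha : a ≠ 0) (b : ℂ) :
    bisector a b / a = Complex.exp ((turn a b / 2 : ℝ) * Complex.I) := by
  rw [bisector, mul_div_assoc, div_self ha, mul_one]

/-- The bisector as seen from the second arm of the angle: this is the arm along which a stretch
arrives at its last corner. -/
theorem bisector_eq_right {a b : ℂ} (ha : a ≠ 0) (hb : b ≠ 0) : ∃ k : ℝ, 0 < k ∧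
    bisector a b = k * Complex.exp (-((turn a b / 2 : ℝ) * Complex.I)) * b := by
  obtain ⟨r, hr, h⟩ := eq_of_turn ha hb
  refine ⟨r⁻¹, inv_pos.2 hr, ?_⟩
  have h1 : Complex.exp (turn a b * Complex.I) = Complex.exp ((turn a b / 2 : ℝ) * Complex.I) *
      Complex.exp ((turn a b / 2 : ℝ) * Complex.I) := by
    rw [← Complex.exp_add, ← add_mul, ← Complex.ofReal_add, add_halves]
  have hr' : (r : ℂ) ≠ 0 := by exact_mod_cast hr.ne'
  rw [bisector]
  generalize turn a b = θ at h h1 ⊢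
  rw [h, h1, Complex.exp_neg]
  have := Complex.exp_ne_zero ((θ / 2 : ℝ) * Complex.I)
  generalize Complex.exp ((θ / 2 : ℝ) * Complex.I) = E at this ⊢
  push_cast
  field_simp

theorem sin_half_nonneg {θ : ℝ} (h0 : 0 < θ) (h1 : θ ≤ 2 * Real.pi) : 0 ≤ Real.sin (θ / 2) :=
  Real.sin_nonneg_of_nonneg_of_le_pi (by linarith) (by linarith)

theorem sin_half_eq_zero_iff {θ : ℝ} (h0 : 0 < θ) (h1 : θ ≤ 2 * Real.pi) :
    Real.sin (θ / 2) = 0 ↔ θ = 2 * Real.pi := by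
  constructor
  · intro h
    by_contra hne
    have : θ < 2 * Real.pi := lt_of_le_of_ne h1 hne
    exact (Real.sin_pos_of_pos_of_lt_pi (by linarith) (by linarith)).ne' h
  · rintro rfl
    rw [mul_div_cancel_left₀ _ two_ne_zero, Real.sin_pi]

/-- Cramer's rule. Only the coefficient of `b` is made explicit, because its sign matters later;
that of `a` will be multiplied by δ and absorbed by the length of a stretch. -/
theorem exists_comb {a b : ℂ} (ha : a ≠ 0) (hb : (b / a).im ≠ 0) (w : ℂ) :
    ∃ α : ℝ, w = α * a + ((w / a).im / (b / a).im : ℝ) * b := by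
  refine ⟨(w / a).re - (w / a).im / (b / a).im * (b / a).re, ?_⟩
  have h : w / a = ((w / a).re - (w / a).im / (b / a).im * (b / a).re : ℝ) +
      ((w / a).im / (b / a).im : ℝ) * (b / a) := by
    apply Complex.ext
    · simp
    · simp [div_mul_cancel₀ _ hb]
  calc w = w / a * a := by field_simp
    _ = _ := by
      conv_lhs => rw [h]
      rw [add_mul, mul_assoc, div_mul_cancel₀ _ ha]

namespace PlaneTree

variable {V : Type*} (T : PlaneTree V) [Finite V]

/-- The darts whose corner is not a straight angle. -/
def kept : Set T.graph.Dart := {d | T.ang d ≠ Real.pi}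

/-- The number of darts that the boundary walk runs straight on from a dart. -/
noncomputable def ret (d : T.graph.Dart) : ℕ := returnTime T.face T.kept d

/-- The dart after the next proper corner of the boundary walk. -/
noncomputable def succ (d : T.graph.Dart) : T.graph.Dart := T.face^[T.ret d] d

variable {T}

theorem ret_spec {d : T.graph.Dart} (hd : d ∈ T.kept) : 1 ≤ T.ret d ∧ T.succ d ∈ T.kept :=
  returnTime_spec T.exists_face_iterate_eq ⟨d, hd⟩ d

theorem ang_iterate {d : T.graph.Dart} {j : ℕ} (h1 : 1 ≤ j) (h2 : j < T.ret d) :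
    T.ang (T.face^[j] d) = Real.pi := by
  by_contra h
  exact notMem_of_lt_returnTime h1 h2 h

theorem rot_iterate (d : T.graph.Dart) (j : ℕ) : T.rot (T.face^[j + 1] d) = (T.face^[j] d).symm :=
    by
  rw [Function.iterate_succ_apply', rot_face]

theorem iterate_fst (d : T.graph.Dart) (j : ℕ) : (T.face^[j + 1] d).fst = (T.face^[j] d).snd := by
  rw [Function.iterate_succ_apply', face_fst]

theorem exists_dir_rot {d : T.graph.Dart} (h : T.ang d = Real.pi) :
    ∃ r : ℝ, 0 < r ∧ T.dir (T.rot d) = -(r * T.dir d) :=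
  (turn_eq_pi_iff (T.dir_ne_zero _) (T.dir_ne_zero _)).1 h

theorem exists_dir_iterate (d : T.graph.Dart) {j : ℕ} (hj : j < T.ret d) :
    ∃ r : ℝ, 0 < r ∧ T.dir (T.face^[j] d) = r * T.dir d := by
  induction j with
  | zero => exact ⟨1, one_pos, by simp⟩
  | succ j ih =>
    obtain ⟨r, hr, h⟩ := ih (by omega)
    obtain ⟨s, hs, h'⟩ := exists_dir_rot (ang_iterate (d := d) (by omega) hj)
    rw [rot_iterate, dir_symm, h, neg_inj] at h'
    refine ⟨s⁻¹ * r, by positivity, ?_⟩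
    have : (s : ℂ) ≠ 0 := by exact_mod_cast hs.ne'
    push_cast
    rw [mul_assoc, h']; field_simp

variable (T) in
/-- The position of the `j`-th vertex of the boundary walk along the direction of a dart. -/
noncomputable def par (d : T.graph.Dart) (j : ℕ) : ℝ :=
  ((T.z (T.face^[j] d).fst - T.z d.fst) / T.dir d).re

theorem par_zero (d : T.graph.Dart) : T.par d 0 = 0 := by simp [par]

theorem z_iterate (d : T.graph.Dart) {j : ℕ} (hj : j ≤ T.ret d) :
    T.z (T.face^[j] d).fst = T.z d.fst + T.par d j * T.dir d ∧
      (∀ k, k < j → T.par d k < T.par d j) := by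
  induction j with
  | zero => simp [par_zero]
  | succ j ih =>
    obtain ⟨h1, h2⟩ := ih (by omega)
    obtain ⟨r, hr, h⟩ := exists_dir_iterate d (show j < T.ret d by omega)
    have h3 : T.z (T.face^[j + 1] d).fst = T.z d.fst + ((T.par d j + r : ℝ) : ℂ) * T.dir d := by
      rw [iterate_fst]
      rw [dir, h1] at h
      push_cast
      linear_combination h
    have h4 : T.par d (j + 1) = T.par d j + r := by
      rw [par, h3, add_sub_cancel_left, mul_div_assoc, div_self (T.dir_ne_zero d), mul_one,
        Complex.ofReal_re]
    refine ⟨by rw [h4]; exact h3, fun k hk => ?_⟩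
    rw [h4]
    rcases Nat.lt_succ_iff_lt_or_eq.1 hk with hk | rfl
    · linarith [h2 k hk]
    · linarith

theorem par_lt (d : T.graph.Dart) {k j : ℕ} (hk : k < j) (hj : j ≤ T.ret d) :
    T.par d k < T.par d j := (z_iterate d hj).2 k hk

theorem par_nonneg (d : T.graph.Dart) {j : ℕ} (hj : j ≤ T.ret d) : 0 ≤ T.par d j := by
  rcases Nat.eq_zero_or_pos j with rfl | h
  · rw [par_zero]
  · rw [← par_zero d]; exact (par_lt d h hj).le

theorem par_ret_pos {d : T.graph.Dart} (hd : d ∈ T.kept) : 0 < T.par d (T.ret d) := by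
  rw [← par_zero d]; exact par_lt d (ret_spec hd).1 le_rfl

theorem par_le_ret (d : T.graph.Dart) {j : ℕ} (hj : j ≤ T.ret d) : T.par d j ≤ T.par d (T.ret d) :=
    by
  rcases hj.eq_or_lt with rfl | h
  · exact le_rfl
  · exact (par_lt d h le_rfl).le

theorem z_succ (d : T.graph.Dart) :
    T.z (T.succ d).fst = T.z d.fst + T.par d (T.ret d) * T.dir d := (z_iterate d le_rfl).1

variable (T) in
/-- The part of the tree that the boundary walk follows from a dart to the next proper corner. -/
def stretch (d : T.graph.Dart) : Set ℂ := ⋃ j < T.ret d, T.seg (T.face^[j] d)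

theorem isCompact_stretch (d : T.graph.Dart) : IsCompact (T.stretch d) :=
  (Set.finite_lt_nat _).isCompact_biUnion fun _ _ => isCompact_segment _ _

theorem seg_iterate (d : T.graph.Dart) {j : ℕ} (hj : j < T.ret d) :
    T.seg (T.face^[j] d) = (fun s : ℝ => T.z d.fst + s * T.dir d) ''
      Set.Icc (T.par d j) (T.par d (j + 1)) := by
  have h1 := (z_iterate d hj.le).1
  have h2 := (z_iterate d (Nat.succ_le_of_lt hj)).1
  have hlt := par_lt d (Nat.lt_succ_self j) (Nat.succ_le_of_lt hj)
  rw [Nat.succ_eq_add_one] at *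
  rw [seg, ← iterate_fst, h1, h2, segment_eq_image']
  ext y
  constructor
  · rintro ⟨t, ⟨ht0, ht1⟩, rfl⟩
    refine ⟨T.par d j + t * (T.par d (j + 1) - T.par d j), ⟨by nlinarith, by nlinarith⟩, ?_⟩
    simp only [Complex.real_smul]
    push_cast; ring
  · rintro ⟨s, ⟨hs0, hs1⟩, rfl⟩
    have hne : T.par d (j + 1) - T.par d j ≠ 0 := by linarith
    refine ⟨(s - T.par d j) / (T.par d (j + 1) - T.par d j), ⟨div_nonneg (by linarith) (by
        linarith),
      (div_le_one (by linarith)).2 (by linarith)⟩, ?_⟩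
    simp only [Complex.real_smul]
    have hne' : (T.par d (j + 1) - T.par d j : ℂ) ≠ 0 := by exact_mod_cast hne
    push_cast; field_simp; ring

theorem mem_stretch (d : T.graph.Dart) {s : ℝ} (h0 : 0 ≤ s) (h1 : s ≤ T.par d (T.ret d))
    (hd : 1 ≤ T.ret d) : T.z d.fst + s * T.dir d ∈ T.stretch d := by
  have key : ∀ k, k + 1 ≤ T.ret d → s ≤ T.par d (k + 1) →
      T.z d.fst + s * T.dir d ∈ T.stretch d := by
    intro k
    induction k with
    | zero =>
      intro hk hs
      refine Set.mem_iUnion₂.2 ⟨0, hk, ?_⟩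
      rw [seg_iterate d hk]
      exact ⟨s, ⟨by rw [par_zero]; exact h0, hs⟩, rfl⟩
    | succ k ih =>
      intro hk hs
      rcases le_or_gt s (T.par d (k + 1)) with h | h
      · exact ih (by omega) h
      · refine Set.mem_iUnion₂.2 ⟨k + 1, hk, ?_⟩
        rw [seg_iterate d hk]
        exact ⟨s, ⟨h.le, hs⟩, rfl⟩
  obtain ⟨k, hk⟩ := Nat.exists_eq_add_of_le hd
  exact key k (by omega) (by rwa [Nat.add_comm, ← hk])

variable (T) in
/-- The point near a vertex of the tree at which the polygon has the vertex that belongs to the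
corner following a dart. -/
noncomputable def corner (δ : ℝ) (d : T.graph.Dart) : ℂ := T.z d.fst + δ * T.bis d

variable (T) in
/-- The edge of the polygon that runs along a stretch of the tree. -/
noncomputable def side (δ : ℝ) (d : T.graph.Dart) : Set ℂ :=
  segment ℝ (T.corner δ d) (T.corner δ (T.succ d))

/-- The dart `T.rot (T.succ d)` is the last dart of the stretch, reversed. -/
theorem exists_dir_rot_succ {d : T.graph.Dart} (hd : d ∈ T.kept) :
    ∃ r : ℝ, 0 < r ∧ T.dir (T.rot (T.succ d)) = -(r * T.dir d) := by
  obtain ⟨k, hk⟩ := Nat.exists_eq_add_of_le (ret_spec hd).1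
  obtain ⟨r, hr, h⟩ := exists_dir_iterate d (show k < T.ret d by omega)
  refine ⟨r, hr, ?_⟩
  rw [succ, hk, Nat.add_comm, rot_iterate, dir_symm, h]

theorem ang_le_two_pi (d : T.graph.Dart) : T.ang d ≤ 2 * Real.pi := turn_le _ _

theorem bis_div_dir (d : T.graph.Dart) :
    T.bis d / T.dir d = Complex.exp ((T.ang d / 2 : ℝ) * Complex.I) :=
  bisector_div (T.dir_ne_zero d) _

/-- Half of an angle in `(0, 2π]` has nonnegative sine, zero only for a full turn. So a pushed-off
corner is never to the right of its stretch, and on its line only at a leaf. The same holds at the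
other end by `bis_succ_im`. -/
theorem bis_im_nonneg (d : T.graph.Dart) : 0 ≤ (T.bis d / T.dir d).im := by
  rw [bis_div_dir, Complex.exp_ofReal_mul_I_im]
  exact sin_half_nonneg (T.ang_pos d) (ang_le_two_pi d)

theorem bis_im_eq_zero_iff (d : T.graph.Dart) : (T.bis d / T.dir d).im = 0 ↔ T.rot d = d := by
  rw [bis_div_dir, Complex.exp_ofReal_mul_I_im,
    sin_half_eq_zero_iff (T.ang_pos d) (ang_le_two_pi d), rot_eq_self_iff]

theorem bis_of_rot_eq_self {d : T.graph.Dart} (h : T.rot d = d) : T.bis d = -T.dir d := by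
  have h1 := bis_div_dir d
  rw [(T.rot_eq_self_iff d).1 h, mul_div_cancel_left₀ _ two_ne_zero, Complex.exp_pi_mul_I,
    div_eq_iff (T.dir_ne_zero d)] at h1
  rw [h1]; ring

theorem exists_bis_succ {d : T.graph.Dart} (hd : d ∈ T.kept) : ∃ k : ℝ, 0 < k ∧
    T.bis (T.succ d) / T.dir d =
      -(k * Complex.exp (-((T.ang (T.succ d) / 2 : ℝ) * Complex.I))) := by
  obtain ⟨r, hr, h⟩ := exists_dir_rot_succ hd
  obtain ⟨k, hk, h'⟩ := bisector_eq_right (T.dir_ne_zero (T.succ d))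
    (T.dir_ne_zero (T.rot (T.succ d)))
  refine ⟨k * r, by positivity, ?_⟩
  rw [bis, h', ang, h, div_eq_iff (T.dir_ne_zero d)]
  push_cast; ring

theorem bis_succ_im {d : T.graph.Dart} (hd : d ∈ T.kept) :
    0 ≤ (T.bis (T.succ d) / T.dir d).im ∧
      ((T.bis (T.succ d) / T.dir d).im = 0 ↔ T.rot (T.succ d) = T.succ d) := by
  obtain ⟨k, hk, h⟩ := exists_bis_succ hd
  have h1 : (T.bis (T.succ d) / T.dir d).im = k * Real.sin (T.ang (T.succ d) / 2) := by
    rw [h, ← neg_mul (_ : ℂ) Complex.I, ← Complex.ofReal_neg, Complex.neg_im, Complex.im_ofReal_mul,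
      Complex.exp_ofReal_mul_I_im, Real.sin_neg]
    ring
  rw [h1]
  have h2 := sin_half_nonneg (T.ang_pos (T.succ d)) (ang_le_two_pi _)
  refine ⟨mul_nonneg hk.le h2, ?_⟩
  rw [mul_eq_zero, or_iff_right hk.ne', sin_half_eq_zero_iff (T.ang_pos _) (ang_le_two_pi _),
    rot_eq_self_iff]

theorem exists_bis_succ_of_rot_eq_self {d : T.graph.Dart} (hd : d ∈ T.kept)
    (h : T.rot (T.succ d) = T.succ d) : ∃ k : ℝ, 0 < k ∧ T.bis (T.succ d) = k * T.dir d := by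
  obtain ⟨k, hk, h1⟩ := exists_bis_succ hd
  refine ⟨k, hk, ?_⟩
  rw [(T.rot_eq_self_iff _).1 h, mul_div_cancel_left₀ _ two_ne_zero, Complex.exp_neg,
    Complex.exp_pi_mul_I, div_eq_iff (T.dir_ne_zero d)] at h1
  rw [h1]; norm_num

end PlaneTree

theorem eventually_pos_add_mul {l : ℝ} (hl : 0 < l) (a : ℝ) : ∀ᶠ δ in 𝓝[>] (0 : ℝ), 0 < l + δ * a
    := by
  have h : Tendsto (fun δ : ℝ => l + δ * a) (𝓝[>] 0) (𝓝 l) := by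
    have h1 : Continuous fun δ : ℝ => l + δ * a := by fun_prop
    have h2 := h1.tendsto 0
    rw [zero_mul, add_zero] at h2
    exact h2.mono_left nhdsWithin_le_nhds
  exact h.eventually_const_lt hl

theorem eventually_pos : ∀ᶠ δ in 𝓝[>] (0 : ℝ), 0 < δ := self_mem_nhdsWithin

/-! ### Location of a side relative to its stretch. -/

namespace PlaneTree

variable {V : Type*} {T : PlaneTree V} [Finite V]

theorem exists_of_mem_side {δ : ℝ} {d : T.graph.Dart} {y : ℂ} (hy : y ∈ T.side δ d) :
    ∃ t : ℝ, 0 ≤ t ∧ t ≤ 1 ∧ y = (1 - t) * T.corner δ d + t * T.corner δ (T.succ d) := by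
  rw [side, segment_eq_image] at hy
  obtain ⟨t, ⟨h0, h1⟩, rfl⟩ := hy
  exact ⟨t, h0, h1, by simp [Complex.real_smul]⟩

/-- In the coordinate `(y - T.z d.fst) / T.dir d` the stretch is the real interval from 0 to `T.par
d (T.ret d)`, and the imaginary part is a height over it. -/
theorem corner_sub_div (δ : ℝ) (d : T.graph.Dart) :
    (T.corner δ d - T.z d.fst) / T.dir d = δ * (T.bis d / T.dir d) := by
  rw [corner, add_sub_cancel_left, mul_div_assoc]

theorem corner_succ_sub_div (δ : ℝ) (d : T.graph.Dart) :
    (T.corner δ (T.succ d) - T.z d.fst) / T.dir d =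
      T.par d (T.ret d) + δ * (T.bis (T.succ d) / T.dir d) := by
  have := T.dir_ne_zero d
  rw [corner, z_succ]; field_simp; ring

theorem sub_div_of_mem_side {δ t : ℝ} {d : T.graph.Dart} {y : ℂ}
    (hy : y = (1 - t) * T.corner δ d + t * T.corner δ (T.succ d)) :
    (y - T.z d.fst) / T.dir d = (1 - t) * (δ * (T.bis d / T.dir d)) +
      t * (T.par d (T.ret d) + δ * (T.bis (T.succ d) / T.dir d)) := by
  rw [← corner_sub_div, ← corner_succ_sub_div, hy]
  ring

theorem side_im_nonneg {δ : ℝ} (hδ : 0 ≤ δ) {d : T.graph.Dart} (hd : d ∈ T.kept) {y : ℂ}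
    (hy : y ∈ T.side δ d) : 0 ≤ ((y - T.z d.fst) / T.dir d).im := by
  obtain ⟨t, h0, h1, h⟩ := exists_of_mem_side hy
  rw [sub_div_of_mem_side h]
  have h2 := bis_im_nonneg d
  have h3 := (bis_succ_im hd).1
  have h4 : 0 ≤ 1 - t := by linarith
  simp
  positivity

/-- The height is a convex combination of two nonnegative heights, so both weighted terms must
vanish. The first alternative is the side from leaf to leaf, which lies on the line altogether. -/
theorem side_im_eq_zero {δ : ℝ} (hδ : 0 < δ) {d : T.graph.Dart} (hd : d ∈ T.kept) {y : ℂ}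
    (hy : y ∈ T.side δ d) (him : ((y - T.z d.fst) / T.dir d).im = 0) :
    (T.rot d = d ∧ T.rot (T.succ d) = T.succ d) ∨ (y = T.corner δ d ∧ T.rot d = d) ∨
      (y = T.corner δ (T.succ d) ∧ T.rot (T.succ d) = T.succ d) := by
  obtain ⟨t, h0, h1, h⟩ := exists_of_mem_side hy
  rw [sub_div_of_mem_side h] at him
  have h2 := bis_im_nonneg d
  have h3 := (bis_succ_im hd).1
  have h4 : 0 ≤ 1 - t := by linarith
  rw [← bis_im_eq_zero_iff, ← (bis_succ_im hd).2]
  simp at him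
  have h5 : (1 - t) * (δ * (T.bis d / T.dir d).im) = 0 := by
    have : 0 ≤ (1 - t) * (δ * (T.bis d / T.dir d).im) := by positivity
    have : 0 ≤ t * (δ * (T.bis (T.succ d) / T.dir d).im) := by positivity
    linarith
  have h6 : t * (δ * (T.bis (T.succ d) / T.dir d).im) = 0 := by linarith
  rw [mul_eq_zero, mul_eq_zero, or_iff_right hδ.ne'] at h5 h6
  rcases h5 with h5 | h5 <;> rcases h6 with h6 | h6
  · linarith
  · right; right
    refine ⟨?_, h6⟩
    have : t = 1 := by linarith
    subst this; simpa using h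
  · right; left
    subst h6
    refine ⟨by simpa using h, h5⟩
  · exact Or.inl ⟨h5, h6⟩

theorem half_ang_lt_pi {d : T.graph.Dart} (h : T.rot d ≠ d) : T.ang d / 2 < Real.pi := by
  have h1 : T.ang d ≠ 2 * Real.pi := fun h' => h ((T.rot_eq_self_iff d).2 h')
  have := lt_of_le_of_ne (ang_le_two_pi d) h1
  linarith

theorem turn_dir_bis (d : T.graph.Dart) : turn (T.dir d) (T.bis d) = T.ang d / 2 :=
  turn_bisector (T.dir_ne_zero d)

theorem turn_bis_dir_rot (d : T.graph.Dart) : turn (T.bis d) (T.dir (T.rot d)) = T.ang d / 2 :=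
  bisector_turn (T.dir_ne_zero d) (T.dir_ne_zero _)

/-- The start of a side of the polygon lies in the half of the first corner next to its stretch. -/
theorem eventually_side_start {d : T.graph.Dart} (hd : d ∈ T.kept) (hrot : T.rot d ≠ d) :
    ∀ᶠ δ in 𝓝[>] (0 : ℝ), ∀ y ∈ T.side δ d, y - T.z d.fst ≠ 0 ∧ (y ≠ T.corner δ d →
      turn (T.dir d) (y - T.z d.fst) < T.ang d / 2 ∨
        ∃ r : ℝ, 0 < r ∧ y - T.z d.fst = r * T.dir d) := by
  have hb0 : (T.bis d / T.dir d).im ≠ 0 := fun h => hrot ((bis_im_eq_zero_iff d).1 h)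
  have hb := lt_of_le_of_ne (bis_im_nonneg d) hb0.symm
  -- The offset of the far corner is `α` along the stretch and `β ≥ 0` along the bisector. A
  -- negative `α` is outweighed by the length of the stretch once δ is small.
  obtain ⟨α, hα⟩ := exists_comb (T.dir_ne_zero d) hb0 (T.bis (T.succ d))
  set β := (T.bis (T.succ d) / T.dir d).im / (T.bis d / T.dir d).im
  have hβ : 0 ≤ β := div_nonneg (bis_succ_im hd).1 hb.le
  have hturn : turn (T.dir d) (T.bis d) < Real.pi := by
    rw [turn_dir_bis]; exact half_ang_lt_pi hrot
  filter_upwards [eventually_pos, eventually_pos_add_mul (par_ret_pos hd) α] with δ hδ hδ' y hy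
  obtain ⟨t, h0, h1, h⟩ := exists_of_mem_side hy
  have hy' : y - T.z d.fst = ((t * (T.par d (T.ret d) + δ * α) : ℝ) : ℂ) * T.dir d +
      (((1 - t) * δ + t * (δ * β) : ℝ) : ℂ) * T.bis d := by
    rw [h, corner, corner, z_succ, hα]; push_cast; ring
  have hA : 0 ≤ t * (T.par d (T.ret d) + δ * α) := by positivity
  have hB : 0 ≤ (1 - t) * δ + t * (δ * β) := by
    have : 0 ≤ 1 - t := by linarith
    positivity
  rw [hy']
  -- The bisector part vanishes only at the far corner and only if that corner belongs to a leaf.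
  rcases hB.eq_or_lt with hB0 | hB
  · have ht : 0 < t := by
      rcases h0.eq_or_lt with rfl | h0
      · simp at hB0; linarith
      · exact h0
    have hA' : 0 < t * (T.par d (T.ret d) + δ * α) := by positivity
    rw [← hB0]
    refine ⟨?_, fun _ => Or.inr ⟨_, hA', by simp⟩⟩
    simp only [Complex.ofReal_zero, zero_mul, add_zero]
    exact mul_ne_zero (by exact_mod_cast hA'.ne') (T.dir_ne_zero d)
  · refine ⟨(turn_comb_le (T.dir_ne_zero d) (T.bis_ne_zero d) hturn hA hB).1, fun hne => Or.inl ?_⟩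
    rw [← turn_dir_bis]
    refine turn_comb_lt (T.dir_ne_zero d) (T.bis_ne_zero d) hturn ?_ hB
    have ht : 0 < t := by
      rcases h0.eq_or_lt with rfl | h0
      · exact absurd (by simpa using h) hne
      · exact h0
    positivity

/-- The end of a side of the polygon lies in the half of the last corner next to its stretch. -/
theorem eventually_side_end {d : T.graph.Dart} (hd : d ∈ T.kept)
    (hrot : T.rot (T.succ d) ≠ T.succ d) :
    ∀ᶠ δ in 𝓝[>] (0 : ℝ), ∀ y ∈ T.side δ d, y - T.z (T.succ d).fst ≠ 0 ∧
      (turn (y - T.z (T.succ d).fst) (T.dir (T.rot (T.succ d))) ≤ T.ang (T.succ d) / 2 ∨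
        ∃ r : ℝ, 0 < r ∧ y - T.z (T.succ d).fst = r * T.dir (T.rot (T.succ d))) := by
  obtain ⟨r, hr, hdir⟩ := exists_dir_rot_succ hd
  have hr' : (r : ℂ) ≠ 0 := by exact_mod_cast hr.ne'
  -- The reversed last dart flips the sign of every height, so the quotient of heights defining `β`
  -- stays nonnegative.
  have him : ∀ w : ℂ, (w / T.dir (T.rot (T.succ d))).im = -(w / T.dir d).im / r := by
    intro w
    have : w / T.dir (T.rot (T.succ d)) = ((-r⁻¹ : ℝ) : ℂ) * (w / T.dir d) := by
      have := T.dir_ne_zero d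
      rw [hdir]; push_cast; field_simp
    rw [this, Complex.im_ofReal_mul]; ring
  obtain ⟨hb', hb0⟩ := bis_succ_im hd
  have hbne : (T.bis (T.succ d) / T.dir d).im ≠ 0 := fun h => hrot (hb0.1 h)
  have hbpos := lt_of_le_of_ne hb' hbne.symm
  obtain ⟨α, hα⟩ := exists_comb (T.dir_ne_zero (T.rot (T.succ d))) (b := T.bis (T.succ d))
    (by rw [him]; exact div_ne_zero (neg_ne_zero.2 hbne) hr.ne') (T.bis d)
  have hβ : 0 ≤ (T.bis d / T.dir (T.rot (T.succ d))).im /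
      (T.bis (T.succ d) / T.dir (T.rot (T.succ d))).im := by
    rw [him, him, div_div_div_cancel_right₀ hr.ne', neg_div_neg_eq]
    exact div_nonneg (bis_im_nonneg d) hb'
  set β := (T.bis d / T.dir (T.rot (T.succ d))).im /
      (T.bis (T.succ d) / T.dir (T.rot (T.succ d))).im
  have hturn : turn (T.bis (T.succ d)) (T.dir (T.rot (T.succ d))) < Real.pi := by
    rw [turn_bis_dir_rot]; exact half_ang_lt_pi hrot
  filter_upwards [eventually_pos, eventually_pos_add_mul (div_pos (par_ret_pos hd) hr) α]
    with δ hδ hδ' y hy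
  obtain ⟨t, h0, h1, h⟩ := exists_of_mem_side hy
  have hy' : y - T.z (T.succ d).fst =
      ((t * δ + (1 - t) * (δ * β) : ℝ) : ℂ) * T.bis (T.succ d) +
      (((1 - t) * (T.par d (T.ret d) / r + δ * α) : ℝ) : ℂ) * T.dir (T.rot (T.succ d)) := by
    have h3 : (T.par d (T.ret d) : ℂ) * T.dir d =
        -((T.par d (T.ret d) / r : ℝ) : ℂ) * T.dir (T.rot (T.succ d)) := by
      rw [hdir]; push_cast; field_simp
    have h4 : T.z d.fst = T.z (T.succ d).fst + ((T.par d (T.ret d) / r : ℝ) : ℂ) *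
        T.dir (T.rot (T.succ d)) := by
      rw [z_succ, h3]; ring
    rw [h, corner, corner, h4, hα]; push_cast; ring
  have h1' : 0 ≤ 1 - t := by linarith
  have hA : 0 ≤ (1 - t) * (T.par d (T.ret d) / r + δ * α) := by positivity
  have hB : 0 ≤ t * δ + (1 - t) * (δ * β) := by positivity
  rw [hy']
  rcases hB.eq_or_lt with hB0 | hB
  · have ht : 0 < 1 - t := by
      rcases h1'.eq_or_lt with h1' | h1'
      · have : t = 1 := by linarith
        subst this; simp at hB0; linarith
      · exact h1'
    have hA' : 0 < (1 - t) * (T.par d (T.ret d) / r + δ * α) := by positivity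
    rw [← hB0]
    refine ⟨?_, Or.inr ⟨_, hA', by simp⟩⟩
    simp only [Complex.ofReal_zero, zero_mul, zero_add]
    exact mul_ne_zero (by exact_mod_cast hA'.ne') (T.dir_ne_zero _)
  · have := comb_turn_le (T.bis_ne_zero _) (T.dir_ne_zero _) hturn hB hA
    rw [turn_bis_dir_rot] at this
    exact ⟨this.1, Or.inl this.2⟩

variable (T) in
/-- `f` is one of the darts of the tree along which a stretch leaves its `j`-th vertex, in either
direction. -/
def own (d : T.graph.Dart) (j : ℕ) (f : T.graph.Dart) : Prop :=
  (j < T.ret d ∧ f = T.face^[j] d) ∨ (0 < j ∧ j ≤ T.ret d ∧ f = T.rot (T.face^[j] d))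

theorem own_fst {d : T.graph.Dart} {j : ℕ} {f : T.graph.Dart} (h : T.own d j f) :
    f.fst = (T.face^[j] d).fst := by
  rcases h with ⟨-, rfl⟩ | ⟨-, -, rfl⟩
  · rfl
  · exact T.rot_fst _

theorem exists_edge_of_own {d : T.graph.Dart} {j : ℕ} {f : T.graph.Dart} (h : T.own d j f) :
    ∃ i < T.ret d, (T.face^[i] d).edge = f.edge := by
  rcases h with ⟨h, rfl⟩ | ⟨h0, h1, rfl⟩
  · exact ⟨j, h, rfl⟩
  · obtain ⟨k, rfl⟩ := Nat.exists_eq_add_of_le h0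
    refine ⟨k, by omega, ?_⟩
    rw [show Nat.succ 0 + k = k + 1 by omega, rot_iterate]
    exact (SimpleGraph.Dart.edge_symm _).symm

theorem smul_mem_sector {d : T.graph.Dart} {y : ℂ} (hy : y ∈ T.sector d) {r : ℝ} (hr : 0 < r) :
    (r * y : ℂ) ∈ T.sector d :=
  ⟨mul_ne_zero (by exact_mod_cast hr.ne') hy.1, by rw [turn_smul_right hr]; exact hy.2⟩

theorem mem_sector_or_of_rot_eq_self {d : T.graph.Dart} (h : T.rot d = d) {y : ℂ} (hy : y ≠ 0) :
    y ∈ T.sector d ∨ ∃ r : ℝ, 0 < r ∧ y = r * T.dir d := by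
  by_cases h1 : turn (T.dir d) y = 2 * Real.pi
  · exact Or.inr ((turn_eq_two_pi_iff (T.dir_ne_zero d) hy).1 h1)
  · refine Or.inl ⟨hy, ?_⟩
    rw [(T.rot_eq_self_iff d).1 h]
    exact lt_of_le_of_ne (turn_le _ _) h1

/-- Seen from a vertex of its stretch, a side of the polygon lies in the corner at this vertex and
on the edges of the stretch at this vertex. -/
theorem eventually_side_mem_sector {d : T.graph.Dart} (hd : d ∈ T.kept) :
    ∀ᶠ δ in 𝓝[>] (0 : ℝ), ∀ j ≤ T.ret d, ∀ y ∈ T.side δ d,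
      y - T.z (T.face^[j] d).fst ≠ 0 → y - T.z (T.face^[j] d).fst ∈ T.sector (T.face^[j] d) ∨
      ∃ f, T.own d j f ∧ ∃ r : ℝ, 0 < r ∧ y - T.z (T.face^[j] d).fst = r * T.dir f := by
  have hstart : ∀ᶠ δ in 𝓝[>] (0 : ℝ), ∀ y ∈ T.side δ d, y - T.z d.fst ≠ 0 →
      y - T.z d.fst ∈ T.sector d ∨ ∃ r : ℝ, 0 < r ∧ y - T.z d.fst = r * T.dir d := by
    by_cases hrot : T.rot d = d
    · exact Eventually.of_forall fun δ y _ hne => mem_sector_or_of_rot_eq_self hrot hne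
    · filter_upwards [eventually_pos, eventually_side_start hd hrot] with δ hδ h y hy hne
      by_cases hc : y = T.corner δ d
      · left
        rw [hc, corner, add_sub_cancel_left]
        exact smul_mem_sector (T.bis_mem_sector d) hδ
      · rcases (h y hy).2 hc with h1 | h1
        · exact Or.inl ⟨hne, h1.trans (half_lt_self (T.ang_pos d))⟩
        · exact Or.inr h1
  have hend : ∀ᶠ δ in 𝓝[>] (0 : ℝ), ∀ y ∈ T.side δ d, y - T.z (T.succ d).fst ≠ 0 →
      y - T.z (T.succ d).fst ∈ T.sector (T.succ d) ∨
      ∃ r : ℝ, 0 < r ∧ y - T.z (T.succ d).fst = r * T.dir (T.rot (T.succ d)) := by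
    by_cases hrot : T.rot (T.succ d) = T.succ d
    · refine Eventually.of_forall fun δ y _ hne => ?_
      rw [hrot]
      exact mem_sector_or_of_rot_eq_self hrot hne
    · filter_upwards [eventually_pos, eventually_side_end hd hrot] with δ hδ h y hy hne
      rcases (h y hy).2 with h1 | h1
      · refine Or.inl ⟨hne, ?_⟩
        have h2 := turn_pos (y - T.z (T.succ d).fst) (T.dir (T.rot (T.succ d)))
        have h3 := turn_le (T.dir (T.succ d)) (y - T.z (T.succ d).fst)
        have h4 := T.ang_pos (T.succ d)
        rcases turn_add (T.dir_ne_zero (T.succ d)) hne (T.dir_ne_zero (T.rot (T.succ d)))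
          with h5 | h5 <;> rw [← ang] at h5 <;> linarith
      · exact Or.inr h1
  filter_upwards [eventually_pos, hstart, hend] with δ hδ h1 h2 j hj y hy hne
  rcases Nat.eq_zero_or_pos j with rfl | hj0
  · rcases h1 y hy hne with h | h
    · exact Or.inl h
    · exact Or.inr ⟨d, Or.inl ⟨(ret_spec hd).1, rfl⟩, h⟩
  rcases hj.eq_or_lt with rfl | hlt
  · rcases h2 y hy hne with h | h
    · exact Or.inl h
    · exact Or.inr ⟨T.rot (T.succ d), Or.inr ⟨hj0, le_rfl, rfl⟩, h⟩
  -- At an inner vertex of the stretch the corner is straight: its sector is the open left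
  -- half-plane, and points of height 0 lie along the two darts of the stretch.
  have hang := ang_iterate hj0 hlt
  have hzj := (z_iterate d hj).1
  obtain ⟨r, hr, hdir⟩ := exists_dir_iterate d hlt
  obtain ⟨s, hs, hrot⟩ := exists_dir_rot hang
  have hr' : (r : ℂ) ≠ 0 := by exact_mod_cast hr.ne'
  set c := T.face^[j] d
  have him := side_im_nonneg hδ.le hd hy
  have hdiv : (y - T.z c.fst) / T.dir c = ((r⁻¹ : ℝ) : ℂ) * ((y - T.z d.fst) / T.dir d - T.par d j)
      := by
    have := T.dir_ne_zero d
    rw [hdir, hzj]; push_cast; field_simp; ring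
  have him' : 0 ≤ ((y - T.z c.fst) / T.dir c).im := by
    rw [hdiv, Complex.im_ofReal_mul]
    simp only [Complex.sub_im, Complex.ofReal_im, sub_zero]
    positivity
  rcases him'.eq_or_lt with h0 | hpos
  · have hre : y - T.z c.fst = (((y - T.z c.fst) / T.dir c).re : ℂ) * T.dir c := by
      rw [eq_comm, ← eq_div_iff (T.dir_ne_zero c)]
      exact Complex.ext (by simp) (by simpa using h0)
    rcases lt_trichotomy ((y - T.z c.fst) / T.dir c).re 0 with h3 | h3 | h3
    · refine Or.inr ⟨T.rot c, Or.inr ⟨hj0, hj, rfl⟩, s⁻¹ * -((y - T.z c.fst) / T.dir c).re,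
        mul_pos (inv_pos.2 hs) (by linarith), ?_⟩
      have hs' : (s : ℂ) ≠ 0 := by exact_mod_cast hs.ne'
      rw [hrot]
      conv_lhs => rw [hre]
      push_cast; field_simp
    · rw [h3] at hre; simp at hre; exact absurd hre hne
    · exact Or.inr ⟨c, Or.inl ⟨hlt, rfl⟩, _, h3, hre⟩
  · exact Or.inl ⟨hne, by rw [hang]; exact turn_lt_pi_iff.2 hpos⟩

end PlaneTree

/-! ### Two sides meet only in common corners. -/

namespace PlaneTree

variable {V : Type*} {T : PlaneTree V} [Finite V]

theorem eventually_corner_ne {d e : T.graph.Dart} (h : d ≠ e) :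
    ∀ᶠ δ in 𝓝[>] (0 : ℝ), T.corner δ d ≠ T.corner δ e := by
  by_cases hf : d.fst = e.fst
  · filter_upwards [eventually_pos] with δ hδ hc
    rw [corner, corner, hf, add_right_inj] at hc
    have h1 : T.bis d = T.bis e := mul_left_cancel₀ (by exact_mod_cast hδ.ne') hc
    exact Set.disjoint_left.1 (T.disjoint_sector hf h) (T.bis_mem_sector d)
      (h1 ▸ T.bis_mem_sector e)
  · have ht : ∀ f : T.graph.Dart, Tendsto (fun δ : ℝ => T.corner δ f) (𝓝[>] 0) (𝓝 (T.z f.fst)) := by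
      intro f
      have h1 : Continuous fun δ : ℝ => T.corner δ f := by unfold corner; fun_prop
      have h2 := h1.tendsto 0
      simp only [corner, Complex.ofReal_zero, zero_mul, add_zero] at h2
      exact h2.mono_left nhdsWithin_le_nhds
    have h1 := ((ht d).sub (ht e)).eventually_ne (sub_ne_zero.2 fun h' => hf (T.z_injective h'))
    exact h1.mono fun δ h => sub_ne_zero.1 h

variable (T) in
/-- The stretches of two darts have a common edge of the tree. -/
def Shares (d e : T.graph.Dart) : Prop :=
  ∃ j < T.ret d, ∃ i < T.ret e, (T.face^[i] e).edge = (T.face^[j] d).edge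

theorem Shares.symm {d e : T.graph.Dart} (h : T.Shares d e) : T.Shares e d := by
  obtain ⟨j, hj, i, hi, h⟩ := h
  exact ⟨i, hi, j, hj, h.symm⟩

/-- Traversed in the same direction, the common edge would be one dart on two stretches. -/
theorem Shares.exists_symm {d e : T.graph.Dart} (hd : d ∈ T.kept) (he : e ∈ T.kept) (hne : d ≠ e)
    (h : T.Shares d e) :
    ∃ j < T.ret d, ∃ i < T.ret e, T.face^[i] e = (T.face^[j] d).symm := by
  obtain ⟨j, hj, i, hi, h⟩ := h
  rcases (SimpleGraph.dart_edge_eq_iff _ _).1 h with h | h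
  · exact absurd (iterate_eq_of_lt_returnTime T.face.injective he hd hi hj h) hne.symm
  · exact ⟨j, hj, i, hi, h⟩

theorem own_shares {d e : T.graph.Dart} {j i : ℕ} {f : T.graph.Dart} (h1 : T.own d j f)
    (h2 : T.own e i f) : T.Shares d e := by
  obtain ⟨k, hk, hk'⟩ := exists_edge_of_own h1
  obtain ⟨l, hl, hl'⟩ := exists_edge_of_own h2
  exact ⟨k, hk, l, hl, hl'.trans hk'.symm⟩

theorem exists_own {d : T.graph.Dart} (hd : d ∈ T.kept) {j : ℕ} (hj : j ≤ T.ret d) :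
    ∃ f, T.own d j f := by
  rcases hj.eq_or_lt with rfl | h
  · exact ⟨_, Or.inr ⟨(ret_spec hd).1, le_rfl, rfl⟩⟩
  · exact ⟨_, Or.inl ⟨h, rfl⟩⟩

/-- A stretch that starts at a leaf is followed backwards up to the leaf by a stretch on the
opposite side, provided that this ends at a leaf as well. -/
theorem succ_eq_of_leaf {d e : T.graph.Dart} (hleaf : T.rot d = d)
    (hleaf' : T.rot (T.succ e) = T.succ e) {j i : ℕ} (hj : j < T.ret d) (hi : i < T.ret e)
    (h : T.face^[i] e = (T.face^[j] d).symm) : T.succ e = d := by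
  have hrotc : T.rot (T.face^[i + 1] e) = T.face^[j] d := by
    rw [rot_iterate, h, SimpleGraph.Dart.symm_symm]
  have hfst : (T.face^[i + 1] e).fst = (T.face^[j] d).fst := by
    rw [← hrotc, T.rot_fst]
  induction j generalizing i with
  | zero =>
    have h1 : T.face^[i + 1] e = d := T.eq_of_fst_eq_of_rot_eq_self hleaf hfst
    rcases Nat.lt_or_ge (i + 1) (T.ret e) with hlt | hge
    · have h2 := ang_iterate (by omega) hlt
      rw [h1, (T.rot_eq_self_iff d).1 hleaf] at h2
      linarith [Real.pi_pos]
    · rw [succ, show T.ret e = i + 1 by omega, h1]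
  | succ j ih =>
    have hd1 := ang_iterate (by omega) hj
    rcases Nat.lt_or_ge (i + 1) (T.ret e) with hlt | hge
    -- Both stretches pass straight through this vertex, so `e` continues along the reversal of the
    -- preceding edge of `d`.
    · have h2 := ang_iterate (by omega) hlt
      obtain ⟨r, hr, h3⟩ := exists_dir_rot h2
      obtain ⟨s, hs, h4⟩ := exists_dir_rot hd1
      rw [hrotc] at h3
      rw [h3] at h4
      have h5 : T.face^[i + 1] e = T.rot (T.face^[j + 1] d) :=
        T.eq_of_dir_eq_smul (hfst.trans (T.rot_fst _).symm) (mul_pos hs hr)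
          (by rw [h4]; push_cast; ring)
      rw [rot_iterate] at h5
      have h6 : T.rot (T.face^[i + 1 + 1] e) = T.face^[j] d := by
        rw [rot_iterate, h5, SimpleGraph.Dart.symm_symm]
      exact ih (by omega) hlt h5 h6 (by rw [← h6, T.rot_fst])
    -- Here `e` would end at a leaf, at a vertex through which `d` runs straight: the one corner
    -- there would have angle both 2π and π.
    · have hs : T.succ e = T.face^[i + 1] e := by rw [succ, show T.ret e = i + 1 by omega]
      rw [hs] at hleaf'
      have h1 : T.face^[i + 1] e = T.face^[j + 1] d := by rw [← hrotc, hleaf']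
      have h2 : T.ang (T.face^[j + 1] d) = 2 * Real.pi := by
        rw [← h1]; exact (T.rot_eq_self_iff _).1 hleaf'
      rw [hd1] at h2
      linarith [Real.pi_pos]

/-- The stretches run along one line in opposite directions, so heights over them have opposite
signs. A common point of the two sides must have height 0. -/
theorem Shares.exists_im_eq {d e : T.graph.Dart} (hd : d ∈ T.kept) (he : e ∈ T.kept) (hne : d ≠ e)
    (h : T.Shares d e) : ∃ k : ℝ, 0 < k ∧ ∀ y : ℂ,
      ((y - T.z e.fst) / T.dir e).im = -(k * ((y - T.z d.fst) / T.dir d).im) := by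
  obtain ⟨j, hj, i, hi, h⟩ := h.exists_symm hd he hne
  obtain ⟨r, hr, h1⟩ := exists_dir_iterate d hj
  obtain ⟨s, hs, h2⟩ := exists_dir_iterate e hi
  have hs' : (s : ℂ) ≠ 0 := by exact_mod_cast hs.ne'
  have hde := T.dir_ne_zero d
  rw [h, dir_symm, h1] at h2
  have h3 : T.dir e = ((-(s⁻¹ * r) : ℝ) : ℂ) * T.dir d := by
    push_cast; field_simp; linear_combination -h2
  have h4 := (z_iterate d hj.le).1
  have h5 := (z_iterate e (Nat.succ_le_of_lt hi)).1
  rw [Nat.succ_eq_add_one, iterate_fst, h] at h5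
  have h6 : T.z e.fst = T.z d.fst + ((T.par d j + T.par e (i + 1) * (s⁻¹ * r) : ℝ) : ℂ) * T.dir d
      := by
    have : T.z (T.face^[j] d).symm.snd = T.z (T.face^[j] d).fst := rfl
    rw [this, h4, h3] at h5
    push_cast at h5 ⊢
    linear_combination -h5
  have hk : (-(s⁻¹ * r) : ℝ) < 0 := by
    have : 0 < s⁻¹ * r := by positivity
    linarith
  refine ⟨-(-(s⁻¹ * r))⁻¹, neg_pos.2 (inv_lt_zero.2 hk), fun y => ?_⟩
  have h7 : (y - T.z e.fst) / T.dir e = ((-(s⁻¹ * r))⁻¹ : ℝ) * ((y - T.z d.fst) / T.dir d -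
      (T.par d j + T.par e (i + 1) * (s⁻¹ * r) : ℝ)) := by
    rw [h3, h6]
    have : (((-(s⁻¹ * r) : ℝ) : ℂ)) ≠ 0 := by exact_mod_cast hk.ne
    rw [Complex.ofReal_inv]
    generalize ((-(s⁻¹ * r) : ℝ) : ℂ) = k at this ⊢
    field_simp
    ring
  rw [h7, Complex.im_ofReal_mul]
  simp only [Complex.sub_im, Complex.ofReal_im, sub_zero]
  ring

theorem Shares.im_eq_zero {d e : T.graph.Dart} (hd : d ∈ T.kept) (he : e ∈ T.kept) (hne : d ≠ e)
    (h : T.Shares d e) {δ : ℝ} (hδ : 0 ≤ δ) {y : ℂ} (hy : y ∈ T.side δ d)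
    (hy' : 0 ≤ ((y - T.z e.fst) / T.dir e).im) : ((y - T.z d.fst) / T.dir d).im = 0 := by
  obtain ⟨k, hk, h1⟩ := h.exists_im_eq hd he hne
  rw [h1] at hy'
  have h2 := side_im_nonneg hδ hd hy
  nlinarith

/-- Two sides of the polygon on opposite sides of the same stretch of the tree. -/
theorem eventually_sides_inter_of_shares {d e : T.graph.Dart} (hd : d ∈ T.kept) (he : e ∈ T.kept)
    (hne : d ≠ e) (h : T.Shares d e) (h3 : T.succ (T.succ d) ≠ d) :
    ∀ᶠ δ in 𝓝[>] (0 : ℝ), ∀ y ∈ T.side δ d, y ∈ T.side δ e →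
      ∃ x, (x = d ∨ x = T.succ d) ∧ (x = e ∨ x = T.succ e) ∧ y = T.corner δ x := by
  have hinj : ∀ᶠ δ in 𝓝[>] (0 : ℝ), ∀ x x' : T.graph.Dart, T.corner δ x = T.corner δ x' → x = x' :=
      by
    rw [eventually_all]; intro x
    rw [eventually_all]; intro x'
    by_cases hx : x = x'
    · exact Eventually.of_forall fun _ _ => hx
    · filter_upwards [eventually_corner_ne hx] with δ h1 h2 using absurd h2 h1
  obtain ⟨j, hj, i, hi, hji⟩ := h.exists_symm hd he hne
  have hij : T.face^[j] d = (T.face^[i] e).symm := by rw [hji, SimpleGraph.Dart.symm_symm]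
  filter_upwards [eventually_pos, hinj] with δ hδ hinj y hyd hye
  have himd := h.im_eq_zero hd he hne hδ.le hyd (side_im_nonneg hδ.le he hye)
  have hime := h.symm.im_eq_zero he hd hne.symm hδ.le hye (side_im_nonneg hδ.le hd hyd)
  have hsd := side_im_eq_zero hδ hd hyd himd
  have hse := side_im_eq_zero hδ he hye hime
  rcases hsd with ⟨a1, a2⟩ | hsd
  · rcases hse with ⟨b1, b2⟩ | ⟨rfl, b1⟩ | ⟨rfl, b2⟩
    -- Two leaf-to-leaf sides along one stretch succeed each other, and the cycle of corners closes
    -- up after two steps.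
    · have c1 := succ_eq_of_leaf a1 b2 hj hi hji
      have c2 := succ_eq_of_leaf b1 a2 hi hj hij
      exact absurd (by rw [c2, c1]) h3
    · exact ⟨e, Or.inr (succ_eq_of_leaf b1 a2 hi hj hij).symm, Or.inl rfl, rfl⟩
    · exact ⟨T.succ e, Or.inl (succ_eq_of_leaf a1 b2 hj hi hji), Or.inr rfl, rfl⟩
  · rcases hse with ⟨b1, b2⟩ | hse
    · rcases hsd with ⟨rfl, a1⟩ | ⟨rfl, a2⟩
      · exact ⟨d, Or.inl rfl, Or.inr (succ_eq_of_leaf a1 b2 hj hi hji).symm, rfl⟩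
      · exact ⟨T.succ d, Or.inr rfl, Or.inl (succ_eq_of_leaf b1 a2 hi hj hij), rfl⟩
    · rcases hsd with ⟨hyd, -⟩ | ⟨hyd, -⟩ <;> rcases hse with ⟨hye, -⟩ | ⟨hye, -⟩
      · exact ⟨d, Or.inl rfl, Or.inl (hinj _ _ (hyd.symm.trans hye)), hyd⟩
      · exact ⟨d, Or.inl rfl, Or.inr (hinj _ _ (hyd.symm.trans hye)), hyd⟩
      · exact ⟨_, Or.inr rfl, Or.inl (hinj _ _ (hyd.symm.trans hye)), hyd⟩
      · exact ⟨_, Or.inr rfl, Or.inr (hinj _ _ (hyd.symm.trans hye)), hyd⟩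

/-- Consecutive sides of the polygon meet only in their common corner. -/
theorem eventually_sides_inter_of_succ {d : T.graph.Dart} (hd : d ∈ T.kept)
    (hrot : T.rot (T.succ d) ≠ T.succ d) :
    ∀ᶠ δ in 𝓝[>] (0 : ℝ), ∀ y ∈ T.side δ d, y ∈ T.side δ (T.succ d) →
      y = T.corner δ (T.succ d) := by
  filter_upwards [eventually_side_end hd hrot, eventually_side_start (ret_spec hd).2 hrot]
    with δ h1 h2 y hy1 hy2
  by_contra hne
  obtain ⟨h0, h1⟩ := h1 y hy1
  have h2 := (h2 y hy2).2 hne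
  have hd1 := T.dir_ne_zero (T.succ d)
  have hd2 := T.dir_ne_zero (T.rot (T.succ d))
  have hang := T.ang_pos (T.succ d)
  -- The bisector divides the corner: the arriving side stays in the closed half next to `T.rot
  -- (T.succ d)`, the departing one, off the corner point, in the open half next to `T.succ d`. The
  -- arms themselves are distinct.
  rcases h1 with h1 | ⟨r, hr, h1⟩ <;> rcases h2 with h2 | ⟨s, hs, h2⟩
  · rcases turn_add hd1 h0 hd2 with h | h <;> rw [← ang] at h <;> linarith [Real.pi_pos]
  · rw [h2, turn_smul_left hs, ← ang] at h1; linarith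
  · rw [h1, turn_smul_right hr, ← ang] at h2; linarith
  · rw [h1] at h2
    have hs' : (s : ℂ) ≠ 0 := by exact_mod_cast hs.ne'
    have hr' : (r : ℂ) ≠ 0 := by exact_mod_cast hr.ne'
    refine hrot (T.eq_of_dir_eq_smul (d := T.succ d) (e := T.rot (T.succ d)) (T.rot_fst _).symm
      (r := r⁻¹ * s) (by positivity) ?_).symm
    push_cast; field_simp; linear_combination h2

theorem vertex_notMem_side_of_end {d : T.graph.Dart} (hd : d ∈ T.kept) {j : ℕ}
    (hj : j = 0 ∨ j = T.ret d) (hrot : T.rot (T.face^[j] d) ≠ T.face^[j] d) :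
    ∀ᶠ δ in 𝓝[>] (0 : ℝ), T.z (T.face^[j] d).fst ∉ T.side δ d := by
  rcases hj with rfl | rfl
  · filter_upwards [eventually_side_start hd hrot] with δ h hy
    exact (h _ hy).1 (sub_self _)
  · filter_upwards [eventually_side_end hd hrot] with δ h hy
    exact (h _ hy).1 (sub_self _)

/-- Two sides of the polygon along stretches that have a common vertex but no common edge. -/
theorem eventually_sides_inter_of_vertex {d e : T.graph.Dart} (hd : d ∈ T.kept) (he : e ∈ T.kept)
    (hne : d ≠ e) (h : ¬ T.Shares d e) {j i : ℕ} (hj : j ≤ T.ret d) (hi : i ≤ T.ret e)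
    (hji : (T.face^[j] d).fst = (T.face^[i] e).fst) :
    ∀ᶠ δ in 𝓝[>] (0 : ℝ), ∀ y ∈ T.side δ d, y ∈ T.side δ e →
      ∃ x, (x = d ∨ x = T.succ d) ∧ (x = e ∨ x = T.succ e) ∧ y = T.corner δ x := by
  -- A leaf has a single edge, which both stretches would have to use.
  have hownrot : T.rot (T.face^[j] d) ≠ T.face^[j] d := by
    intro hrot
    obtain ⟨f, hf⟩ := exists_own hd hj
    obtain ⟨g, hg⟩ := exists_own he hi
    have h1 := T.eq_of_fst_eq_of_rot_eq_self hrot (own_fst hf)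
    have h2 := T.eq_of_fst_eq_of_rot_eq_self hrot ((own_fst hg).trans hji.symm)
    exact h (own_shares hf (h1 ▸ h2 ▸ hg))
  have hownrot' : T.rot (T.face^[i] e) ≠ T.face^[i] e := by
    intro hrot
    obtain ⟨f, hf⟩ := exists_own hd hj
    obtain ⟨g, hg⟩ := exists_own he hi
    have h1 := T.eq_of_fst_eq_of_rot_eq_self hrot (own_fst hg)
    have h2 := T.eq_of_fst_eq_of_rot_eq_self hrot ((own_fst hf).trans hji)
    exact h (own_shares hf (h2 ▸ h1 ▸ hg))
  -- In one and the same corner at the common vertex, both stretches start, both end, or one takes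
  -- over from the other; the first two cases give a common edge.
  by_cases hc : T.face^[j] d = T.face^[i] e
  · rcases hj.eq_or_lt with rfl | hj'
    · rcases hi.eq_or_lt with rfl | hi'
      · exact absurd (own_shares (Or.inr ⟨(ret_spec hd).1, le_rfl, rfl⟩)
          (Or.inr ⟨(ret_spec he).1, le_rfl, by rw [hc]⟩)) h
      · have hi0 : i = 0 := by
          by_contra h0
          have := ang_iterate (Nat.one_le_iff_ne_zero.2 h0) hi'
          rw [← hc] at this
          exact (ret_spec hd).2 this
        subst hi0
        have he' : T.succ d = e := hc
        subst he'
        filter_upwards [eventually_sides_inter_of_succ hd hownrot] with δ h1 y hy hy'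
        exact ⟨_, Or.inr rfl, Or.inl rfl, h1 y hy hy'⟩
    · rcases hi.eq_or_lt with rfl | hi'
      · have hj0 : j = 0 := by
          by_contra h0
          have := ang_iterate (Nat.one_le_iff_ne_zero.2 h0) hj'
          rw [hc] at this
          exact (ret_spec he).2 this
        subst hj0
        have he' : T.succ e = d := hc.symm
        subst he'
        filter_upwards [eventually_sides_inter_of_succ he hownrot'] with δ h1 y hy hy'
        exact ⟨_, Or.inl rfl, Or.inr rfl, h1 y hy' hy⟩
      · exact absurd (own_shares (Or.inl ⟨hj', rfl⟩) (Or.inl ⟨hi', hc⟩)) h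
  -- For different corners the sectors are disjoint, so only the vertex itself could be common. It
  -- avoids a side whose stretch ends there; if both stretches pass straight through, two disjoint
  -- angles π fill the full turn and the stretches share an edge.
  · have hz : ∀ᶠ δ in 𝓝[>] (0 : ℝ), T.z (T.face^[j] d).fst ∉ T.side δ d ∨
        T.z (T.face^[j] d).fst ∉ T.side δ e := by
      by_cases hj0 : j = 0 ∨ j = T.ret d
      · filter_upwards [vertex_notMem_side_of_end hd hj0 hownrot] with δ h1 using Or.inl h1
      by_cases hi0 : i = 0 ∨ i = T.ret e
      · filter_upwards [vertex_notMem_side_of_end he hi0 hownrot'] with δ h1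
        rw [hji]; exact Or.inr h1
      exfalso
      rw [not_or] at hj0 hi0
      have a1 := ang_iterate (Nat.one_le_iff_ne_zero.2 hj0.1) (lt_of_le_of_ne hj hj0.2)
      have a2 := ang_iterate (Nat.one_le_iff_ne_zero.2 hi0.1) (lt_of_le_of_ne hi hi0.2)
      have b1 := T.ang_le hji.symm
      have b2 := T.ang_le hji
      have b3 := T.turn_dir_lt hji hc
      have b4 : turn (T.dir (T.face^[j] d)) (T.dir (T.face^[i] e)) = Real.pi := by
        rcases T.turn_dir_add (T.face^[j] d) (T.face^[i] e) (T.face^[j] d) with h5 | h5 <;>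
        rw [turn_dir_self] at h5 <;>
        linarith [turn_le (T.dir (T.face^[i] e)) (T.dir (T.face^[j] d))]
      obtain ⟨r, hr, h5⟩ := (turn_eq_pi_iff (T.dir_ne_zero _) (T.dir_ne_zero _)).1 b4
      obtain ⟨s, hs, h6⟩ := exists_dir_rot a1
      have hr' : (r : ℂ) ≠ 0 := by exact_mod_cast hr.ne'
      have h7 : T.face^[i] e = T.rot (T.face^[j] d) :=
        T.eq_of_dir_eq_smul (hji.symm.trans (T.rot_fst _).symm) (r := s * r⁻¹) (by positivity)
          (by rw [h6, h5]; push_cast; field_simp)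
      exact h (own_shares (Or.inr ⟨Nat.pos_of_ne_zero hj0.1, hj, rfl⟩)
        (Or.inl ⟨lt_of_le_of_ne hi hi0.2, h7.symm⟩))
    filter_upwards [eventually_side_mem_sector hd, eventually_side_mem_sector he, hz]
      with δ h1 h2 hz y hy hy'
    exfalso
    have hne0 : y - T.z (T.face^[j] d).fst ≠ 0 := by
      intro h0
      rw [← sub_eq_zero.1 h0] at hz
      exact hz.elim (fun h => h hy) (fun h => h hy')
    have k1 := h1 j hj y hy hne0
    have k2 := h2 i hi y hy' (by rw [← hji]; exact hne0)
    rw [← hji] at k2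
    rcases k1 with k1 | ⟨f, hf, r, hr, k1⟩ <;> rcases k2 with k2 | ⟨g, hg, s, hs, k2⟩
    · exact Set.disjoint_left.1 (T.disjoint_sector hji hc) k1 k2
    · rw [k2] at k1
      exact T.dir_notMem_sector ((own_fst hg).trans hji.symm) hs k1
    · rw [k1] at k2
      exact T.dir_notMem_sector ((own_fst hf).trans hji) hr k2
    · rw [k1] at k2
      have hs' : (s : ℂ) ≠ 0 := by exact_mod_cast hs.ne'
      have h7 : f = g := T.eq_of_dir_eq_smul ((own_fst hf).trans (hji.trans (own_fst hg).symm))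
        (r := s⁻¹ * r) (by positivity) (by push_cast; field_simp; linear_combination -k2)
      exact h (own_shares hf (h7 ▸ hg))

/-- The sides of the polygon are close to their stretches. -/
theorem eventually_side_subset {d : T.graph.Dart} (hd : d ∈ T.kept) {η : ℝ} (hη : 0 < η) :
    ∀ᶠ δ in 𝓝[>] (0 : ℝ), T.side δ d ⊆ Metric.thickening η (T.stretch d) := by
  have h1 : ∀ᶠ δ in 𝓝[>] (0 : ℝ), 0 < η + δ * -(‖T.bis d‖ + ‖T.bis (T.succ d)‖) :=
    eventually_pos_add_mul hη _
  filter_upwards [eventually_pos, h1] with δ hδ h1 y hy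
  obtain ⟨t, h0, h2, h⟩ := exists_of_mem_side hy
  refine Metric.mem_thickening_iff.2 ⟨T.z d.fst + ((t * T.par d (T.ret d) : ℝ) : ℂ) * T.dir d,
    mem_stretch d (mul_nonneg h0 (par_ret_pos hd).le) ?_ (ret_spec hd).1, ?_⟩
  · exact mul_le_of_le_one_left (par_ret_pos hd).le h2
  · have h3 : y - (T.z d.fst + ((t * T.par d (T.ret d) : ℝ) : ℂ) * T.dir d) =
        (((1 - t) * δ : ℝ) : ℂ) * T.bis d + ((t * δ : ℝ) : ℂ) * T.bis (T.succ d) := by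
      rw [h, corner, corner, z_succ]; push_cast; ring
    rw [dist_eq_norm, h3]
    refine (norm_add_le _ _).trans_lt ?_
    have h4 : 0 ≤ 1 - t := by linarith
    rw [norm_mul, norm_mul, Complex.norm_real, Complex.norm_real, Real.norm_of_nonneg (by
        positivity),
      Real.norm_of_nonneg (by positivity)]
    have h5 : (1 - t) * δ * ‖T.bis d‖ ≤ δ * ‖T.bis d‖ :=
      mul_le_mul_of_nonneg_right (by nlinarith) (norm_nonneg _)
    have h6 : t * δ * ‖T.bis (T.succ d)‖ ≤ δ * ‖T.bis (T.succ d)‖ :=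
      mul_le_mul_of_nonneg_right (by nlinarith) (norm_nonneg _)
    linarith

theorem eventually_disjoint_side {d : T.graph.Dart} (hd : d ∈ T.kept) {K : Set ℂ}
    (hK : IsCompact K) (h : Disjoint (T.stretch d) K) :
    ∀ᶠ δ in 𝓝[>] (0 : ℝ), Disjoint (T.side δ d) K := by
  obtain ⟨η, hη, h1⟩ := h.exists_thickenings (isCompact_stretch d) hK.isClosed
  filter_upwards [eventually_side_subset hd hη] with δ h2
  exact h1.mono h2 (Metric.self_subset_thickening hη _)

theorem exists_iterate_of_mem {d : T.graph.Dart} {i : ℕ} (hi : i < T.ret d) {v : V}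
    (hv : v ∈ ({(T.face^[i] d).fst, (T.face^[i] d).snd} : Set V)) :
    ∃ j ≤ T.ret d, (T.face^[j] d).fst = v := by
  rcases hv with rfl | hv
  · exact ⟨i, hi.le, rfl⟩
  · exact ⟨i + 1, hi, by rw [iterate_fst]; exact hv.symm⟩

/-- Two sides of the polygon meet at most in common corners. -/
theorem eventually_sides_inter {d e : T.graph.Dart} (hd : d ∈ T.kept) (he : e ∈ T.kept)
    (hne : d ≠ e) (h3 : T.succ (T.succ d) ≠ d) :
    ∀ᶠ δ in 𝓝[>] (0 : ℝ), ∀ y ∈ T.side δ d, y ∈ T.side δ e →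
      ∃ x, (x = d ∨ x = T.succ d) ∧ (x = e ∨ x = T.succ e) ∧ y = T.corner δ x := by
  by_cases hs : T.Shares d e
  · exact eventually_sides_inter_of_shares hd he hne hs h3
  by_cases hv : ∃ j ≤ T.ret d, ∃ i ≤ T.ret e, (T.face^[j] d).fst = (T.face^[i] e).fst
  · obtain ⟨j, hj, i, hi, hji⟩ := hv
    exact eventually_sides_inter_of_vertex hd he hne hs hj hi hji
  have hdis : Disjoint (T.stretch e) (T.stretch d) := by
    rw [Set.disjoint_left]
    intro y hy hy'
    obtain ⟨i, hi, hyi⟩ := Set.mem_iUnion₂.1 hy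
    obtain ⟨j, hj, hyj⟩ := Set.mem_iUnion₂.1 hy'
    obtain ⟨v, ⟨hv1, hv2⟩, -⟩ := T.inter_segment_subset (fun h => hs ⟨j, hj, i, hi, h⟩) ⟨hyi, hyj⟩
    obtain ⟨i', hi', h1⟩ := exists_iterate_of_mem hi hv1
    obtain ⟨j', hj', h2⟩ := exists_iterate_of_mem hj hv2
    exact hv ⟨j', hj', i', hi', h2.trans h1.symm⟩
  obtain ⟨η, hη, h1⟩ := hdis.exists_thickenings (isCompact_stretch e) (isCompact_stretch d).isClosed
  filter_upwards [eventually_side_subset hd hη, eventually_side_subset he hη] with δ h2 h3 y hy hy'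
  exact absurd (h2 hy) (Set.disjoint_left.1 h1 (h3 hy'))

end PlaneTree

/-! ### Genuine corners, and the sides against the edges of the tree. -/

theorem turn_of_im_eq_zero {a b : ℂ} (ha : a ≠ 0) (hb : b ≠ 0) (h : (b / a).im = 0) :
    turn a b = Real.pi ∨ turn a b = 2 * Real.pi := by
  have h1 : b = ((b / a).re : ℂ) * a := by
    rw [eq_comm, ← eq_div_iff ha]
    exact Complex.ext (by simp) (by simpa using h.symm)
  rcases lt_trichotomy (b / a).re 0 with h2 | h2 | h2
  · left
    refine (turn_eq_pi_iff ha hb).2 ⟨-(b / a).re, by linarith, ?_⟩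
    push_cast; rw [neg_mul, neg_neg]; exact h1
  · rw [h2] at h1; simp at h1; exact absurd h1 hb
  · exact Or.inr ((turn_eq_two_pi_iff ha hb).2 ⟨_, h2, h1⟩)

theorem im_div_eq (N M : ℂ) : (N / M).im = (N.im * M.re - N.re * M.im) / Complex.normSq M := by
  rw [Complex.div_im, sub_div]

theorem div_mem_slitPlane_of_re_pos {A B : ℂ} (hA : 0 < A.re) (hB : 0 < B.re) :
    A / B ∈ Complex.slitPlane := by
  have hB0 : B ≠ 0 := fun h => by simp [h] at hB
  rw [Complex.mem_slitPlane_iff]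
  by_contra! h
  have h1 : A = ((A / B).re : ℂ) * B := by
    rw [eq_comm, ← eq_div_iff hB0]
    exact Complex.ext (by simp) (by simpa using h.2.symm)
  have h2 : A.re = (A / B).re * B.re := by
    conv_lhs => rw [h1]
    simp
  nlinarith [h.1]

namespace PlaneTree

variable {V : Type*} {T : PlaneTree V}

variable (T) in
/-- An edge of the tree without its ends. -/
def openSeg (f : T.graph.Dart) : Set ℂ := openSegment ℝ (T.z f.fst) (T.z f.snd)

theorem openSeg_subset (f : T.graph.Dart) : T.openSeg f ⊆ T.seg f := openSegment_subset_segment ℝ _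
    _

theorem openSeg_symm (f : T.graph.Dart) : T.openSeg f.symm = T.openSeg f := openSegment_symm ℝ _ _

theorem fst_notMem_openSeg (f : T.graph.Dart) : T.z f.fst ∉ T.openSeg f := by
  rw [openSeg, left_mem_openSegment_iff]
  exact fun h => f.adj.ne (T.z_injective h)

theorem snd_notMem_openSeg (f : T.graph.Dart) : T.z f.snd ∉ T.openSeg f := by
  rw [openSeg, right_mem_openSegment_iff]
  exact fun h => f.adj.ne (T.z_injective h)

theorem exists_of_mem_openSeg {f : T.graph.Dart} {y : ℂ} (hy : y ∈ T.openSeg f) :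
    ∃ r : ℝ, 0 < r ∧ y - T.z f.fst = r * T.dir f := by
  rw [openSeg, openSegment_eq_image'] at hy
  obtain ⟨t, ⟨ht, -⟩, rfl⟩ := hy
  exact ⟨t, ht, by simp [dir]⟩

theorem notMem_seg_of_mem_openSeg {f g : T.graph.Dart} (h : g.edge ≠ f.edge) {y : ℂ}
    (hy : y ∈ T.openSeg f) : y ∉ T.seg g := by
  intro hy'
  obtain ⟨v, ⟨-, hv⟩, rfl⟩ := T.inter_segment_subset h ⟨hy', T.openSeg_subset f hy⟩
  rcases hv with rfl | hv
  · exact fst_notMem_openSeg f hy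
  · rw [Set.mem_singleton_iff] at hv; subst hv
    exact snd_notMem_openSeg f hy

variable [Finite V]

theorem tendsto_corner (f : T.graph.Dart) :
    Tendsto (fun δ : ℝ => T.corner δ f) (𝓝[>] 0) (𝓝 (T.z f.fst)) := by
  have h1 : Continuous fun δ : ℝ => T.corner δ f := by unfold corner; fun_prop
  have h2 := h1.tendsto 0
  simp only [corner, Complex.ofReal_zero, zero_mul, add_zero] at h2
  exact h2.mono_left nhdsWithin_le_nhds

/-- Three consecutive corners of the polygon are not collinear. -/
theorem eventually_corner_im_ne_zero {d : T.graph.Dart} (hd : d ∈ T.kept)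
    (h3 : T.succ (T.succ d) ≠ d) :
    ∀ᶠ δ in 𝓝[>] (0 : ℝ), ((T.corner δ d - T.corner δ (T.succ d)) /
      (T.corner δ (T.succ (T.succ d)) - T.corner δ (T.succ d))).im ≠ 0 := by
  have hc := (ret_spec hd).2
  obtain ⟨r, hr, hdir⟩ := exists_dir_rot_succ hd
  have hr' : (r : ℂ) ≠ 0 := by exact_mod_cast hr.ne'
  have hdc := T.dir_ne_zero (T.succ d)
  have hl := par_ret_pos hd
  have hl2 := par_ret_pos hc
  have hzd : T.z d.fst - T.z (T.succ d).fst =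
      ((T.par d (T.ret d) / r : ℝ) : ℂ) * T.dir (T.rot (T.succ d)) := by
    rw [z_succ, hdir]; push_cast; field_simp; ring
  have hz2 : T.z (T.succ (T.succ d)).fst - T.z (T.succ d).fst =
      (T.par (T.succ d) (T.ret (T.succ d)) : ℂ) * T.dir (T.succ d) := by
    rw [z_succ (T.succ d)]; ring
  -- At a leaf the three corners become collinear as δ tends to 0, so the sign has to be read off
  -- for positive δ. The two neighbouring heights are nonnegative, and they are not both 0 because
  -- the cycle does not close up after two steps.
  by_cases hrot : T.rot (T.succ d) = T.succ d
  · have hnot : ¬ ((T.bis d / T.dir d).im = 0 ∧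
        (T.bis (T.succ (T.succ d)) / T.dir (T.succ d)).im = 0) := by
      rw [bis_im_eq_zero_iff, (bis_succ_im hc).2]
      rintro ⟨h1, h2⟩
      obtain ⟨k, hk⟩ := Nat.exists_eq_add_of_le (ret_spec hd).1
      refine h3 (succ_eq_of_leaf (j := k) (i := 0) h1 h2 (by omega) (ret_spec hc).1 ?_)
      rw [← rot_iterate, show k + 1 = T.ret d by omega]
      exact hrot.symm
    have hb1 := bis_im_nonneg d
    have hb2 := (bis_succ_im hc).1
    filter_upwards [eventually_pos,
      eventually_pos_add_mul (div_pos hl hr) (1 - r⁻¹ * (T.bis d / T.dir d).re),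
      eventually_pos_add_mul hl2 (1 + (T.bis (T.succ (T.succ d)) / T.dir (T.succ d)).re)]
      with δ hδ hA hB
    have hbis : T.bis d = -((r⁻¹ : ℝ) : ℂ) * (T.bis d / T.dir d) * T.dir (T.succ d) := by
      have := T.dir_ne_zero d
      rw [← hrot, hdir]; push_cast; field_simp
    have e1 : T.corner δ d - T.corner δ (T.succ d) = (((T.par d (T.ret d) / r + δ : ℝ) : ℂ) -
        ((δ * r⁻¹ : ℝ) : ℂ) * (T.bis d / T.dir d)) * T.dir (T.succ d) := by
      rw [corner, corner, bis_of_rot_eq_self hrot, eq_add_of_sub_eq hzd, hrot]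
      conv_lhs => rw [hbis]
      push_cast; ring
    have e2 : T.corner δ (T.succ (T.succ d)) - T.corner δ (T.succ d) =
        (((T.par (T.succ d) (T.ret (T.succ d)) + δ : ℝ) : ℂ) +
        (δ : ℂ) * (T.bis (T.succ (T.succ d)) / T.dir (T.succ d))) * T.dir (T.succ d) := by
      rw [corner, corner, bis_of_rot_eq_self hrot, eq_add_of_sub_eq hz2]
      push_cast; field_simp; ring
    rw [e1, e2, mul_div_mul_right _ _ hdc]
    generalize T.bis d / T.dir d = b at *
    generalize T.bis (T.succ (T.succ d)) / T.dir (T.succ d) = b' at *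
    generalize T.par d (T.ret d) / r = l at *
    generalize T.par (T.succ d) (T.ret (T.succ d)) = l' at *
    generalize hs : r⁻¹ = s at *
    have hs' : 0 < s := by rw [← hs]; positivity
    set N : ℂ := ((l + δ : ℝ) : ℂ) - ((δ * s : ℝ) : ℂ) * b
    set M : ℂ := ((l' + δ : ℝ) : ℂ) + (δ : ℂ) * b'
    have hN1 : 0 < N.re := by
      have : N.re = l + δ * (1 - s * b.re) := by simp [N]; ring
      rw [this]; exact hA
    have hM1 : 0 < M.re := by
      have : M.re = l' + δ * (1 + b'.re) := by simp [M]; ring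
      rw [this]; exact hB
    have hN2 : N.im = -(δ * s * b.im) := by simp [N]
    have hM2 : M.im = δ * b'.im := by simp [M]
    have hM0 : 0 < Complex.normSq M := Complex.normSq_pos.2 fun h => by rw [h] at hM1; simp at hM1
    rw [im_div_eq]
    refine (div_neg_of_neg_of_pos ?_ hM0).ne
    rw [hN2, hM2]
    rcases hb1.eq_or_lt with h1 | h1
    · have h2 : 0 < b'.im := lt_of_le_of_ne hb2 fun h => hnot ⟨h1.symm, h.symm⟩
      rw [← h1]
      have := mul_pos hN1 (mul_pos hδ h2)
      linarith
    · have h4 := mul_pos (mul_pos (mul_pos hδ hs') h1) hM1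
      have h5 := mul_nonneg hN1.le (mul_nonneg hδ.le hb2)
      linarith
  -- Away from leaves the limit is already nonzero, the angle being neither π (the corner is kept)
  -- nor 2π.
  · have hlim : Tendsto (fun δ : ℝ => ((T.corner δ d - T.corner δ (T.succ d)) /
        (T.corner δ (T.succ (T.succ d)) - T.corner δ (T.succ d))).im) (𝓝[>] 0)
        (𝓝 ((T.z d.fst - T.z (T.succ d).fst) /
          (T.z (T.succ (T.succ d)).fst - T.z (T.succ d).fst)).im) := by
      refine (Complex.continuous_im.tendsto _).comp
        (((tendsto_corner d).sub (tendsto_corner _)).div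
          ((tendsto_corner _).sub (tendsto_corner _)) ?_)
      rw [hz2]
      exact mul_ne_zero (by exact_mod_cast hl2.ne') hdc
    refine hlim.eventually_ne ?_
    rw [hzd, hz2]
    have : ((T.par d (T.ret d) / r : ℝ) : ℂ) * T.dir (T.rot (T.succ d)) /
        ((T.par (T.succ d) (T.ret (T.succ d)) : ℂ) * T.dir (T.succ d)) =
        ((T.par d (T.ret d) / r / T.par (T.succ d) (T.ret (T.succ d)) : ℝ) : ℂ) *
          (T.dir (T.rot (T.succ d)) / T.dir (T.succ d)) := by
      push_cast; field_simp
    rw [this, Complex.im_ofReal_mul]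
    refine mul_ne_zero (by positivity) fun h => ?_
    rcases turn_of_im_eq_zero hdc (T.dir_ne_zero _) h with h | h
    · exact hc h
    · exact hrot ((T.rot_eq_self_iff _).2 h)

/-- A side of the polygon that does not run from leaf to leaf avoids the edges of its stretch. -/
theorem disjoint_side_openSeg {δ : ℝ} (hδ : 0 < δ) {e : T.graph.Dart} (he : e ∈ T.kept) {i : ℕ}
    (hi : i < T.ret e) (h : ¬ (T.rot e = e ∧ T.rot (T.succ e) = T.succ e)) :
    Disjoint (T.side δ e) (T.openSeg (T.face^[i] e)) := by
  rw [Set.disjoint_left]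
  intro y hy hy'
  have h1 := openSeg_subset _ hy'
  rw [seg_iterate e hi] at h1
  obtain ⟨s, ⟨hs0, hs1⟩, hys⟩ := h1
  dsimp only at hys
  subst hys
  have hde := T.dir_ne_zero e
  have him : ((T.z e.fst + s * T.dir e - T.z e.fst) / T.dir e).im = 0 := by
    rw [add_sub_cancel_left, mul_div_assoc, div_self hde]; simp
  have hp0 := par_nonneg e hi.le
  have hp1 := par_le_ret e (Nat.succ_le_of_lt hi)
  have hcanc : ∀ a : ℝ, T.z e.fst + s * T.dir e = T.z e.fst + a * T.dir e → s = a := by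
    intro a ha
    exact_mod_cast mul_right_cancel₀ hde (add_left_cancel ha)
  -- A corner of height 0 sits beyond a leaf, at parameter `-δ` or beyond `T.par e (T.ret e)`, hence
  -- off the stretch.
  rcases side_im_eq_zero hδ he hy him with h2 | ⟨h2, h3⟩ | ⟨h2, h3⟩
  · exact h h2
  · rw [corner, bis_of_rot_eq_self h3] at h2
    have := hcanc (-δ) (by rw [h2]; push_cast; ring)
    linarith
  · obtain ⟨k, hk, h4⟩ := exists_bis_succ_of_rot_eq_self he h3
    rw [corner, h4, z_succ] at h2
    have := hcanc (T.par e (T.ret e) + δ * k) (by rw [h2]; push_cast; ring)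
    have := mul_pos hδ hk
    rw [Nat.succ_eq_add_one] at hp1
    linarith

theorem eventually_disjoint_side_openSeg_of_fst {e : T.graph.Dart} (he : e ∈ T.kept)
    {f : T.graph.Dart} (hf : ∀ i < T.ret e, (T.face^[i] e).edge ≠ f.edge) {j : ℕ}
    (hj : j ≤ T.ret e) (hjf : (T.face^[j] e).fst = f.fst) :
    ∀ᶠ δ in 𝓝[>] (0 : ℝ), Disjoint (T.side δ e) (T.openSeg f) := by
  filter_upwards [eventually_side_mem_sector he] with δ h
  rw [Set.disjoint_left]
  intro y hy hy'
  obtain ⟨r, hr, h1⟩ := exists_of_mem_openSeg hy'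
  have hne : y - T.z f.fst ≠ 0 := by
    rw [h1]; exact mul_ne_zero (by exact_mod_cast hr.ne') (T.dir_ne_zero f)
  have h2 := h j hj y hy (by rw [hjf]; exact hne)
  rw [hjf, h1] at h2
  rcases h2 with h2 | ⟨g, hg, s, hs, h2⟩
  · exact T.dir_notMem_sector hjf.symm hr h2
  · have hs' : (s : ℂ) ≠ 0 := by exact_mod_cast hs.ne'
    have h3 : f = g := T.eq_of_dir_eq_smul (hjf.symm.trans (own_fst hg).symm)
        (r := s⁻¹ * r) (by positivity) (by push_cast; field_simp; linear_combination -h2)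
    obtain ⟨i, hi, hi'⟩ := exists_edge_of_own hg
    exact hf i hi (h3 ▸ hi')

theorem eventually_disjoint_side_openSeg {e : T.graph.Dart} (he : e ∈ T.kept)
    {f : T.graph.Dart} (hf : ∀ i < T.ret e, (T.face^[i] e).edge ≠ f.edge) :
    ∀ᶠ δ in 𝓝[>] (0 : ℝ), Disjoint (T.side δ e) (T.openSeg f) := by
  by_cases h1 : ∃ j ≤ T.ret e, (T.face^[j] e).fst = f.fst
  · obtain ⟨j, hj, h1⟩ := h1
    exact eventually_disjoint_side_openSeg_of_fst he hf hj h1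
  by_cases h2 : ∃ j ≤ T.ret e, (T.face^[j] e).fst = f.snd
  · obtain ⟨j, hj, h2⟩ := h2
    rw [← openSeg_symm]
    exact eventually_disjoint_side_openSeg_of_fst he (f := f.symm)
      (by simpa only [SimpleGraph.Dart.edge_symm] using hf) hj h2
  have hdis : Disjoint (T.stretch e) (T.seg f) := by
    rw [Set.disjoint_left]
    intro y hy hy'
    obtain ⟨i, hi, hyi⟩ := Set.mem_iUnion₂.1 hy
    obtain ⟨v, ⟨hv1, hv2⟩, -⟩ := T.inter_segment_subset (hf i hi) ⟨hyi, hy'⟩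
    obtain ⟨j, hj, h3⟩ := exists_iterate_of_mem hi hv1
    rcases hv2 with rfl | hv2
    · exact h1 ⟨j, hj, h3⟩
    · exact h2 ⟨j, hj, h3.trans hv2⟩
  filter_upwards [eventually_disjoint_side he (isCompact_segment _ _) hdis] with δ h
  exact h.mono_right (T.openSeg_subset f)

/-- A side of the polygon that runs from leaf to leaf contains its stretch. -/
theorem stretch_subset_side {δ : ℝ} (hδ : 0 < δ) {d : T.graph.Dart} (hd : d ∈ T.kept)
    (h1 : T.rot d = d) (h2 : T.rot (T.succ d) = T.succ d) {j : ℕ} (hj : j < T.ret d) :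
    T.seg (T.face^[j] d) ⊆ T.side δ d := by
  rw [seg_iterate d hj]
  rintro _ ⟨s, ⟨hs0, hs1⟩, rfl⟩
  obtain ⟨k, hk, h4⟩ := exists_bis_succ_of_rot_eq_self hd h2
  have hp0 := par_nonneg d hj.le
  have hp1 := par_le_ret d (Nat.succ_le_of_lt hj)
  rw [Nat.succ_eq_add_one] at hp1
  have hδk := mul_pos hδ hk
  have hL : 0 < T.par d (T.ret d) + δ * k + δ := by linarith [par_ret_pos hd]
  have hL' : (T.par d (T.ret d) + δ * k + δ : ℂ) ≠ 0 := by exact_mod_cast hL.ne'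
  have : T.z d.fst + s * T.dir d = T.corner δ d + (((s + δ) / (T.par d (T.ret d) + δ * k + δ) : ℝ)
      : ℂ)
      * (T.corner δ (T.succ d) - T.corner δ d) := by
    rw [corner, corner, h4, bis_of_rot_eq_self h1, z_succ]
    push_cast; field_simp; ring
  dsimp only
  rw [this]
  exact mem_segment_add_smul (div_nonneg (by linarith) hL.le) ((div_le_one hL).2 (by linarith))

end PlaneTree

/-! ### The polygon encloses the tree. -/

namespace PlaneTree

variable {V : Type*} {T : PlaneTree V} [Finite V]

section Enumeration

variable {n : ℕ} (e : Fin n ≃ T.kept)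

variable (T) in
/-- The vertices of the polygon, for an enumeration of the proper corners of the tree. -/
noncomputable def corners (δ : ℝ) (i : Fin n) : ℂ := T.corner δ (e i)

variable {e} (he : ∀ i, (e (finRotate n i) : T.graph.Dart) = T.succ (e i))
include he

theorem segment_corners (δ : ℝ) (i : Fin n) :
    segment ℝ (T.corners e δ i) (T.corners e δ (finRotate n i)) = T.side δ (e i) := by
  rw [corners, corners, he, side]

theorem chain_corners (δ : ℝ) : chain (T.corners e δ) = ⋃ i, T.side δ (e i) :=
  Set.iUnion_congr fun i => segment_corners he δ i

theorem side_subset_chain (δ : ℝ) {d : T.graph.Dart} (hd : d ∈ T.kept) :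
    T.side δ d ⊆ chain (T.corners e δ) := by
  rw [chain_corners he]
  have := Set.subset_iUnion (fun i => T.side δ (e i)) (e.symm ⟨d, hd⟩)
  simpa using this

theorem eventually_chain_subset {η : ℝ} (hη : 0 < η) :
    ∀ᶠ δ in 𝓝[>] (0 : ℝ), chain (T.corners e δ) ⊆ Metric.thickening η T.edgeUnion := by
  have h : ∀ᶠ δ in 𝓝[>] (0 : ℝ), ∀ i, T.side δ (e i) ⊆ Metric.thickening η (T.stretch (e i)) :=
    eventually_all.2 fun i => eventually_side_subset (e i).2 hη
  filter_upwards [h] with δ h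
  rw [chain_corners he]
  refine Set.iUnion_subset fun i => (h i).trans (Metric.thickening_subset_of_subset _ ?_)
  exact Set.iUnion₂_subset fun j _ => T.seg_subset _

theorem tendsto_volume_fill_chain [Nonempty T.graph.Dart] :
    Tendsto (fun δ => MeasureTheory.volume (fill (chain (T.corners e δ)))) (𝓝[>] 0) (𝓝 0) :=
  tendsto_volume_fill T.isCompact_edgeUnion T.isPreconnected_compl_edgeUnion T.volume_edgeUnion
    (fun _ => isCompact_chain.isClosed) fun _ hη => eventually_chain_subset he hη

/-- Across a stretch that does not run from leaf to leaf, the polygon separates the tree from the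
outside. -/
theorem eventually_sweep_ne_zero {d : T.graph.Dart} (hd : d ∈ T.kept) {j : ℕ} (hj : j < T.ret d)
    (h : ¬ (T.rot d = d ∧ T.rot (T.succ d) = T.succ d)) {m : ℂ} (hm : m ∈ T.openSeg (T.face^[j] d))
    (hopen : ∀ᶠ δ in 𝓝[>] (0 : ℝ), Disjoint (chain (T.corners e δ)) (T.openSeg (T.face^[j] d))) :
    ∀ᶠ δ in 𝓝[>] (0 : ℝ), sweep (T.corners e δ) m ≠ 0 := by
  set f := T.face^[j] d with hf
  have hD := T.dir_ne_zero d
  obtain ⟨s, ⟨hs0, hs1⟩, hsm⟩ := (seg_iterate d hj) ▸ T.openSeg_subset f hm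
  dsimp only at hsm
  have hs0' : 0 < s := by
    refine lt_of_le_of_ne ((par_nonneg d hj.le).trans hs0) fun h0 => ?_
    have h1 : T.par d j = 0 := le_antisymm (h0 ▸ hs0) (par_nonneg d hj.le)
    refine fst_notMem_openSeg f ?_
    have h2 : T.z f.fst = m := by rw [hf, (z_iterate d hj.le).1, h1, ← hsm, ← h0]
    rwa [h2]
  have hs1' : s < T.par d (T.ret d) := by
    refine lt_of_le_of_ne (hs1.trans (par_le_ret d hj)) fun h0 => ?_
    have h1 : T.par d (j + 1) = s := le_antisymm (h0 ▸ par_le_ret d hj) hs1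
    refine snd_notMem_openSeg f ?_
    rwa [hf, ← iterate_fst, (z_iterate d hj).1, h1, hsm]
  let K : Set ℂ := ⋃ g : {g : T.graph.Dart // g.edge ≠ f.edge}, T.seg g
  have hK : IsClosed K := (isCompact_iUnion fun _ => isCompact_segment _ _).isClosed
  have hmK : m ∈ Kᶜ := fun h => by
    obtain ⟨g, hg⟩ := Set.mem_iUnion.1 h
    exact notMem_seg_of_mem_openSeg g.2 hm hg
  have hcoord : ∀ τ : ℝ, (m + τ * Complex.I * T.dir d - T.z d.fst) / T.dir d = s + τ * Complex.I :=
      by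
    intro τ
    rw [← hsm]; field_simp; ring
  obtain ⟨η, hη, hηK⟩ : ∃ η : ℝ, 0 < η ∧ ∀ τ : ℝ, 0 ≤ τ → τ ≤ η →
      m + τ * Complex.I * T.dir d ∉ K := by
    obtain ⟨ρ, hρ, hball⟩ := Metric.isOpen_iff.1 hK.isOpen_compl m hmK
    have hn : 0 < ‖T.dir d‖ := norm_pos_iff.2 hD
    refine ⟨ρ / 2 / ‖T.dir d‖, by positivity, fun τ h0 h1 => hball ?_⟩
    rw [Metric.mem_ball, dist_eq_norm, add_sub_cancel_left, norm_mul, norm_mul, Complex.norm_I,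
      mul_one, Complex.norm_real, Real.norm_of_nonneg h0]
    rw [le_div_iff₀ hn] at h1
    linarith
  -- The point `m` of the edge is pushed to the left by an `η` independent of δ, so for small δ the
  -- side along the stretch passes between `m` and `x`. The bound on `η` keeps the segment from `x`
  -- to `m` off all other edges.
  set x : ℂ := m + η * Complex.I * T.dir d
  have hS : ∀ w ∈ segment ℝ x m, ∃ τ : ℝ, 0 ≤ τ ∧ τ ≤ η ∧ w = m + τ * Complex.I * T.dir d := by
    intro w hw
    rw [segment_symm, segment_eq_image'] at hw
    obtain ⟨t, ⟨h0, h1⟩, rfl⟩ := hw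
    refine ⟨t * η, by positivity, mul_le_of_le_one_left hη.le h1, ?_⟩
    simp only [x, Complex.real_smul]; push_cast; ring
  have hsegf : ∀ g : T.graph.Dart, g.edge = f.edge → T.seg g = T.seg f := by
    intro g hg
    rcases (SimpleGraph.dart_edge_eq_iff _ _).1 hg with rfl | rfl
    · rfl
    · exact T.seg_symm f
  have hx : x ∉ T.edgeUnion := by
    intro hx
    obtain ⟨g, hg⟩ := Set.mem_iUnion.1 hx
    by_cases hgf : g.edge = f.edge
    · rw [hsegf g hgf, seg_iterate d hj] at hg
      obtain ⟨s', -, hs'⟩ := hg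
      have h1 := hcoord η
      change (x - T.z d.fst) / T.dir d = _ at h1
      dsimp only at hs'
      rw [← hs', add_sub_cancel_left, mul_div_assoc, div_self hD, mul_one] at h1
      have h2 := congrArg Complex.im h1
      simp at h2
      exact hη.ne h2
    · exact hηK η hη.le le_rfl (Set.mem_iUnion.2 ⟨⟨g, hgf⟩, hg⟩)
  have hother : ∀ i : Fin n, (e i : T.graph.Dart) ≠ d →
      ∀ᶠ δ in 𝓝[>] (0 : ℝ), Disjoint (T.side δ (e i)) (segment ℝ x m) := by
    intro i hi
    by_cases hsh : T.Shares d (e i)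
    -- A side along the opposite side of the same edge could meet the segment from `x` to `m` only
    -- at height 0, in `m`, which `hopen` forbids. The remaining sides are close to stretches away
    -- from this segment.
    · obtain ⟨k, hk, h1⟩ := hsh.exists_im_eq hd (e i).2 hi.symm
      filter_upwards [eventually_pos, hopen] with δ hδ hopen
      rw [Set.disjoint_left]
      intro y hy hy'
      obtain ⟨τ, h0, -, hyτ⟩ := hS y hy'
      have h2 := side_im_nonneg hδ.le (e i).2 hy
      rw [h1, hyτ, hcoord] at h2
      simp at h2
      have h3 : τ = 0 := by nlinarith
      rw [h3] at hyτ
      simp only [Complex.ofReal_zero, zero_mul, add_zero] at hyτ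
      subst hyτ
      exact Set.disjoint_left.1 hopen (side_subset_chain he δ (e i).2 hy) hm
    · refine eventually_disjoint_side (e i).2 (isCompact_segment _ _) ?_
      rw [Set.disjoint_left]
      intro y hy hy'
      obtain ⟨l, hl, hyl⟩ := Set.mem_iUnion₂.1 hy
      obtain ⟨τ, h0, h1, rfl⟩ := hS y hy'
      exact hηK τ h0 h1 (Set.mem_iUnion.2 ⟨⟨_, fun hg => hsh ⟨j, hj, l, hl, hg⟩⟩, hyl⟩)
  obtain ⟨ζ, hζ, hout⟩ := exists_thickening_not_isBounded T.isCompact_edgeUnion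
    (haveI : Nonempty T.graph.Dart := ⟨d⟩; T.isPreconnected_compl_edgeUnion) hx
  have hall : ∀ᶠ δ in 𝓝[>] (0 : ℝ), ∀ i : Fin n, (e i : T.graph.Dart) ≠ d →
      Disjoint (T.side δ (e i)) (segment ℝ x m) :=
    eventually_all.2 fun i => eventually_imp_distrib_left.2 (hother i)
  have hb1 := bis_im_nonneg d
  have hb2 := (bis_succ_im hd).1
  have hnot : ¬ ((T.bis d / T.dir d).im = 0 ∧ (T.bis (T.succ d) / T.dir d).im = 0) := by
    rw [bis_im_eq_zero_iff, (bis_succ_im hd).2]; exact h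
  filter_upwards [eventually_pos, hall, eventually_chain_subset he hζ,
    eventually_pos_add_mul hs0' (-(T.bis d / T.dir d).re),
    eventually_pos_add_mul (sub_pos.2 hs1') (T.bis (T.succ d) / T.dir d).re,
    eventually_pos_add_mul hη (-(T.bis d / T.dir d).im),
    eventually_pos_add_mul hη (-(T.bis (T.succ d) / T.dir d).im)]
    with δ hδ hall hsub c1 c2 c3 c4
  obtain ⟨hxc, hxb⟩ := hout _ hsub
  let i0 := e.symm ⟨d, hd⟩
  have hi0 : (e i0 : T.graph.Dart) = d := by simp [i0]
  have hratio : ∀ τ : ℝ, ratio (T.corners e δ) i0 (m + τ * Complex.I * T.dir d) =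
      ((T.par d (T.ret d) : ℂ) + δ * (T.bis (T.succ d) / T.dir d) - (s + τ * Complex.I)) /
        (δ * (T.bis d / T.dir d) - (s + τ * Complex.I)) := by
    intro τ
    rw [ratio, corners, corners, he, hi0, ← corner_succ_sub_div, ← corner_sub_div, ← hcoord,
      div_sub_div_same, div_sub_div_same, div_div_div_cancel_right₀ hD]
    congr 1 <;> ring
  have hsw := sweep_jump (p := T.corners e δ) (x := x) (y := m) (i := i0) (fun i hi => by
      rw [segment_corners he]
      refine (hall i fun h' => hi ?_).symm
      rw [← e.symm_apply_apply i]
      exact congrArg e.symm (Subtype.ext h'))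
    (fun w hw => by
      obtain ⟨τ, h0, h1, rfl⟩ := hS w hw
      -- Seen from the segment, one corner lies behind and the other ahead in the direction of the
      -- stretch, so the negated ratio is a quotient of numbers with positive real part.
      rw [hratio, ← div_neg]
      apply div_mem_slitPlane_of_re_pos
      · simp; linarith
      · simp; linarith)
  have hxm : sweep (T.corners e δ) x = sweep (T.corners e δ) m + 2 * Real.pi := by
    generalize T.bis d / T.dir d = b at *
    generalize T.bis (T.succ d) / T.dir d = b' at *
    refine hsw ?_ ?_
    · have := hratio η
      change ratio _ _ x = _ at this
      rw [this, im_div_eq]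
      refine div_pos ?_ (Complex.normSq_pos.2 fun h0 => ?_)
      · simp
        nlinarith
      · have := congrArg Complex.re h0
        simp at this; linarith
    · have := hratio 0
      simp only [Complex.ofReal_zero, zero_mul, add_zero] at this
      rw [this, im_div_eq]
      refine div_neg_of_neg_of_pos ?_ (Complex.normSq_pos.2 fun h0 => ?_)
      · simp
        rcases hb1.eq_or_lt with h1 | h1
        · have h2 : 0 < b'.im := lt_of_le_of_ne hb2 fun h => hnot ⟨h1.symm, h.symm⟩
          rw [← h1]
          have := mul_pos hδ h2
          nlinarith
        · have h2 := mul_pos hδ h1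
          have h3 := mul_nonneg hδ.le hb2
          nlinarith
      · have := congrArg Complex.re h0
        simp at this; linarith
  have hx0 : sweep (T.corners e δ) x = 0 := sweep_eq_zero isPreconnected_connectedComponentIn
    (connectedComponentIn_subset _ _) hxb (mem_connectedComponentIn hxc)
  intro hm0
  rw [hx0, hm0] at hxm
  linarith [Real.pi_pos]

/-- The polygon encloses every edge of the tree. -/
theorem eventually_seg_subset_fill (f : T.graph.Dart) (hK : T.kept.Nonempty) :
    ∀ᶠ δ in 𝓝[>] (0 : ℝ), T.seg f ⊆ fill (chain (T.corners e δ)) := by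
  -- The edge is followed by two stretches, one in each direction. If either side runs from leaf to
  -- leaf, the polygon covers the edge. Otherwise no side meets the open edge, so one point of
  -- nonzero sweep puts it into a bounded component, and closedness of `fill` adds the ends.
  obtain ⟨d, hd, j, hj, hf⟩ := exists_lt_returnTime T.exists_face_iterate_eq hK f
  obtain ⟨d', hd', j', hj', hf'⟩ := exists_lt_returnTime T.exists_face_iterate_eq hK f.symm
  by_cases h : T.rot d = d ∧ T.rot (T.succ d) = T.succ d
  · filter_upwards [eventually_pos] with δ hδ
    rw [← hf]
    exact (stretch_subset_side hδ hd h.1 h.2 hj).trans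
      ((side_subset_chain he δ hd).trans Set.subset_union_left)
  by_cases h' : T.rot d' = d' ∧ T.rot (T.succ d') = T.succ d'
  · filter_upwards [eventually_pos] with δ hδ
    rw [← seg_symm, ← hf']
    exact (stretch_subset_side hδ hd' h'.1 h'.2 hj').trans
      ((side_subset_chain he δ hd').trans Set.subset_union_left)
  have hopen : ∀ᶠ δ in 𝓝[>] (0 : ℝ), ∀ i : Fin n, Disjoint (T.side δ (e i)) (T.openSeg f) := by
    refine eventually_all.2 fun i => ?_
    by_cases hi : ∀ l < T.ret (e i), (T.face^[l] (e i : T.graph.Dart)).edge ≠ f.edge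
    · exact eventually_disjoint_side_openSeg (e i).2 hi
    push Not at hi
    obtain ⟨l, hl, hle⟩ := hi
    rcases (SimpleGraph.dart_edge_eq_iff _ _).1 hle with h1 | h1
    · have hde : (e i : T.graph.Dart) = d :=
        iterate_eq_of_lt_returnTime T.face.injective (e i).2 hd hl hj (h1.trans hf.symm)
      rw [hde, ← hf]
      filter_upwards [eventually_pos] with δ hδ using disjoint_side_openSeg hδ hd hj h
    · have hde : (e i : T.graph.Dart) = d' :=
        iterate_eq_of_lt_returnTime T.face.injective (e i).2 hd' hl hj' (h1.trans hf'.symm)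
      rw [hde, ← openSeg_symm, ← hf']
      filter_upwards [eventually_pos] with δ hδ using disjoint_side_openSeg hδ hd' hj' h'
  have hopen' : ∀ᶠ δ in 𝓝[>] (0 : ℝ), Disjoint (chain (T.corners e δ)) (T.openSeg f) := by
    filter_upwards [hopen] with δ h
    rw [chain_corners he, Set.disjoint_iUnion_left]
    exact h
  obtain ⟨m, hm⟩ : (T.openSeg f).Nonempty := by
    rw [openSeg, openSegment_eq_image']
    exact ⟨_, ⟨1 / 2, by norm_num, rfl⟩⟩
  have hsweep := eventually_sweep_ne_zero he hd hj h (m := m) (by rwa [hf]) (by rwa [hf])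
  filter_upwards [hopen', hsweep] with δ hopen hsweep
  have hsub : T.openSeg f ⊆ (chain (T.corners e δ))ᶜ := hopen.subset_compl_left
  have hb : Bornology.IsBounded (connectedComponentIn (chain (T.corners e δ))ᶜ m) := by
    by_contra hb
    exact hsweep (sweep_eq_zero isPreconnected_connectedComponentIn
      (connectedComponentIn_subset _ _) hb (mem_connectedComponentIn (hsub hm)))
  have hin : T.openSeg f ⊆ fill (chain (T.corners e δ)) := by
    intro y hy
    refine Or.inr ⟨hsub hy, ?_⟩
    rwa [← connectedComponentIn_eq ((convex_openSegment _
        _).isPreconnected.subset_connectedComponentIn hm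
      hsub hy)]
  have := (isClosed_fill (isCompact_chain (p := T.corners e δ)).isClosed).closure_subset_iff.2 hin
  rwa [openSeg, closure_openSegment] at this

end Enumeration

end PlaneTree

/-! ### From complex chains to polygons in the Euclidean plane. -/

section Transfer

variable {n : ℕ} (p : Fin n → ℂ)

/-- The polygon in the plane with given complex vertices. -/
noncomputable def planePolygon : Polygon Plane n := ⟨fun i => toC.symm (p i)⟩

theorem image_edgeSet (i : Fin n) :
    toC '' (planePolygon p).edgeSet ℝ i = segment ℝ (p i) (p (finRotate n i)) := by
  rw [Polygon.edgeSet, affineSegment_eq_segment, PlaneTree.toC_image_segment]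
  simp [planePolygon]

theorem image_boundary : toC '' (planePolygon p).boundary ℝ = chain p := by
  rw [Polygon.boundary, Set.image_iUnion]
  exact Set.iUnion_congr fun i => image_edgeSet p i

theorem region_planePolygon : (planePolygon p).region = toC ⁻¹' fill (chain p) := by
  ext x
  have hmem : x ∈ (planePolygon p).boundary ℝ ↔ toC x ∈ chain p := by
    rw [← image_boundary, toC.injective.mem_set_image]
  have hcompl : toC '' ((planePolygon p).boundary ℝ)ᶜ = (chain p)ᶜ := by
    rw [Set.image_compl_eq toC.bijective, image_boundary]
  have hb (h : x ∉ (planePolygon p).boundary ℝ) :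
      Bornology.IsBounded (connectedComponentIn ((planePolygon p).boundary ℝ)ᶜ x) ↔
        Bornology.IsBounded (connectedComponentIn (chain p)ᶜ (toC x)) := by
    have h1 := toC.toHomeomorph.image_connectedComponentIn (s := ((planePolygon p).boundary ℝ)ᶜ) h
    change toC '' _ = connectedComponentIn (toC '' _) (toC x) at h1
    rw [← hcompl, ← h1]
    constructor
    · exact toC.lipschitz.isBounded_image
    · intro h2
      have := toC.symm.lipschitz.isBounded_image h2
      rwa [← Set.image_comp, show (toC.symm ∘ toC) = id from funext toC.symm_apply_apply,
        Set.image_id] at this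
  simp only [Polygon.region, fill, Set.mem_union, Set.mem_ofPred_eq, Set.mem_preimage, hmem]
  refine or_congr_right (and_congr_right fun h => hb fun h' => h (hmem.1 h'))

theorem volume_region_planePolygon :
    MeasureTheory.volume (planePolygon p).region = MeasureTheory.volume (fill (chain p)) := by
  rw [region_planePolygon]
  exact toC.measurePreserving.measure_preimage
    (isClosed_fill isCompact_chain.isClosed).measurableSet.nullMeasurableSet

variable {p}

theorem isSimple_planePolygon (h3 : 3 ≤ n) (hinj : Function.Injective p)
    (hcorner : ∀ i, ((p i - p (finRotate n i)) /
      (p (finRotate n (finRotate n i)) - p (finRotate n i))).im ≠ 0)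
    (hinter : ∀ i j, i ≠ j → segment ℝ (p i) (p (finRotate n i)) ∩
      segment ℝ (p j) (p (finRotate n j)) ⊆ p '' ({i, finRotate n i} ∩ {j, finRotate n j})) :
    (planePolygon p).IsSimple where
  three_le := h3
  injective := toC.symm.injective.comp hinj
  corner i := by
    rw [affineIndependent_iff_not_collinear_set]
    intro h
    obtain ⟨v, hv⟩ := (collinear_iff_of_mem (p₀ := planePolygon p (finRotate n i))
      (by simp)).1 h
    obtain ⟨r, hr⟩ := hv (planePolygon p i) (by simp)
    obtain ⟨s, hs⟩ := hv (planePolygon p (finRotate n (finRotate n i))) (by simp)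
    have hr' := congrArg toC hr
    have hs' := congrArg toC hs
    simp only [planePolygon, LinearIsometryEquiv.apply_symm_apply, vadd_eq_add, map_add, map_smul,
      Complex.real_smul] at hr' hs'
    refine hcorner i ?_
    rw [hr', hs', add_sub_cancel_right, add_sub_cancel_right]
    by_cases h0 : toC v = 0
    · simp [h0]
    rw [mul_div_mul_right _ _ h0, ← Complex.ofReal_div, Complex.ofReal_im]
  edges_inter i j hij := by
    have := hinter i j hij
    rw [← image_edgeSet, ← image_edgeSet, ← Set.image_inter toC.injective] at this
    have h1 := Set.image_mono (f := toC.symm) this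
    rw [← Set.image_comp, ← Set.image_comp,
      show (toC.symm ∘ toC) = id from funext toC.symm_apply_apply, Set.image_id] at h1
    exact h1

end Transfer

/-! ### Existence of the polygon in terms of proper corners. -/

namespace PlaneTree

variable {V : Type*} (T : PlaneTree V) [Finite V]

/-- A plane tree with at least three proper corners lies in a simple polygon of arbitrarily small
area that has one vertex for each proper corner. -/
theorem exists_polygon {n : ℕ} (hn : Nat.card T.kept = n) (h3 : 3 ≤ n) {ε : ℝ} (hε : 0 < ε) :
    ∃ P : Polygon Plane n, P.IsSimple ∧ T.carrier ⊆ P.region ∧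
      MeasureTheory.volume P.region ≤ ENNReal.ofReal ε := by
  have hK : T.kept.Nonempty := by
    rw [← Set.nonempty_coe_sort, ← not_isEmpty_iff]
    intro h
    rw [Nat.card_of_isEmpty] at hn
    omega
  obtain ⟨d₀, hd₀⟩ := id hK
  have : Nonempty T.graph.Dart := ⟨d₀⟩
  obtain ⟨e, he⟩ := exists_cyclic_enumeration T.face.injective T.exists_face_iterate_eq hK hn
  replace he : ∀ i, (e (finRotate n i) : T.graph.Dart) = T.succ (e i) := he
  -- Rotating a cycle of length at least 3 twice fixes nothing; this rules out a tree that is a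
  -- single straight path.
  have hsucc2 : ∀ i, T.succ (T.succ (e i)) ≠ e i := by
    intro i h
    rw [← he, ← he] at h
    have h1 := e.injective (Subtype.ext h)
    obtain ⟨m, rfl⟩ := Nat.exists_eq_add_of_le' h3
    rw [finRotate_apply, finRotate_apply, add_assoc, add_eq_left] at h1
    have h2 := congrArg Fin.val h1
    rw [Fin.val_add, Fin.val_one, Nat.mod_eq_of_lt (by omega)] at h2
    simp at h2
  have hinj : ∀ᶠ δ in 𝓝[>] (0 : ℝ), ∀ i j, i ≠ j → T.corners e δ i ≠ T.corners e δ j := by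
    refine eventually_all.2 fun i => eventually_all.2 fun j => eventually_imp_distrib_left.2 ?_
    exact fun h => eventually_corner_ne fun h' => h (e.injective (Subtype.ext h'))
  have hcorner : ∀ᶠ δ in 𝓝[>] (0 : ℝ), ∀ i, ((T.corner δ (e i) - T.corner δ (T.succ (e i))) /
      (T.corner δ (T.succ (T.succ (e i))) - T.corner δ (T.succ (e i)))).im ≠ 0 :=
    eventually_all.2 fun i => eventually_corner_im_ne_zero (e i).2 (hsucc2 i)
  have hinter : ∀ᶠ δ in 𝓝[>] (0 : ℝ), ∀ i j, i ≠ j → ∀ y ∈ T.side δ (e i), y ∈ T.side δ (e j) →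
      ∃ x, (x = (e i : T.graph.Dart) ∨ x = T.succ (e i)) ∧
        (x = (e j : T.graph.Dart) ∨ x = T.succ (e j)) ∧ y = T.corner δ x := by
    refine eventually_all.2 fun i => eventually_all.2 fun j => eventually_imp_distrib_left.2 ?_
    exact fun h => eventually_sides_inter (e i).2 (e j).2
      (fun h' => h (e.injective (Subtype.ext h'))) (hsucc2 i)
  have hseg : ∀ᶠ δ in 𝓝[>] (0 : ℝ), ∀ f, T.seg f ⊆ fill (chain (T.corners e δ)) :=
    eventually_all.2 fun f => eventually_seg_subset_fill he f hK
  have hvol : ∀ᶠ δ in 𝓝[>] (0 : ℝ),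
      MeasureTheory.volume (fill (chain (T.corners e δ))) ≤ ENNReal.ofReal ε :=
    (tendsto_volume_fill_chain he).eventually_le_const (ENNReal.ofReal_pos.2 hε)
  obtain ⟨δ, hinj, hcorner, hinter, hseg, hvol⟩ :=
    (hinj.and <| hcorner.and <| hinter.and <| hseg.and hvol).exists
  refine ⟨planePolygon (T.corners e δ), isSimple_planePolygon h3 ?_ ?_ ?_, ?_, ?_⟩
  · exact fun i j h => by_contra fun hne => hinj i j hne h
  · intro i
    simpa only [corners, he] using hcorner i
  · rintro i j hij y ⟨h1, h2⟩
    rw [segment_corners he] at h1 h2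
    obtain ⟨x, hx1, hx2, rfl⟩ := hinter i j hij y h1 h2
    have hx : ∀ k, (x = (e k : T.graph.Dart) ∨ x = T.succ (e k)) →
        ∃ l, l ∈ ({k, finRotate n k} : Set (Fin n)) ∧ (e l : T.graph.Dart) = x := by
      rintro k (rfl | rfl)
      · exact ⟨k, Or.inl rfl, rfl⟩
      · exact ⟨_, Or.inr rfl, he k⟩
    obtain ⟨l, hl, hlx⟩ := hx i hx1
    obtain ⟨l', hl', hlx'⟩ := hx j hx2
    obtain rfl : l = l' := e.injective (Subtype.ext (hlx.trans hlx'.symm))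
    exact ⟨l, ⟨hl, hl'⟩, by rw [corners, hlx]⟩
  · rw [region_planePolygon]
    rintro x (⟨v, rfl⟩ | ⟨u, v, huv, hx⟩)
    · have : ∃ d : T.graph.Dart, d.fst = v := by
        by_cases h : v = d₀.fst
        · exact ⟨d₀, h.symm⟩
        · exact T.exists_dart_fst h
      obtain ⟨d, rfl⟩ := this
      exact hseg d (left_mem_segment ℝ _ _)
    · refine hseg ⟨(u, v), huv⟩ ?_
      rw [seg, z, z, ← toC_image_segment]
      exact Set.mem_image_of_mem _ hx
  · rwa [volume_region_planePolygon]

end PlaneTree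

/-! ### Segments as straight paths. -/

namespace PlaneTree

variable {V : Type*} {T : PlaneTree V}

theorem collinear_iff_of_mem {S : Set V} {a : V} (ha : a ∈ S) :
    Collinear ℝ (T.pos '' S) ↔ ∃ D : ℂ, ∀ v ∈ S, ∃ r : ℝ, T.z v = T.z a + r * D := by
  rw [_root_.collinear_iff_of_mem (Set.mem_image_of_mem _ ha)]
  constructor
  · rintro ⟨D, h⟩
    refine ⟨toC D, fun v hv => ?_⟩
    obtain ⟨r, hr⟩ := h _ (Set.mem_image_of_mem _ hv)
    refine ⟨r, ?_⟩
    rw [z, hr, vadd_eq_add, map_add, map_smul, Complex.real_smul, add_comm]; rfl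
  · rintro ⟨D, h⟩
    refine ⟨toC.symm D, ?_⟩
    rintro _ ⟨v, hv, rfl⟩
    obtain ⟨r, hr⟩ := h v hv
    refine ⟨r, toC.injective ?_⟩
    rw [vadd_eq_add, map_add, map_smul, Complex.real_smul, LinearIsometryEquiv.apply_symm_apply,
      add_comm]
    exact hr

/-- A collinear path of a plane tree runs in one direction. -/
theorem exists_steps {a b : V} {p : T.graph.Walk a b} (hp : p.IsPath)
    (hc : Collinear ℝ (T.pos '' {x | x ∈ p.support})) :
    ∃ D : ℂ, ∀ i < p.length, ∃ r : ℝ, 0 < r ∧ T.z (p.getVert (i + 1)) - T.z (p.getVert i) = r * D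
        := by
  obtain ⟨D, hD⟩ := (collinear_iff_of_mem (T := T) (S := {x | x ∈ p.support}) (a := a)
    p.start_mem_support).1 hc
  clear hc
  have hD' : ∀ x ∈ p.support, ∀ y ∈ p.support, ∃ r : ℝ, T.z y - T.z x = r * D := by
    intro x hx y hy
    obtain ⟨r, hr⟩ := hD x hx
    obtain ⟨s, hs⟩ := hD y hy
    refine ⟨s - r, ?_⟩
    rw [hr, hs]; push_cast; ring
  clear hD
  induction p with
  | nil => exact ⟨D, by simp⟩
  | @cons u v w h q ih =>
    rw [SimpleGraph.Walk.cons_isPath_iff] at hp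
    obtain ⟨E, hE⟩ := ih hp.1 fun x hx y hy => hD' x (by simp [hx]) y (by simp [hy])
    rcases Nat.eq_zero_or_pos q.length with h0 | h0
    · refine ⟨T.z v - T.z u, fun i hi => ⟨1, one_pos, ?_⟩⟩
      simp [h0] at hi
      subst hi
      simp
    · refine ⟨E, fun i hi => ?_⟩
      rcases i with _ | i
      · rw [SimpleGraph.Walk.getVert_cons_succ, SimpleGraph.Walk.getVert_zero,
          SimpleGraph.Walk.getVert_zero]
        obtain ⟨r, hr, h1⟩ := hE 0 h0
        rw [SimpleGraph.Walk.getVert_zero] at h1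
        have hadj : T.graph.Adj v (q.getVert (0 + 1)) := by
          simpa using q.adj_getVert_succ h0
        obtain ⟨s, hs⟩ := hD' v (by simp) (q.getVert (0 + 1)) (by
          rw [SimpleGraph.Walk.support_cons]
          exact List.mem_cons_of_mem _ (q.getVert_mem_support _))
        obtain ⟨c, hc⟩ := hD' u (by simp) v (by simp)
        have hs0 : s ≠ 0 := fun h => hadj.ne' (T.z_injective (by
          rw [h, Complex.ofReal_zero, zero_mul, sub_eq_zero] at hs; exact hs))
        have hc0 : c ≠ 0 := fun h' => h.ne' (T.z_injective (by
          rw [h', Complex.ofReal_zero, zero_mul, sub_eq_zero] at hc; exact hc))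
        rw [zero_add] at hs h1 hadj
        have hcE : T.z v - T.z u = ((c / s * r : ℝ) : ℂ) * E := by
          have : (s : ℂ) ≠ 0 := Complex.ofReal_ne_zero.2 hs0
          push_cast
          rw [mul_assoc, ← h1, hs, hc]; field_simp
        rcases lt_or_gt_of_ne (div_ne_zero hc0 hs0) with hneg | hpos
        -- A change of sign would mean that the path turns back at `v` along the edge by which it
        -- came.
        · exfalso
          have := T.eq_of_dir_eq_smul (d := ⟨(v, q.getVert 1), hadj⟩) (e := ⟨(v, u), h.symm⟩) rfl
            (r := -(c / s)) (by linarith) (by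
              simp only [dir]
              rw [h1, ← neg_sub, hcE]; push_cast; ring)
          have h2 : q.getVert 1 = u := congrArg (fun d => d.snd) this
          exact hp.2 (h2 ▸ q.getVert_mem_support 1)
        · exact ⟨_, mul_pos hpos hr, hcE⟩
      · rw [SimpleGraph.Walk.getVert_cons_succ, SimpleGraph.Walk.getVert_cons_succ]
        exact hE i (by simpa using hi)

theorem edge_mem_iff {a b : V} {p : T.graph.Walk a b} {d : T.graph.Dart} :
    d.edge ∈ p.edges ↔ d.snd ∈ p.toSubgraph.neighborSet d.fst := by
  rw [← SimpleGraph.Walk.mem_edges_toSubgraph]; rfl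

variable {σ : Finset (Sym2 V)}

theorem IsSegmentBetween.symm {a b : V} (h : T.IsSegmentBetween a b σ) :
    T.IsSegmentBetween b a σ := by
  obtain ⟨hab, p, hp, hσ, hc⟩ := h
  exact ⟨hab.symm, p.reverse, hp.reverse, by simpa using hσ, by simpa using hc⟩

/-- The dart with which a path along a segment starts. -/
theorem exists_first_dart {a b : V} (hab : a ≠ b) {p : T.graph.Walk a b} (hp : p.IsPath)
    (hc : Collinear ℝ (T.pos '' {x | x ∈ p.support})) :
    ∃ d : T.graph.Dart, d.fst = a ∧ d.edge ∈ p.edges ∧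
      (∀ d' : T.graph.Dart, d'.fst = a → d'.edge ∈ p.edges → d' = d) ∧
      (∀ x ∈ p.support, ∃ r : ℝ, T.z x = T.z a + r * T.dir d) ∧
      ∃ r : ℝ, 0 < r ∧ T.z b - T.z a = r * T.dir d := by
  have hn : ¬ p.Nil := SimpleGraph.Walk.not_nil_of_ne hab
  have hlen : 0 < p.length := SimpleGraph.Walk.not_nil_iff_lt_length.1 hn
  have hnb := hp.neighborSet_toSubgraph_startpoint hn
  obtain ⟨D, hD⟩ := exists_steps hp hc
  have hpos : ∀ i, i + 1 ≤ p.length → ∃ r : ℝ, 0 < r ∧ T.z (p.getVert (i + 1)) - T.z a = r * D := by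
    intro i
    induction i with
    | zero => intro h; simpa using hD 0 h
    | succ i ih =>
      intro h
      obtain ⟨r, hr, h1⟩ := ih (by omega)
      obtain ⟨s, hs, h2⟩ := hD (i + 1) (by omega)
      refine ⟨s + r, by positivity, ?_⟩
      push_cast
      rw [add_mul, ← h1, ← h2]; ring
  obtain ⟨r, hr, h1⟩ := hpos 0 hlen
  have hr' : (r : ℂ) ≠ 0 := Complex.ofReal_ne_zero.2 hr.ne'
  let d : T.graph.Dart := ⟨(a, p.snd), p.adj_snd hn⟩
  have hd : T.dir d = r * D := h1
  have hsmul : ∀ s : ℝ, (s : ℂ) * D = ((s / r : ℝ) : ℂ) * T.dir d := by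
    intro s; rw [hd]; push_cast; field_simp
  refine ⟨d, rfl, edge_mem_iff.2 (by rw [hnb]; rfl), ?_, ?_, ?_⟩
  · intro d' hd' h
    refine T.eq_of_snd_eq hd' ?_
    rw [edge_mem_iff, hd', hnb] at h
    exact h
  · intro x hx
    obtain ⟨i, rfl, hi⟩ := SimpleGraph.Walk.mem_support_iff_exists_getVert.1 hx
    rcases i with _ | i
    · exact ⟨0, by simp⟩
    · obtain ⟨s, -, hs⟩ := hpos i hi
      refine ⟨s / r, ?_⟩
      rw [← hsmul, ← hs]; ring
  · obtain ⟨s, hs, h2⟩ := hpos (p.length - 1) (by omega)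
    rw [Nat.sub_add_cancel hlen, p.getVert_length] at h2
    exact ⟨s / r, by positivity, by rw [h2, hsmul]⟩

theorem IsSegmentBetween.exists_dart {a b : V} (h : T.IsSegmentBetween a b σ) :
    ∃ d : T.graph.Dart, d.fst = a ∧ d.edge ∈ σ ∧
      (∀ d' : T.graph.Dart, d'.fst = a → d'.edge ∈ σ → d' = d) ∧
      ∃ r : ℝ, 0 < r ∧ T.z b - T.z a = r * T.dir d := by
  obtain ⟨hab, p, hp, hσ, hc⟩ := h
  obtain ⟨d, h1, h2, h3, -, h4⟩ := exists_first_dart hab hp hc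
  exact ⟨d, h1, (hσ _).2 h2, fun d' h h' => h3 d' h ((hσ _).1 h'), h4⟩

/-- At a vertex other than its ends, a segment consists of two opposite edges. -/
theorem IsSegmentBetween.eq_or_exists_opposite {a b : V} (h : T.IsSegmentBetween a b σ)
    {d : T.graph.Dart} (hd : d.edge ∈ σ) : d.fst = a ∨ d.fst = b ∨
      ∃ d' : T.graph.Dart, d'.fst = d.fst ∧ d' ≠ d ∧ d'.edge ∈ σ ∧
        (∃ r : ℝ, 0 < r ∧ T.dir d' = -(r * T.dir d)) ∧
        ∀ e : T.graph.Dart, e.fst = d.fst → e.edge ∈ σ → e = d ∨ e = d' := by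
  obtain ⟨hab, p, hp, hσ, hc⟩ := h
  obtain ⟨D, hD⟩ := exists_steps hp hc
  have hsupp : d.fst ∈ p.support := p.fst_mem_support_of_mem_edges ((hσ _).1 hd)
  obtain ⟨i, hi, hil⟩ := SimpleGraph.Walk.mem_support_iff_exists_getVert.1 hsupp
  rcases Nat.eq_zero_or_pos i with rfl | h0
  · left; rw [← hi, p.getVert_zero]
  rcases hil.eq_or_lt with rfl | hlt
  · right; left; rw [← hi, p.getVert_length]
  right; right
  have hnb := hp.neighborSet_toSubgraph_internal h0.ne' hlt
  obtain ⟨k, rfl⟩ : ∃ k, i = k + 1 := ⟨i - 1, by omega⟩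
  rw [Nat.add_sub_cancel, hi] at hnb
  obtain ⟨r, hr, h1⟩ := hD k (by omega)
  obtain ⟨s, hs, h2⟩ := hD (k + 1) hlt
  rw [hi] at h1 h2
  have hr' : (r : ℂ) ≠ 0 := Complex.ofReal_ne_zero.2 hr.ne'
  have hs' : (s : ℂ) ≠ 0 := Complex.ofReal_ne_zero.2 hs.ne'
  have hmem : ∀ e : T.graph.Dart, e.fst = d.fst →
      (e.edge ∈ σ ↔ e.snd = p.getVert k ∨ e.snd = p.getVert (k + 1 + 1)) := by
    intro e he
    rw [hσ, edge_mem_iff, he, hnb]; rfl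
  have hadj1 : T.graph.Adj d.fst (p.getVert k) := by
    rw [← hi]; exact (p.adj_getVert_succ (by omega)).symm
  have hadj2 : T.graph.Adj d.fst (p.getVert (k + 1 + 1)) := by
    rw [← hi]; exact p.adj_getVert_succ hlt
  have hne : p.getVert k ≠ p.getVert (k + 1 + 1) := by
    intro h
    have := hp.getVert_injOn (by simp; omega) (by simp; omega) h
    omega
  rcases (hmem d rfl).1 hd with h | h
  · let d' : T.graph.Dart := ⟨(d.fst, p.getVert (k + 1 + 1)), hadj2⟩
    refine ⟨d', rfl, ?_, (hmem d' rfl).2 (Or.inr rfl), ⟨s / r, by positivity, ?_⟩, ?_⟩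
    · intro h'
      exact hne (h.symm.trans (congrArg (fun e => e.snd) h').symm)
    · simp only [dir, d', h]
      rw [h2, ← neg_sub, h1]; push_cast; field_simp
    · intro e he hσ'
      rcases (hmem e he).1 hσ' with h' | h'
      · exact Or.inl (T.eq_of_snd_eq he (h'.trans h.symm))
      · exact Or.inr (T.eq_of_snd_eq he h')
  · let d' : T.graph.Dart := ⟨(d.fst, p.getVert k), hadj1⟩
    refine ⟨d', rfl, ?_, (hmem d' rfl).2 (Or.inl rfl), ⟨r / s, by positivity, ?_⟩, ?_⟩
    · intro h'
      exact hne ((congrArg (fun e => e.snd) h').trans h)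
    · simp only [dir, d', h]
      rw [h2, ← neg_sub, h1]; push_cast; field_simp
    · intro e he hσ'
      rcases (hmem e he).1 hσ' with h' | h'
      · exact Or.inr (T.eq_of_snd_eq he h')
      · exact Or.inl (T.eq_of_snd_eq he (h'.trans h.symm))

/-- An end of a path has one edge of `σ`, an inner vertex two. Hence the endpoints depend on the
edge set only, not on the path chosen to represent it. -/
theorem IsSegmentBetween.isEndpoint_iff {a b v : V} (h : T.IsSegmentBetween a b σ) :
    T.IsEndpoint v σ ↔ v = a ∨ v = b := by
  constructor
  · rintro ⟨c, hc⟩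
    obtain ⟨d, rfl, hd, huniq, -⟩ := hc.exists_dart
    rcases h.eq_or_exists_opposite hd with h1 | h1 | ⟨d', h1, hne, h2, -⟩
    · exact Or.inl h1
    · exact Or.inr h1
    · exact absurd (huniq d' h1 h2) hne
  · rintro (rfl | rfl)
    · exact ⟨_, h⟩
    · exact ⟨_, h.symm⟩

theorem IsSegment.exists_dart_of_mem (h : T.IsSegment σ) {v : V} {e : Sym2 V} (he : e ∈ σ)
    (hv : v ∈ e) : ∃ d : T.graph.Dart, d.fst = v ∧ d.edge ∈ σ := by
  obtain ⟨a, b, -, p, -, hσ, -⟩ := h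
  obtain ⟨w, rfl⟩ := hv
  exact ⟨⟨(v, w), p.edges_subset_edgeSet ((hσ _).1 he)⟩, rfl, he⟩

theorem IsSegment.isEndpoint_or_exists_opposite (h : T.IsSegment σ) {d : T.graph.Dart}
    (hd : d.edge ∈ σ) : T.IsEndpoint d.fst σ ∨
      ∃ d' : T.graph.Dart, d'.fst = d.fst ∧ d' ≠ d ∧ d'.edge ∈ σ ∧
        (∃ r : ℝ, 0 < r ∧ T.dir d' = -(r * T.dir d)) ∧
        ∀ e : T.graph.Dart, e.fst = d.fst → e.edge ∈ σ → e = d ∨ e = d' := by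
  obtain ⟨a, b, h⟩ := h
  rw [h.isEndpoint_iff, or_assoc]
  exact h.eq_or_exists_opposite hd

theorem IsEndpoint.eq_of_edge_mem {v : V} (h : T.IsEndpoint v σ) {d d' : T.graph.Dart}
    (hd : d.fst = v) (hd' : d'.fst = v) (hσ : d.edge ∈ σ) (hσ' : d'.edge ∈ σ) : d = d' := by
  obtain ⟨b, h⟩ := h
  obtain ⟨e, -, -, h, -⟩ := h.exists_dart
  rw [h d hd hσ, h d' hd' hσ']

theorem IsSegment.exists_of_isInterior (h : T.IsSegment σ) {v : V} (hv : T.IsInterior v σ) :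
    ∃ d d' : T.graph.Dart, d.fst = v ∧ d'.fst = v ∧ d' ≠ d ∧ d.edge ∈ σ ∧ d'.edge ∈ σ ∧
      (∃ r : ℝ, 0 < r ∧ T.dir d' = -(r * T.dir d)) ∧
      ∀ e : T.graph.Dart, e.fst = v → e.edge ∈ σ → e = d ∨ e = d' := by
  obtain ⟨⟨e, he, hve⟩, hend⟩ := hv
  obtain ⟨d, rfl, hd⟩ := h.exists_dart_of_mem he hve
  obtain ⟨d', h1, h2, h3, h4, h5⟩ := (h.isEndpoint_or_exists_opposite hd).resolve_left hend
  exact ⟨d, d', rfl, h1, h2, hd, h3, h4, h5⟩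

theorem isInterior_of_ne {d d' : T.graph.Dart} (hne : d ≠ d') (hf : d'.fst = d.fst)
    (hd : d.edge ∈ σ) (hd' : d'.edge ∈ σ) : T.IsInterior d.fst σ :=
  ⟨⟨d.edge, hd, Sym2.mem_mk_left _ _⟩, fun h => hne (h.eq_of_edge_mem rfl hf hd hd')⟩

end PlaneTree

/-! ### Merging segments in a minimum partition. -/

namespace PlaneTree

variable {V : Type*} {T : PlaneTree V} {M : Finset (Finset (Sym2 V))} {σ τ : Finset (Sym2 V)}

theorem IsSegmentPartition.eq_of_mem (hM : T.IsSegmentPartition M) (hσ : σ ∈ M) (hτ : τ ∈ M)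
    {d : T.graph.Dart} (h : d.edge ∈ σ) (h' : d.edge ∈ τ) : σ = τ :=
  (hM.existsUnique_mem _ d.edge_mem).unique ⟨hσ, h⟩ ⟨hτ, h'⟩

/-- Two disjoint segments that leave a common endpoint in opposite directions form a segment. -/
theorem IsSegmentBetween.union [DecidableEq V] {v a b : V} (h : T.IsSegmentBetween v a σ)
    (h' : T.IsSegmentBetween v b τ) (hdisj : ∀ d : T.graph.Dart, d.edge ∈ σ → d.edge ∉ τ)
    {d d' : T.graph.Dart} (hd : d.fst = v) (hd' : d'.fst = v) (hσ : d.edge ∈ σ) (hτ : d'.edge ∈ τ)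
    {r : ℝ} (hr : T.dir d' = r * T.dir d) : T.IsSegmentBetween a b (σ ∪ τ) := by
  obtain ⟨hva, p, hp, hpσ, hc⟩ := h
  obtain ⟨hvb, q, hq, hqτ, hc'⟩ := h'
  obtain ⟨e, -, -, he, hpe, -⟩ := exists_first_dart hva hp hc
  obtain ⟨e', -, -, he', hqe, -⟩ := exists_first_dart hvb hq hc'
  obtain rfl := he d hd ((hpσ _).1 hσ)
  obtain rfl := he' d' hd' ((hqτ _).1 hτ)
  have hpath : (p.reverse.append q).IsPath := by
    -- In an acyclic graph a walk without repeated edges is a path, so disjointness of the edge sets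
    -- suffices.
    rw [T.isTree.2.isPath_iff_isTrail, SimpleGraph.Walk.isTrail_def, SimpleGraph.Walk.edges_append,
      SimpleGraph.Walk.edges_reverse, List.nodup_append, List.nodup_reverse]
    refine ⟨hp.isTrail.edges_nodup, hq.isTrail.edges_nodup, ?_⟩
    rintro x hx _ hy rfl
    rw [List.mem_reverse] at hx
    have hx' := p.edges_subset_edgeSet hx
    induction x with
    | _ u w => exact hdisj ⟨(u, w), hx'⟩ ((hpσ _).2 hx) ((hqτ _).2 hy)
  refine ⟨?_, _, hpath, ?_, ?_⟩
  · rintro rfl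
    have h0 := SimpleGraph.Walk.length_eq_zero_iff.2 (SimpleGraph.Walk.isPath_iff_nil.1 hpath)
    rw [SimpleGraph.Walk.length_append] at h0
    exact hvb (SimpleGraph.Walk.eq_of_length_eq_zero (p := q) (by omega))
  · intro x
    rw [Finset.mem_union, SimpleGraph.Walk.edges_append, SimpleGraph.Walk.edges_reverse,
      List.mem_append, List.mem_reverse, hpσ, hqτ]
  · refine (collinear_iff_of_mem (a := v) ?_).2 ⟨T.dir d, ?_⟩
    · simp
    · intro x hx
      simp only [SimpleGraph.Walk.mem_support_append_iff, SimpleGraph.Walk.support_reverse,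
        List.mem_reverse, Set.mem_ofPred_eq] at hx
      rcases hx with hx | hx
      · exact hpe x hx
      · obtain ⟨s, hs⟩ := hqe x hx
        exact ⟨s * r, by rw [hs, hr]; push_cast; ring⟩

/-- In a partition without crossings, replacing two segments by their union gives a partition of
the same kind if the union is a segment whose new interior vertex is in the interior of no other
segment. -/
theorem IsSegmentPartition.insert_union [DecidableEq V] (hM : T.IsSegmentPartition M)
    (hσ : σ ∈ M) (hτ : τ ∈ M) {v a b : V} (h : T.IsSegmentBetween v a σ)
    (h' : T.IsSegmentBetween v b τ) (hu : T.IsSegmentBetween a b (σ ∪ τ))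
    (hv : ∀ ρ ∈ M, ¬ T.IsInterior v ρ) :
    T.IsSegmentPartition (insert (σ ∪ τ) ((M.erase σ).erase τ)) := by
  have hmem : ∀ ρ, ρ ∈ insert (σ ∪ τ) ((M.erase σ).erase τ) ↔
      ρ = σ ∪ τ ∨ ρ ≠ τ ∧ ρ ≠ σ ∧ ρ ∈ M := by
    intro ρ; rw [Finset.mem_insert, Finset.mem_erase, Finset.mem_erase]
  -- Apart from the junction `v`, an interior vertex of the union is interior to one of the two
  -- parts.
  have hcross : ∀ ρ ∈ M, ρ ≠ τ → ρ ≠ σ → ∀ x, T.IsInterior x (σ ∪ τ) → ¬ T.IsInterior x ρ := by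
    rintro ρ hρ hρτ hρσ x ⟨⟨e, he, hxe⟩, hend⟩ hx
    rw [hu.isEndpoint_iff, not_or] at hend
    rcases Finset.mem_union.1 he with he | he
    · refine hM.not_cross σ hσ ρ hρ hρσ.symm ⟨x, ⟨⟨e, he, hxe⟩, ?_⟩, hx⟩
      rw [h.isEndpoint_iff, not_or]
      exact ⟨fun hxv => hv ρ hρ (hxv ▸ hx), hend.1⟩
    · refine hM.not_cross τ hτ ρ hρ hρτ.symm ⟨x, ⟨⟨e, he, hxe⟩, ?_⟩, hx⟩
      rw [h'.isEndpoint_iff, not_or]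
      exact ⟨fun hxv => hv ρ hρ (hxv ▸ hx), hend.2⟩
  refine ⟨?_, ?_, ?_⟩
  · intro ρ hρ
    rcases (hmem ρ).1 hρ with rfl | ⟨-, -, hρ⟩
    · exact ⟨a, b, hu⟩
    · exact hM.isSegment ρ hρ
  · intro e he
    obtain ⟨ρ, ⟨hρ, heρ⟩, huniq⟩ := hM.existsUnique_mem e he
    by_cases hc : ρ = σ ∨ ρ = τ
    · refine ⟨σ ∪ τ, ⟨(hmem _).2 (Or.inl rfl), ?_⟩, ?_⟩
      · rcases hc with rfl | rfl
        · exact Finset.mem_union_left _ heρ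
        · exact Finset.mem_union_right _ heρ
      · rintro ρ' ⟨hρ', he'⟩
        rcases (hmem _).1 hρ' with rfl | ⟨h1, h2, h3⟩
        · rfl
        · have := huniq ρ' ⟨h3, he'⟩
          rcases hc with rfl | rfl
          · exact absurd this h2
          · exact absurd this h1
    · rw [not_or] at hc
      refine ⟨ρ, ⟨(hmem _).2 (Or.inr ⟨hc.2, hc.1, hρ⟩), heρ⟩, ?_⟩
      rintro ρ' ⟨hρ', he'⟩
      rcases (hmem _).1 hρ' with rfl | ⟨h1, h2, h3⟩
      · rcases Finset.mem_union.1 he' with he' | he'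
        · exact absurd (huniq σ ⟨hσ, he'⟩).symm hc.1
        · exact absurd (huniq τ ⟨hτ, he'⟩).symm hc.2
      · exact huniq ρ' ⟨h3, he'⟩
  · intro ρ hρ ρ' hρ' hne
    rcases (hmem _).1 hρ with rfl | ⟨h1, h2, h3⟩ <;> rcases (hmem _).1 hρ' with rfl | ⟨h1', h2',
        h3'⟩
    · exact absurd rfl hne
    · rintro ⟨x, hx, hx'⟩
      exact hcross ρ' h3' h1' h2' x hx hx'
    · rintro ⟨x, hx, hx'⟩
      exact hcross ρ h3 h1 h2 x hx' hx
    · exact hM.not_cross ρ h3 ρ' h3' hne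

variable [Finite V]

/-- In a minimum partition, the two edges that bound a straight corner belong to the same
segment. -/
theorem IsMinimumSegmentPartition.rot_edge_mem (hM : T.IsMinimumSegmentPartition M) (hσ : σ ∈ M)
    {d : T.graph.Dart} (hd : d.edge ∈ σ) (hang : T.ang d = Real.pi) : (T.rot d).edge ∈ σ := by
  classical
  obtain ⟨r, hr, hrot⟩ := exists_dir_rot hang
  obtain ⟨τ, ⟨hτ, hdτ⟩, -⟩ := hM.1.existsUnique_mem _ (T.rot d).edge_mem
  by_contra hnot
  have hne : σ ≠ τ := fun h => hnot (h ▸ hdτ)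
  have hf := T.rot_fst d
  -- If `σ` passed through, it would continue opposite to `d`, that is, along `T.rot d`. The same
  -- reasoning shows that `τ` ends here.
  have hendσ : T.IsEndpoint d.fst σ := by
    refine ((hM.1.isSegment σ hσ).isEndpoint_or_exists_opposite hd).resolve_right ?_
    rintro ⟨e, he, -, heσ, ⟨s, hs, h1⟩, -⟩
    have := T.eq_of_dir_eq_smul (d := e) (e := T.rot d) (he.trans hf.symm) (r := r / s)
      (by positivity) (by
        have : (s : ℂ) ≠ 0 := Complex.ofReal_ne_zero.2 hs.ne'
        rw [h1, hrot]; push_cast; field_simp)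
    exact hnot (this ▸ heσ)
  have hendτ : T.IsEndpoint d.fst τ := by
    rw [← hf]
    refine ((hM.1.isSegment τ hτ).isEndpoint_or_exists_opposite hdτ).resolve_right ?_
    rintro ⟨e, he, -, heτ, ⟨s, hs, h1⟩, -⟩
    have := T.eq_of_dir_eq_smul (d := d) (e := e) (hf.symm.trans he.symm) (r := s * r)
      (by positivity) (by rw [h1, hrot]; push_cast; ring)
    exact hne (hM.1.eq_of_mem hσ hτ hd (this ▸ heτ))
  -- No dart points into the straight corner. The two opposite darts of a segment passing through
  -- therefore lie on the line of `d`, so they are `d` and `T.rot d`, whose segments end here.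
  have hv : ∀ ρ ∈ M, ¬ T.IsInterior d.fst ρ := by
    intro ρ hρ hint
    obtain ⟨e, e', he, he', hee', heρ, heρ', ⟨s, hs, h1⟩, -⟩ :=
      (hM.1.isSegment ρ hρ).exists_of_isInterior hint
    have him : ∀ f : T.graph.Dart, f.fst = d.fst → (T.dir f / T.dir d).im ≤ 0 := fun f hf' => by
      by_contra hpos
      exact absurd (turn_lt_pi_iff.2 (not_le.1 hpos)) (not_lt.2 (hang ▸ T.ang_le hf'))
    have him0 : (T.dir e / T.dir d).im = 0 := by
      have h2 := him e' he'
      rw [h1, neg_div, mul_div_assoc, Complex.neg_im, Complex.im_ofReal_mul] at h2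
      exact le_antisymm (him e he) (by nlinarith)
    have hre : T.dir e = ((T.dir e / T.dir d).re : ℂ) * T.dir d := by
      rw [eq_comm, ← eq_div_iff (T.dir_ne_zero d)]
      exact Complex.ext (by simp) (by simp [him0])
    rcases lt_trichotomy (T.dir e / T.dir d).re 0 with h0 | h0 | h0
    · have := T.eq_of_dir_eq_smul (d := T.rot d) (e := e) (hf.trans he.symm)
        (r := -(T.dir e / T.dir d).re / r) (div_pos (neg_pos.2 h0) hr) (by
          have : (r : ℂ) ≠ 0 := Complex.ofReal_ne_zero.2 hr.ne'
          rw [hrot]; nth_rewrite 1 [hre]; push_cast; field_simp)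
      obtain rfl := hM.1.eq_of_mem hτ hρ hdτ (this ▸ heρ)
      exact hint.2 hendτ
    · rw [h0, Complex.ofReal_zero, zero_mul] at hre
      exact T.dir_ne_zero e hre
    · have := T.eq_of_dir_eq_smul (d := d) (e := e) he.symm h0 hre
      obtain rfl := hM.1.eq_of_mem hσ hρ hd (this ▸ heρ)
      exact hint.2 hendσ
  obtain ⟨a, ha⟩ := hendσ
  obtain ⟨b, hb⟩ := hendτ
  have hu := ha.union hb (fun f h h' => hne (hM.1.eq_of_mem hσ hτ h h')) rfl hf hd hdτ (r := -r)
    (by rw [hrot]; push_cast; ring)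
  -- The merged partition has one segment fewer, against minimality.
  have h1 := hM.2 _ (hM.1.insert_union hσ hτ ha hb hu hv)
  have h2 := Finset.card_insert_le (σ ∪ τ) ((M.erase σ).erase τ)
  rw [Finset.card_erase_of_mem (Finset.mem_erase.2 ⟨hne.symm, hτ⟩),
    Finset.card_erase_of_mem hσ] at h2
  have h3 : 1 < M.card := Finset.one_lt_card.2 ⟨σ, hσ, τ, hτ, hne⟩
  omega

end PlaneTree

/-! ### Opposite sides of a line in complex coordinates. -/

section Sides

theorem mul_neg_iff_of_left_pos {r x : ℝ} (hr : 0 < r) : r * x < 0 ↔ x < 0 :=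
  ⟨fun h => (pos_iff_neg_of_mul_neg h).1 hr, mul_neg_of_pos_of_neg hr⟩

variable {p q : Plane} {u D : ℂ}

theorem mem_line_iff (hD : D ≠ 0) (hpq : p ≠ q) (hp : ∃ r : ℝ, toC p = u + r * D)
    (hq : ∃ r : ℝ, toC q = u + r * D) (x : Plane) :
    x ∈ line[ℝ, p, q] ↔ ((toC x - u) / D).im = 0 := by
  obtain ⟨a, ha⟩ := hp
  obtain ⟨b, hb⟩ := hq
  have hmap : ∀ t : ℝ, toC (AffineMap.lineMap p q t) = u + ((a + t * (b - a) : ℝ) : ℂ) * D := by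
    intro t
    rw [AffineMap.lineMap_apply, vsub_eq_sub, vadd_eq_add, map_add, map_smul, map_sub,
      Complex.real_smul, ha, hb]
    push_cast; ring
  rw [mem_affineSpan_pair_iff_exists_lineMap_eq]
  constructor
  · rintro ⟨t, rfl⟩
    rw [hmap, add_sub_cancel_left, mul_div_assoc, div_self hD, mul_one, Complex.ofReal_im]
  · intro h
    have hab : b - a ≠ 0 := fun h0 => hpq (toC.injective (by rw [ha, hb, sub_eq_zero.1 h0]))
    refine ⟨(((toC x - u) / D).re - a) / (b - a), toC.injective ?_⟩
    rw [hmap, div_mul_cancel₀ _ hab, add_sub_cancel,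
      show ((((toC x - u) / D).re : ℝ) : ℂ) = (toC x - u) / D from
        Complex.ext (by simp) (by simp [h]), div_mul_cancel₀ _ hD, add_sub_cancel]

theorem sOppSide_iff (hD : D ≠ 0) (hpq : p ≠ q) (hp : ∃ r : ℝ, toC p = u + r * D)
    (hq : ∃ r : ℝ, toC q = u + r * D) (x y : Plane) :
    line[ℝ, p, q].SOppSide x y ↔ ((toC x - u) / D).im * ((toC y - u) / D).im < 0 := by
  rw [AffineSubspace.SOppSide, AffineSubspace.wOppSide_iff_exists_wbtw, mem_line_iff hD hpq hp hq,
    mem_line_iff hD hpq hp hq]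
  have hmap : ∀ t : ℝ, ((toC (AffineMap.lineMap x y t) - u) / D).im =
      (1 - t) * ((toC x - u) / D).im + t * ((toC y - u) / D).im := by
    intro t
    rw [← Complex.im_ofReal_mul, ← Complex.im_ofReal_mul, ← Complex.add_im]
    congr 1
    rw [AffineMap.lineMap_apply, vsub_eq_sub, vadd_eq_add, map_add, map_smul, map_sub,
      Complex.real_smul]
    push_cast; ring
  constructor
  · rintro ⟨⟨w, hw, t, ⟨h0, h1⟩, rfl⟩, hx, hy⟩
    rw [mem_line_iff hD hpq hp hq, hmap] at hw
    generalize ((toC x - u) / D).im = g at *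
    generalize ((toC y - u) / D).im = h at *
    by_contra hneg
    have h2 : 0 < g * h := lt_of_le_of_ne (not_lt.1 hneg) (mul_ne_zero hx hy).symm
    have h3 : (1 - t) * g ^ 2 + t * (g * h) = 0 := by linear_combination g * hw
    have h4 : 0 < g ^ 2 := by positivity
    rcases h0.eq_or_lt with rfl | h0
    · linarith
    · nlinarith [mul_pos h0 h2, mul_nonneg (sub_nonneg.2 h1) h4.le]
  · intro hneg
    -- The parameter at which the height, affine along the segment from `x` to `y`, vanishes.
    refine ⟨⟨AffineMap.lineMap x y
      (((toC x - u) / D).im / (((toC x - u) / D).im - ((toC y - u) / D).im)), ?_, ?_⟩, ?_, ?_⟩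
    · rw [mem_line_iff hD hpq hp hq, hmap]
      have : ((toC x - u) / D).im - ((toC y - u) / D).im ≠ 0 := fun h => by
        rw [sub_eq_zero.1 h] at hneg
        exact absurd hneg (not_lt.2 (mul_self_nonneg _))
      field_simp; ring
    · refine ⟨_, ?_, rfl⟩
      generalize ((toC x - u) / D).im = g at *
      generalize ((toC y - u) / D).im = h at *
      rcases mul_neg_iff.1 hneg with ⟨h1, h2⟩ | ⟨h1, h2⟩
      · exact ⟨div_nonneg h1.le (by linarith), (div_le_one (by linarith)).2 (by linarith)⟩
      · exact ⟨div_nonneg_of_nonpos h1.le (by linarith),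
          (div_le_one_of_neg (by linarith)).2 (by linarith)⟩
    · exact fun h => by simp [h] at hneg
    · exact fun h => by simp [h] at hneg

end Sides

/-! ### Counting the proper corners. -/

namespace PlaneTree

variable {V : Type*} {T : PlaneTree V} {M : Finset (Finset (Sym2 V))} {σ τ : Finset (Sym2 V)}

theorem IsSegmentBetween.exists_eq_add_mul_dir {a b : V} (h : T.IsSegmentBetween a b σ)
    {d : T.graph.Dart} (hd : d.edge ∈ σ) : ∃ r : ℝ, T.z a = T.z d.fst + r * T.dir d := by
  obtain ⟨hab, p, hp, hσ, hc⟩ := h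
  have hd' := (hσ _).1 hd
  obtain ⟨D, hD⟩ := (collinear_iff_of_mem (T := T) (a := d.fst)
    (p.fst_mem_support_of_mem_edges hd')).1 hc
  obtain ⟨r, hr⟩ := hD a p.start_mem_support
  obtain ⟨s, hs⟩ := hD d.snd (p.snd_mem_support_of_mem_edges hd')
  have hdir : T.dir d = s * D := by rw [dir, hs]; ring
  have hs0 : (s : ℂ) ≠ 0 := fun h => T.dir_ne_zero d (by rw [hdir, h, zero_mul])
  refine ⟨r / s, ?_⟩
  rw [hr, hdir]; push_cast; field_simp

theorem IsSegmentPartition.exists_mem (hM : T.IsSegmentPartition M) (d : T.graph.Dart) :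
    ∃ σ ∈ M, d.edge ∈ σ :=
  (hM.existsUnique_mem _ d.edge_mem).exists

variable (T M) in
/-- The darts at a vertex whose segment ends there. -/
def ending (v : V) : Set T.graph.Dart :=
  {d | d.fst = v ∧ ∀ σ ∈ M, d.edge ∈ σ → T.IsEndpoint v σ}

open Classical in
-- Each dart belongs to one segment, and a segment ending at `v` has exactly one dart there.
theorem IsSegmentPartition.ncard_ending (hM : T.IsSegmentPartition M) (v : V) :
    (T.ending M v).ncard = (M.filter fun σ => T.IsEndpoint v σ).card := by
  choose f hfM hf using hM.exists_mem
  rw [← Set.ncard_coe_finset]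
  refine Set.ncard_congr (fun d _ => f d) ?_ ?_ ?_
  · rintro d ⟨hd, h⟩
    simpa using ⟨hfM d, h _ (hfM d) (hf d)⟩
  · rintro d d' ⟨hd, h⟩ ⟨hd', -⟩ (heq : f d = f d')
    exact (h _ (hfM d) (hf d)).eq_of_edge_mem hd hd' (hf d) (heq ▸ hf d')
  · intro σ hσ
    simp only [Finset.coe_filter, Set.mem_ofPred_eq] at hσ
    obtain ⟨b, hb⟩ := hσ.2
    obtain ⟨d, hd, hdσ, -⟩ := hb.exists_dart
    refine ⟨d, ⟨hd, fun τ hτ hdτ => ?_⟩, hM.eq_of_mem (hfM d) hσ.1 (hf d) hdσ⟩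
    rw [hM.eq_of_mem hτ hσ.1 hdτ hdσ]
    exact hσ.2

theorem isInterior_of_not_isEndpoint {d : T.graph.Dart} (hd : d.edge ∈ σ)
    (h : ¬ T.IsEndpoint d.fst σ) : T.IsInterior d.fst σ :=
  ⟨⟨d.edge, hd, Sym2.mem_mk_left _ _⟩, h⟩

variable (T) in
/-- The darts `d` and `d'` are the two opposite darts of `σ` at an interior vertex of `σ`. -/
structure IsThrough (σ : Finset (Sym2 V)) (d d' : T.graph.Dart) : Prop where
  fst_eq : d'.fst = d.fst
  ne : d' ≠ d
  mem : d.edge ∈ σ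
  mem' : d'.edge ∈ σ
  opposite : ∃ r : ℝ, 0 < r ∧ T.dir d' = -(r * T.dir d)
  eq_or_eq : ∀ e : T.graph.Dart, e.fst = d.fst → e.edge ∈ σ → e = d ∨ e = d'

namespace IsThrough

variable {d d' : T.graph.Dart}

theorem symm (h : T.IsThrough σ d d') : T.IsThrough σ d' d where
  fst_eq := h.fst_eq.symm
  ne := h.ne.symm
  mem := h.mem'
  mem' := h.mem
  opposite := by
    obtain ⟨r, hr, h1⟩ := h.opposite
    have : (r : ℂ) ≠ 0 := Complex.ofReal_ne_zero.2 hr.ne'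
    exact ⟨r⁻¹, inv_pos.2 hr, by rw [h1]; push_cast; field_simp⟩
  eq_or_eq e he heσ := (h.eq_or_eq e (he.trans h.fst_eq) heσ).symm

theorem isInterior (h : T.IsThrough σ d d') : T.IsInterior d.fst σ :=
  isInterior_of_ne h.ne.symm h.fst_eq h.mem h.mem'

/-- By noncrossing, `σ` is the only segment passing through the vertex, so every other dart there
belongs to a segment that ends. -/
theorem mem_ending_iff (h : T.IsThrough σ d d') (hM : T.IsSegmentPartition M) (hσ : σ ∈ M)
    {c : T.graph.Dart} (hc : c.fst = d.fst) : c ∈ T.ending M d.fst ↔ c ≠ d ∧ c ≠ d' := by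
  constructor
  · rintro ⟨-, h1⟩
    constructor
    · rintro rfl
      exact h.isInterior.2 (h1 σ hσ h.mem)
    · rintro rfl
      exact h.isInterior.2 (h1 σ hσ h.mem')
  · rintro ⟨h1, h2⟩
    refine ⟨hc, fun τ hτ hcτ => by_contra fun hend => ?_⟩
    refine hM.not_cross σ hσ τ hτ ?_
      ⟨d.fst, h.isInterior, hc ▸ isInterior_of_not_isEndpoint hcτ (hc.symm ▸ hend)⟩
    rintro rfl
    rcases h.eq_or_eq c hc hcτ with h' | h'
    · exact h1 h'
    · exact h2 h'

theorem im_div_eq (h : T.IsThrough σ d d') : ∃ r : ℝ, 0 < r ∧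
    ∀ y : ℂ, (y / T.dir d').im = -(r * (y / T.dir d).im) := by
  obtain ⟨r, hr, h1⟩ := h.opposite
  refine ⟨r⁻¹, inv_pos.2 hr, fun y => ?_⟩
  rw [← Complex.im_ofReal_mul, ← Complex.neg_im]
  congr 1
  rw [h1, div_neg, div_mul_eq_div_div_swap, Complex.ofReal_inv, div_eq_inv_mul]

theorem ne_of_im_ne_zero (h : T.IsThrough σ d d') {c : T.graph.Dart}
    (hc : (T.dir c / T.dir d).im ≠ 0) : c ≠ d ∧ c ≠ d' := by
  constructor
  · rintro rfl
    simp [div_self (T.dir_ne_zero c)] at hc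
  · rintro rfl
    obtain ⟨r, hr, h1⟩ := h.opposite
    simp [h1, neg_div, mul_div_assoc, div_self (T.dir_ne_zero d)] at hc

theorem im_ne_zero (h : T.IsThrough σ d d') {c : T.graph.Dart} (hc : c.fst = d.fst)
    (hcd : c ≠ d) (hcd' : c ≠ d') : (T.dir c / T.dir d).im ≠ 0 := by
  intro h0
  rcases turn_of_im_eq_zero (T.dir_ne_zero d) (T.dir_ne_zero c) h0 with h1 | h1
  · obtain ⟨s, hs, h2⟩ := (turn_eq_pi_iff (T.dir_ne_zero d) (T.dir_ne_zero c)).1 h1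
    obtain ⟨r, hr, h3⟩ := h.opposite
    refine hcd' (T.eq_of_dir_eq_smul (d := d') (e := c) (h.fst_eq.trans hc.symm) (r := s / r)
      (by positivity) ?_).symm
    have : (r : ℂ) ≠ 0 := Complex.ofReal_ne_zero.2 hr.ne'
    rw [h2, h3]; push_cast; field_simp
  · exact (T.turn_dir_lt hc.symm hcd.symm).ne h1

theorem eq_of_isInterior (h : T.IsThrough σ d d') (hM : T.IsSegmentPartition M) (hσ : σ ∈ M)
    (hτ : τ ∈ M) (hv : T.IsInterior d.fst τ) : τ = σ :=
  by_contra fun hne => hM.not_cross τ hτ σ hσ hne ⟨_, hv, h.isInterior⟩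

theorem exists_isSegmentBetween (h : T.IsThrough σ d d') (hM : T.IsSegmentPartition M)
    (hσ : σ ∈ M) {c : T.graph.Dart} (hc : c.fst = d.fst) (him : (T.dir c / T.dir d).im ≠ 0) :
    ∃ τ ∈ M, ∃ b, T.IsSegmentBetween d.fst b τ ∧ ∃ r : ℝ, 0 < r ∧
      ((T.z b - T.z d.fst) / T.dir d).im = r * (T.dir c / T.dir d).im := by
  obtain ⟨τ, hτ, hcτ⟩ := hM.exists_mem c
  obtain ⟨b, hb⟩ := ((h.mem_ending_iff hM hσ hc).2 (h.ne_of_im_ne_zero him)).2 τ hτ hcτ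
  obtain ⟨e, -, -, huniq, r, hr, h1⟩ := hb.exists_dart
  refine ⟨τ, hτ, b, hb, r, hr, ?_⟩
  rw [h1, ← huniq c hc hcτ, mul_div_assoc, Complex.im_ofReal_mul]

variable [Finite V]

/-- The opposite dart bounds the corner by π, so the corner is proper exactly when some dart lies
strictly to the left of `d`. -/
theorem mem_kept_iff (h : T.IsThrough σ d d') :
    d ∈ T.kept ↔ ∃ c : T.graph.Dart, c.fst = d.fst ∧ 0 < (T.dir c / T.dir d).im := by
  have hpi : turn (T.dir d) (T.dir d') = Real.pi :=
    (turn_eq_pi_iff (T.dir_ne_zero _) (T.dir_ne_zero _)).2 h.opposite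
  constructor
  · intro hd
    exact ⟨T.rot d, T.rot_fst d, turn_lt_pi_iff.1 (lt_of_le_of_ne (hpi ▸ T.ang_le h.fst_eq) hd)⟩
  · rintro ⟨c, hc, him⟩
    exact ((T.ang_le hc).trans_lt (turn_lt_pi_iff.2 him)).ne

theorem mem_kept_iff' (h : T.IsThrough σ d d') :
    d' ∈ T.kept ↔ ∃ c : T.graph.Dart, c.fst = d.fst ∧ (T.dir c / T.dir d).im < 0 := by
  obtain ⟨r, hr, him⟩ := h.im_div_eq
  rw [h.symm.mem_kept_iff]
  refine exists_congr fun c => ?_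
  rw [h.fst_eq, him, Left.neg_pos_iff, mul_neg_iff_of_left_pos hr]

/-- The corners of `d` and `d'` are those following the two darts of `σ`, one on each side of it,
and a side is proper when an edge is attached there. With `isTwoSidedFork_iff` this makes the
multiplicity the number of kept darts among `d` and `d'`. -/
theorem isFork_iff (h : T.IsThrough σ d d') (hM : T.IsSegmentPartition M) (hσ : σ ∈ M) :
    T.IsFork M d.fst ↔ d ∈ T.kept ∨ d' ∈ T.kept := by
  rw [h.mem_kept_iff, h.mem_kept_iff', ← exists_or]
  constructor
  · rintro ⟨ρ, hρ, hint, τ, hτ, hne, b, hb⟩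
    obtain rfl := h.eq_of_isInterior hM hσ hρ hint
    obtain ⟨c, hc, hcτ, -⟩ := hb.exists_dart
    have him := h.im_ne_zero hc (by rintro rfl; exact hne (hM.eq_of_mem hτ hσ hcτ h.mem))
      (by rintro rfl; exact hne (hM.eq_of_mem hτ hσ hcτ h.mem'))
    rcases lt_or_gt_of_ne him with h1 | h1
    · exact ⟨c, Or.inr ⟨hc, h1⟩⟩
    · exact ⟨c, Or.inl ⟨hc, h1⟩⟩
  · rintro ⟨c, hc⟩
    rw [← and_or_left] at hc
    have hcd := h.ne_of_im_ne_zero (c := c) (by rcases hc.2 with h | h; exacts [h.ne', h.ne])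
    obtain ⟨τ, hτ, hcτ⟩ := hM.exists_mem c
    refine ⟨σ, hσ, h.isInterior, τ, hτ, ?_, ((h.mem_ending_iff hM hσ hc.1).2 hcd).2 τ hτ hcτ⟩
    rintro rfl
    rcases h.eq_or_eq c hc.1 hcτ with h' | h'
    exacts [hcd.1 h', hcd.2 h']

theorem isTwoSidedFork_iff (h : T.IsThrough σ d d') (hM : T.IsSegmentPartition M) (hσ : σ ∈ M) :
    T.IsTwoSidedFork M d.fst ↔ d ∈ T.kept ∧ d' ∈ T.kept := by
  rw [h.mem_kept_iff, h.mem_kept_iff']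
  have hopp : ∀ a b c e : V, T.IsSegmentBetween a b σ →
      (line[ℝ, T.pos a, T.pos b].SOppSide (T.pos c) (T.pos e) ↔
        ((T.z c - T.z d.fst) / T.dir d).im * ((T.z e - T.z d.fst) / T.dir d).im < 0) :=
    fun a b c e hab => sOppSide_iff (T.dir_ne_zero d) (T.pos_injective.ne hab.1)
      (hab.exists_eq_add_mul_dir h.mem) (hab.symm.exists_eq_add_mul_dir h.mem) _ _
  constructor
  · rintro ⟨ρ, hρ, hint, a, b, hab, τ₁, hτ₁, τ₂, hτ₂, c, e, hc, he, hside⟩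
    obtain rfl := h.eq_of_isInterior hM hσ hρ hint
    rw [hopp a b c e hab] at hside
    obtain ⟨f, hf, -, -, r, hr, hfr⟩ := hc.exists_dart
    obtain ⟨g, hg, -, -, s, hs, hgs⟩ := he.exists_dart
    rw [hfr, hgs, mul_div_assoc, mul_div_assoc, Complex.im_ofReal_mul, Complex.im_ofReal_mul,
      mul_neg_iff, mul_pos_iff_of_pos_left hr, mul_pos_iff_of_pos_left hs,
      mul_neg_iff_of_left_pos hr, mul_neg_iff_of_left_pos hs] at hside
    rcases hside with ⟨h1, h2⟩ | ⟨h1, h2⟩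
    · exact ⟨⟨f, hf, h1⟩, ⟨g, hg, h2⟩⟩
    · exact ⟨⟨g, hg, h2⟩, ⟨f, hf, h1⟩⟩
  · rintro ⟨⟨f, hf, h1⟩, ⟨g, hg, h2⟩⟩
    obtain ⟨τ₁, hτ₁, c, hc, r, hr, hcr⟩ := h.exists_isSegmentBetween hM hσ hf h1.ne'
    obtain ⟨τ₂, hτ₂, e, he, s, hs, hes⟩ := h.exists_isSegmentBetween hM hσ hg h2.ne
    obtain ⟨a, b, hab⟩ := hM.isSegment σ hσ
    refine ⟨σ, hσ, h.isInterior, a, b, hab, τ₁, hτ₁, τ₂, hτ₂, c, e, hc, he, ?_⟩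
    rw [hopp a b c e hab, hcr, hes]
    exact mul_neg_of_pos_of_neg (mul_pos hr h1) (mul_neg_of_pos_of_neg hs h2)

end IsThrough

theorem IsSegment.exists_isThrough (h : T.IsSegment σ) {v : V} (hv : T.IsInterior v σ) :
    ∃ d d' : T.graph.Dart, d.fst = v ∧ T.IsThrough σ d d' := by
  obtain ⟨d, d', rfl, h1, h2, h3, h4, h5, h6⟩ := h.exists_of_isInterior hv
  exact ⟨d, d', rfl, h1, h2, h3, h4, h5, h6⟩

variable [Finite V]

theorem rot_ne_of_ang_eq_pi {d : T.graph.Dart} (h : T.ang d = Real.pi) : T.rot d ≠ d := by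
  rw [Ne, rot_eq_self_iff, h]
  linarith [Real.pi_pos]

/-- The corners of a segment partition at the end of a segment are not straight. -/
theorem IsMinimumSegmentPartition.ending_subset_kept (hM : T.IsMinimumSegmentPartition M) (v : V) :
    T.ending M v ⊆ T.kept := by
  rintro d ⟨rfl, hd⟩ hang
  obtain ⟨σ, hσ, hdσ⟩ := hM.1.exists_mem d
  exact rot_ne_of_ang_eq_pi hang
    ((hd σ hσ hdσ).eq_of_edge_mem (T.rot_fst d) rfl (hM.rot_edge_mem hσ hdσ hang) hdσ)

/-- The number of proper corners at a vertex. -/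
theorem IsMinimumSegmentPartition.ncard_kept_at (hM : T.IsMinimumSegmentPartition M) (v : V) :
    {d | d.fst = v ∧ d ∈ T.kept}.ncard = (T.ending M v).ncard + T.forkMultiplicity M v := by
  classical
  by_cases hv : ∃ σ ∈ M, T.IsInterior v σ
  · obtain ⟨σ, hσ, hv⟩ := hv
    obtain ⟨d, d', rfl, h⟩ := (hM.1.isSegment σ hσ).exists_isThrough hv
    -- Darts of ending segments are always kept; the two darts of the segment passing through
    -- account for the multiplicity.
    have hset : {c | c.fst = d.fst ∧ c ∈ T.kept} =
        T.ending M d.fst ∪ ({d, d'} ∩ T.kept) := by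
      ext c
      simp only [Set.mem_union, Set.mem_inter_iff, Set.mem_insert_iff, Set.mem_singleton_iff,
        Set.mem_ofPred_eq]
      constructor
      · rintro ⟨hc, hk⟩
        rw [h.mem_ending_iff hM.1 hσ hc]
        tauto
      · rintro (hc | ⟨rfl | rfl, hk⟩)
        · exact ⟨hc.1, hM.ending_subset_kept _ hc⟩
        · exact ⟨rfl, hk⟩
        · exact ⟨h.fst_eq, hk⟩
    rw [hset, Set.ncard_union_eq]
    · congr 1
      rw [forkMultiplicity, h.isTwoSidedFork_iff hM.1 hσ, h.isFork_iff hM.1 hσ]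
      by_cases h1 : d ∈ T.kept <;> by_cases h2 : d' ∈ T.kept
      · rw [Set.inter_eq_left.2 (by rintro x (rfl | rfl) <;> assumption), Set.ncard_pair h.ne.symm]
        simp [h1, h2]
      · rw [Set.insert_inter_of_mem h1, Set.singleton_inter_eq_empty.2 h2]
        simp [h1, h2]
      · rw [Set.insert_inter_of_notMem h1, Set.inter_eq_left.2 (by rintro x rfl; assumption)]
        simp [h1, h2]
      · rw [Set.insert_inter_of_notMem h1, Set.singleton_inter_eq_empty.2 h2]
        simp [h1, h2]
    · rw [Set.disjoint_left]
      rintro c hc ⟨hc', -⟩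
      have := (h.mem_ending_iff hM.1 hσ hc.1).1 hc
      rcases hc' with rfl | rfl
      exacts [this.1 rfl, this.2 rfl]
  · push Not at hv
    have h0 : T.forkMultiplicity M v = 0 := by
      rw [forkMultiplicity, if_neg, if_neg]
      · rintro ⟨σ, hσ, h, -⟩
        exact hv σ hσ h
      · rintro ⟨σ, hσ, h, -⟩
        exact hv σ hσ h
    rw [h0, add_zero]
    congr 1
    ext c
    constructor
    · rintro ⟨rfl, -⟩
      exact ⟨rfl, fun σ hσ hc => by_contra fun h => hv σ hσ (isInterior_of_not_isEndpoint hc h)⟩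
    · exact fun hc => ⟨hc.1, hM.ending_subset_kept v hc⟩

end PlaneTree

namespace PlaneTree

variable {V : Type*} {T : PlaneTree V} {M : Finset (Finset (Sym2 V))} [Fintype V]

theorem IsSegment.card_endpoints [DecidableEq V] {σ : Finset (Sym2 V)} (h : T.IsSegment σ)
    [DecidablePred fun v => T.IsEndpoint v σ] :
    (Finset.univ.filter fun v => T.IsEndpoint v σ).card = 2 := by
  obtain ⟨a, b, h⟩ := h
  rw [← Finset.card_pair h.1]
  congr 1
  ext v
  simp [h.isEndpoint_iff]

/-- Double counting of pairs of a segment and one of its two endpoints. -/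
theorem IsSegmentPartition.sum_ncard_ending (hM : T.IsSegmentPartition M) :
    ∑ v, (T.ending M v).ncard = 2 * M.card := by
  classical
  simp only [hM.ncard_ending]
  refine (Finset.sum_card_bipartiteAbove_eq_sum_card_bipartiteBelow
    (fun σ v => T.IsEndpoint v σ)).symm.trans ?_
  refine (Finset.sum_congr rfl fun σ hσ => (hM.isSegment σ hσ).card_endpoints).trans ?_
  rw [Finset.sum_const, smul_eq_mul, mul_comm]

/-- The number of proper corners of a plane tree with a minimum segment partition. -/
theorem IsMinimumSegmentPartition.card_kept (hM : T.IsMinimumSegmentPartition M) :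
    Nat.card T.kept = 2 * M.card + T.forkSum M := by
  classical
  have : Fintype T.graph.Dart := Fintype.ofFinite _
  rw [forkSum, ← hM.1.sum_ncard_ending, ← Finset.sum_add_distrib,
    ← Finset.sum_congr rfl fun v _ => hM.ncard_kept_at v, Nat.card_coe_set_eq,
    Set.ncard_eq_toFinset_card', Finset.card_eq_sum_card_fiberwise (f := fun d => d.fst)
      (t := Finset.univ) (fun _ _ => Finset.mem_coe.2 (Finset.mem_univ _))]
  refine Finset.sum_congr rfl fun v _ => ?_
  rw [Set.ncard_eq_toFinset_card']
  congr 1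
  ext d
  simp [and_comm]

end PlaneTree

theorem mainTheorem7 {V : Type*} [Fintype V] (T : PlaneTree V)
    (M : Finset (Finset (Sym2 V))) (hM : T.IsMinimumSegmentPartition M) (hs : 2 ≤ M.card)
    (ε : ℝ) (hε : 0 < ε) :
    ∃ P : Polygon Plane (2 * M.card + T.forkSum M),
      P.IsSimple ∧ T.carrier ⊆ P.region ∧
        MeasureTheory.volume P.region ≤ ENNReal.ofReal ε := by
  -- Two segments already give four proper corners, where three are needed.
  exact T.exists_polygon hM.card_kept (by omega) hε
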